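/- Fix a real $\gamma\neq0$ and put $\gamma'=\frac1\gamma-\frac14$. Let $\mathscr P_\gamma$ be the class of equations $$i\psi_t+\psi_{xx}+\sigma|\psi|^\gamma\psi+V(t,x)\psi=0,\qquad \sigma\in\mathbb C\setminus\{0\},$$ with a smooth complex-valued potential $V$, considered for $\psi\neq0$. A point transformation is a local smooth diffeomorphism of the space of the variables $(t,x,\psi)\in\mathbb R\times\mathbb R\times\mathbb C$ (its components may depend on $t,x,\psi,\psi^*$); it maps one equation to another if its second prolongation maps the submanifold of the second-order jet space given by the first equation to the one given by the second equation. Let $\Omega\subseteq\mathbb R^2$ be an open set whose sections $\{x:(t,x)\in\Omega\}$ are all intervals (possibly empty), and let $I$ be its projection to the $t$-axis. We say that a smooth potential $V$ on $\Omega$ can be transformed to an $x$-free one (respectively, is equivalent to zero, or can be made to vanish) if every point $(t,x,\psi)$ with $(t,x)\in\Omega$, $\psi\ne0$, has a neighbourhood on which some point transformation maps the equation with the parameters $\sigma$ and $V$ to an equation from $\mathscr P_\gamma$ (with the same $\gamma$ and some nonzero constant $\tilde\sigma$) whose potential depends only on $t$ (respectively, is identically zero). Then, for every $\sigma\ne0$: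 1. $V$ can be transformed to an $x$-free potential if and only if on $\Omega$ $$V=v(t)x^2+u(t)x+\tilde w(t)+iw(t)\qquad(*)$$ with smooth real-valued functions $v,u,\tilde w,w$ on $I$. 2. If $\gamma=4$, every real-valued potential $V=v(t)x^2+u(t)x+\tilde w(t)$ with smooth real-valued $v,u,\tilde w$ on $I$ can be made to vanish. 3. If $\gamma\neq4$, a potential of the form $(*)$ with smooth real-valued $v,u,\tilde w,w$ on $I$ is equivalent to zero if and only if $16\gamma'^2v=2\gamma'w_t+w^2$ on $I$. -/

import Mathlib

open scoped ContDiff Topology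

/-- The left-hand side of `i ψ_t + ψ_xx + σ |ψ|^γ ψ + V(t,x) ψ = 0`, evaluated at `p = (t, x)`. -/
noncomputable def nlsExpr (γ : ℝ) (σ : ℂ) (V ψ : ℝ × ℝ → ℂ) (p : ℝ × ℝ) : ℂ :=
  Complex.I * deriv (fun s : ℝ => ψ (s, p.2)) p.1
    + iteratedDeriv 2 (fun y : ℝ => ψ (p.1, y)) p.2
    + σ * ((‖ψ p‖ ^ γ : ℝ) : ℂ) * ψ p + V p * ψ p

/-- A (locally defined) point transformation in the space of the variables `(t, x, ψ)`: a smooth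
diffeomorphism between two open subsets of `ℝ × ℝ × ℂ`. All components may depend, not necessarily
holomorphically, on `ψ`, i.e. they are functions of `t`, `x`, `ψ`, `ψ*`. -/
structure PointTransformation extends
    OpenPartialHomeomorph (ℝ × ℝ × ℂ) (ℝ × ℝ × ℂ) where
  contDiffOn_toFun : ContDiffOn ℝ ∞ toFun source
  contDiffOn_invFun : ContDiffOn ℝ ∞ invFun target

/-- The point of the graph of `ψ` over `p = (t, x)`. -/
def graphPoint (ψ : ℝ × ℝ → ℂ) (p : ℝ × ℝ) : ℝ × ℝ × ℂ := (p.1, p.2, ψ p)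

/-- The base point `(t, x)` of a point `(t, x, ψ)`. -/
def basePoint (z : ℝ × ℝ × ℂ) : ℝ × ℝ := (z.1, z.2.1)

/-- Near the point over `p`, the transformation `Φ` carries the graph of the smooth function `ψ`
into the graph of the smooth function `ψ'`. (As `Φ` is a diffeomorphism, this says that the 2-jet of
`ψ'` at the image base point is the image of the 2-jet of `ψ` at `p` under the prolongation
of `Φ`.) -/
def CarriesGraph (Φ : PointTransformation) (ψ ψ' : ℝ × ℝ → ℂ) (p : ℝ × ℝ) : Prop :=
  graphPoint ψ p ∈ Φ.source ∧ ContDiffAt ℝ ∞ ψ p ∧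
    ContDiffAt ℝ ∞ ψ' (basePoint (Φ.toFun (graphPoint ψ p))) ∧
    ∀ᶠ q in 𝓝 p, (Φ.toFun (graphPoint ψ q)).2.2 = ψ' (basePoint (Φ.toFun (graphPoint ψ q)))

/-- The second prolongation of `Φ` maps the manifold that the equation with the parameters
`(γ, σ, V)` defines in the second order jet space to the one that the equation with `(γ, σ', V')`
defines: a jet satisfies the first equation iff its image satisfies the second one. -/
def MapsEquation (Φ : PointTransformation) (γ : ℝ) (σ : ℂ) (V : ℝ × ℝ → ℂ)
    (σ' : ℂ) (V' : ℝ × ℝ → ℂ) : Prop :=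
  ∀ (ψ ψ' : ℝ × ℝ → ℂ) (p : ℝ × ℝ), CarriesGraph Φ ψ ψ' p →
    (nlsExpr γ σ V ψ p = 0 ↔
      nlsExpr γ σ' V' ψ' (basePoint (Φ.toFun (graphPoint ψ p))) = 0)

/-- The domain in `(t, x, ψ)`-space of an equation whose potential is given on `Ω`; the modular
nonlinearity is smooth with nonvanishing derivative in `|ψ|` exactly away from `ψ = 0`. -/
def equationDomain (Ω : Set (ℝ × ℝ)) : Set (ℝ × ℝ × ℂ) := {z | basePoint z ∈ Ω ∧ z.2.2 ≠ 0}

/-- Near the point `z` the equation with parameters `(γ, σ)` and potential `V` on `Ω` is mapped by a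
point transformation to an equation of the same class (same `γ`, some nonzero constant `σ'`) with
potential `V'` on `Ω'`. -/
def PotentialEquivNear (γ : ℝ) (σ : ℂ) (Ω : Set (ℝ × ℝ)) (V : ℝ × ℝ → ℂ)
    (Ω' : Set (ℝ × ℝ)) (V' : ℝ × ℝ → ℂ) (z : ℝ × ℝ × ℂ) : Prop :=
  ∃ (Φ : PointTransformation) (σ' : ℂ), σ' ≠ 0 ∧ z ∈ Φ.source ∧
    Φ.source ⊆ equationDomain Ω ∧ Φ.target ⊆ equationDomain Ω' ∧ MapsEquation Φ γ σ V σ' V'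

/-- The potential `V` on `Ω` can be transformed, locally, to an `x`-free one. -/
def TransformableToXFree (γ : ℝ) (σ : ℂ) (Ω : Set (ℝ × ℝ)) (V : ℝ × ℝ → ℂ) : Prop :=
  ∀ z ∈ equationDomain Ω, ∃ (K : Set ℝ) (W : ℝ → ℂ), IsOpen K ∧ ContDiffOn ℝ ∞ W K ∧
    PotentialEquivNear γ σ Ω V (K ×ˢ Set.univ) (fun q => W q.1) z

/-- The potential `V` on `Ω` is, locally, equivalent to zero (can be made to vanish). -/
def EquivalentToZero (γ : ℝ) (σ : ℂ) (Ω : Set (ℝ × ℝ)) (V : ℝ × ℝ → ℂ) : Prop :=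
  ∀ z ∈ equationDomain Ω, PotentialEquivNear γ σ Ω V Set.univ (fun _ => 0) z

/-- The potential `v(t) x² + u(t) x + w₁(t) + i w(t)` with real-valued coefficients. -/
noncomputable def quadraticPotential (v u w₁ w : ℝ → ℝ) (p : ℝ × ℝ) : ℂ :=
  ((v p.1 * p.2 ^ 2 + u p.1 * p.2 + w₁ p.1 : ℝ) : ℂ) + Complex.I * ((w p.1 : ℝ) : ℂ)

/-- The constant `γ' = 1/γ - 1/4`. -/
noncomputable def gammaPrime (γ : ℝ) : ℝ := 1 / γ - 1 / 4

section

open scoped ComplexConjugate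
open Asymptotics Filter

/-! Necessity. A point transformation `(T, X, Ψ)` between two equations of the class is determined
by moving jets inside the solution manifold. The equation does not contain `ψ_tt`, so varying `ψ_tt`
alone shows that `T` depends on `t` only (`fst_eq_zero_of_totalBase_eq`, `eq_zero_of_generic`).
Varying `(ψ_t, ψ_xx)` by `(i c, c)` shows that `X` does not depend on `ψ`, that `X_x² = |T_t|`, and
that the differential of `Ψ` in `ψ` is complex linear or antilinear according to the sign of `T_t`
(`comparison_relation`, `firstOrderStructure`). The reflection `(-t, x, ψ*)` removes the case `T_t <
0`. Thus `T' = s²` and `X = s x + η` with functions `s, η` of `t` (`exists_base_normalForm`).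

The transformed equation is then polynomial in the free variable `ψ_x`. Its coefficients give `Ψ = A
ψ + B` with `A_x = i h A`, `h = (s' x + η') / (2 s)` (`exists_amplitude`). The remaining identity in
`ψ` compares `|ψ|^γ ψ` with `|Aψ + B|^γ (Aψ + B)` modulo affine functions, and `affine_rigidity`
forces `B = 0`, `σ = s² σ' |A|^γ` and a formula for `V`. With `k = s' / (2s)` and `m = η' / (2s)`,
integration in `x` gives `A = C(t) exp(i (k x² / 2 + m x))`. Hence `V` is quadratic in `x`, with
leading coefficient `v = k² - k' / 2` and a real linear coefficient. Since `s² |C|^γ` is constant,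
`Re (C' / C) = -4 k / γ`. If the target potential is zero, then `w = k - 4 k / γ = -4 γ' k`, and
eliminating `k` from the formulas for `v` and `w` gives the condition of the third claim.

Sufficiency. The Riccati equation `k' = 2 k² - 2 v` is linearised by `k = -y' / (2y)` to `y'' = 4 v
y`. Any positive local solution `y` yields a transformation with `s = 1 / y` whose target potential
is `i (y² w - 2 γ' y y')` (`potentialEquivNear_of_ode`), which is `x`-free. It vanishes if `γ' = 0`
and `w = 0`. If `γ' ≠ 0`, it vanishes for `y = exp ∫ w / (2 γ')`, and the condition says precisely
that this `y` solves the linear equation. -/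

/-! ### Second-order expansions and derivatives of curves -/

theorem taylor_two_isLittleO {E : Type*} [NormedAddCommGroup E] [NormedSpace ℝ E] {g : ℝ → E}
    {x₀ : ℝ} (hg : ContDiffAt ℝ 2 g x₀) :
    (fun s => g (x₀ + s) - g x₀ - s • deriv g x₀ - (s ^ 2 / 2) • iteratedDeriv 2 g x₀)
      =o[𝓝 0] fun s : ℝ => s ^ 2 := by
  obtain ⟨r, hr, hball⟩ : ∃ r > 0, ContDiffOn ℝ 2 g (Metric.ball x₀ r) := by
    obtain ⟨u, hu, h⟩ := hg.contDiffOn le_rfl (by simp)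
    obtain ⟨r, hr, hru⟩ := Metric.mem_nhds_iff.1 (by simpa using hu)
    exact ⟨r, hr, h.mono (hru)⟩
  have hx : x₀ ∈ Metric.ball x₀ r := Metric.mem_ball_self hr
  have h := taylor_isLittleO (convex_ball x₀ r) hx (n := 2) hball
  rw [Metric.isOpen_ball.nhdsWithin_eq hx] at h
  have ht : Tendsto (fun s : ℝ => x₀ + s) (𝓝 0) (𝓝 x₀) := by
    have : ContinuousAt (fun s : ℝ => x₀ + s) 0 := by fun_prop
    simpa [ContinuousAt] using this
  have h2 := h.comp_tendsto ht
  refine (h2.congr' ?_ ?_)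
  · refine Eventually.of_forall fun s => ?_
    have e2 : iteratedDerivWithin 2 g (Metric.ball x₀ r) x₀ = iteratedDeriv 2 g x₀ :=
      iteratedDerivWithin_of_isOpen Metric.isOpen_ball hx
    have e1 : iteratedDerivWithin 1 g (Metric.ball x₀ r) x₀ = deriv g x₀ := by
      rw [iteratedDerivWithin_of_isOpen Metric.isOpen_ball hx, iteratedDeriv_one]
    simp only [Function.comp_apply, taylorWithinEval_succ, taylor_within_zero_eval, e1, e2,
      zero_add, add_sub_cancel_left]
    norm_num
    rw [show s ^ 2 / 2 = (1 / 2) * s ^ 2 by ring]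
    abel
  · exact Eventually.of_forall fun s => by simp

/-- Uniqueness of the second-order Taylor polynomial. Comparing two transported graphs yields only
an `o(s²)` statement, and this turns it into the derivatives that occur in the equation. -/
theorem derivs_of_isLittleO_sq {E : Type*} [NormedAddCommGroup E] [NormedSpace ℝ E] {g : ℝ → E}
    {x₀ : ℝ} (hg : ContDiffAt ℝ 2 g x₀) {k : E}
    (h : (fun s => g (x₀ + s) - s ^ 2 • k) =o[𝓝 0] fun s : ℝ => s ^ 2) :
    g x₀ = 0 ∧ deriv g x₀ = 0 ∧ iteratedDeriv 2 g x₀ = (2 : ℝ) • k := by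
  have hT := taylor_two_isLittleO hg
  have h0 : g x₀ = 0 := by
    have := h.isBigO.eq_zero_imp
    have := this.self_of_nhds (by simp)
    simpa using this
  have hd := hT.sub h
  simp only [h0] at hd
  have h1 : deriv g x₀ = 0 := by
    have hs : (fun s : ℝ => s ^ 2) =o[𝓝 0] fun s : ℝ => s := by
      simpa using isLittleO_pow_pow (𝕜 := ℝ) (show 1 < 2 by norm_num)
    have hA : (fun s : ℝ => s • deriv g x₀) =o[𝓝 0] fun s : ℝ => s := by
      have a1 := hd.trans_isBigO hs.isBigO
      have a2 : (fun s : ℝ => s ^ 2 • (k - (1 / 2 : ℝ) • iteratedDeriv 2 g x₀)) =o[𝓝 0]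
          fun s : ℝ => s := by
        have := hs.smul_isBigO (isBigO_refl
          (fun _ : ℝ => k - (1 / 2 : ℝ) • iteratedDeriv 2 g x₀) (𝓝 (0:ℝ)))
        refine this.trans_isBigO ?_
        refine IsBigO.of_bound ‖k - (1 / 2 : ℝ) • iteratedDeriv 2 g x₀‖ ?_
        refine Eventually.of_forall fun s => ?_
        rw [norm_smul, mul_comm]
      refine (a2.sub a1).congr_left fun s => ?_
      module
    have hB : HasDerivAt (fun s : ℝ => s • deriv g x₀) 0 0 := by
      rw [hasDerivAt_iff_isLittleO]
      simpa using hA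
    have hC : HasDerivAt (fun s : ℝ => s • deriv g x₀) (deriv g x₀) 0 := by
      simpa using (hasDerivAt_id (0:ℝ)).smul_const (deriv g x₀)
    exact hC.unique hB
  refine ⟨h0, h1, ?_⟩
  simp only [h1] at hd
  have hc : (fun s : ℝ => s ^ 2 • (k - (1 / 2 : ℝ) • iteratedDeriv 2 g x₀)) =o[𝓝 0]
      fun s : ℝ => s ^ 2 := by
    refine hd.congr_left fun s => ?_
    module
  have hz : k - (1 / 2 : ℝ) • iteratedDeriv 2 g x₀ = 0 := by
    rw [← norm_eq_zero]
    by_contra hne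
    have hpos : 0 < ‖k - (1 / 2 : ℝ) • iteratedDeriv 2 g x₀‖ :=
      lt_of_le_of_ne (norm_nonneg _) (Ne.symm hne)
    have := hc.def (half_pos hpos)
    obtain ⟨r, hr, hb⟩ := Metric.eventually_nhds_iff.1 this
    have := @hb (r / 2) (by rw [Real.dist_eq, sub_zero, abs_of_pos (by positivity)]; linarith)
    rw [norm_smul] at this
    have h3 : 0 < ‖(r / 2) ^ 2‖ := norm_pos_iff.2 (by positivity)
    nlinarith
  rw [sub_eq_zero] at hz
  rw [hz, smul_smul]; norm_num

theorem iteratedDeriv_two_eq {E : Type*} [NormedAddCommGroup E] [NormedSpace ℝ E] {g : ℝ → E}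
    {g' : ℝ → E} {g'' : E} {x : ℝ} (h1 : ∀ᶠ y in 𝓝 x, HasDerivAt g (g' y) y)
    (h2 : HasDerivAt g' g'' x) : iteratedDeriv 2 g x = g'' := by
  rw [iteratedDeriv_succ, iteratedDeriv_one]
  have : deriv g =ᶠ[𝓝 x] g' := h1.mono fun y hy => hy.deriv
  rw [this.deriv_eq, h2.deriv]

theorem ContDiffAt.eventually_hasDerivAt {E : Type*} [NormedAddCommGroup E] [NormedSpace ℝ E]
    {g : ℝ → E} {x : ℝ} {n : WithTop ℕ∞} (hg : ContDiffAt ℝ n g x) (hn : 2 ≤ n) :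
    (∀ᶠ y in 𝓝 x, HasDerivAt g (deriv g y) y) ∧
      HasDerivAt (deriv g) (iteratedDeriv 2 g x) x := by
  have hg2 := hg.of_le hn
  constructor
  · have := (hg2.of_le one_le_two).eventually (by simp)
    exact this.mono fun y hy => (hy.differentiableAt (by simp)).hasDerivAt
  · rw [iteratedDeriv_succ, iteratedDeriv_one]
    have : DifferentiableAt ℝ (iteratedDeriv 1 g) x := by
      rw [iteratedDeriv_one]
      have h := hg2.fderiv_right (m := 1) (by norm_num)
      exact ((h.clm_apply contDiffAt_const).differentiableAt (by simp)).congr_of_eventuallyEq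
        (Eventually.of_forall fun y => (fderiv_apply_one_eq_deriv (f := g) (x := y)).symm)
    rw [iteratedDeriv_one] at this
    exact this.hasDerivAt

theorem iteratedDeriv_two_comp {E : Type*} [NormedAddCommGroup E] [NormedSpace ℝ E] {g : ℝ → E}
    {r : ℝ → ℝ} {x : ℝ} (hg : ContDiffAt ℝ 2 g (r x)) (hr : ContDiffAt ℝ 2 r x) :
    iteratedDeriv 2 (fun y => g (r y)) x =
      (deriv r x) ^ 2 • iteratedDeriv 2 g (r x) + iteratedDeriv 2 r x • deriv g (r x) := by
  obtain ⟨hr1, hr2⟩ := hr.eventually_hasDerivAt le_rfl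
  obtain ⟨hg1, hg2⟩ := hg.eventually_hasDerivAt le_rfl
  have hev := hr.continuousAt.eventually hg1
  refine iteratedDeriv_two_eq (g' := fun y => deriv r y • deriv g (r y)) ?_ ?_
  · filter_upwards [hr1, hev] with y h1 h2
    exact h2.scomp y h1
  · have := hr2.smul (hg2.scomp x hr1.self_of_nhds)
    rw [sq, mul_smul]
    exact this

/-! ### Polynomial test functions with a prescribed jet -/

/-- The polynomial with prescribed jet at the point `p`. -/
noncomputable def jetPoly (p : ℝ × ℝ) (a e b c d : ℂ) (q : ℝ × ℝ) : ℂ :=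
  a + ((q.1 - p.1 : ℝ) : ℂ) * e + ((q.2 - p.2 : ℝ) : ℂ) * b + (((q.2 - p.2) ^ 2 / 2 : ℝ) : ℂ) * c
    + (((q.1 - p.1) ^ 2 : ℝ) : ℂ) * d

theorem jetPoly_self (p : ℝ × ℝ) (a e b c d : ℂ) : jetPoly p a e b c d p = a := by
  simp [jetPoly]

theorem contDiff_jetPoly (p : ℝ × ℝ) (a e b c d : ℂ) {n : WithTop ℕ∞} :
    ContDiff ℝ n (jetPoly p a e b c d) := by
  have h1 : ContDiff ℝ n (fun q : ℝ × ℝ => ((q.1 - p.1 : ℝ) : ℂ)) :=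
    Complex.ofRealCLM.contDiff.comp (contDiff_fst.sub contDiff_const)
  have h2 : ContDiff ℝ n (fun q : ℝ × ℝ => ((q.2 - p.2 : ℝ) : ℂ)) :=
    Complex.ofRealCLM.contDiff.comp (contDiff_snd.sub contDiff_const)
  have h3 : ContDiff ℝ n (fun q : ℝ × ℝ => (((q.2 - p.2) ^ 2 / 2 : ℝ) : ℂ)) :=
    Complex.ofRealCLM.contDiff.comp (((contDiff_snd.sub contDiff_const).pow 2).div_const 2)
  have h4 : ContDiff ℝ n (fun q : ℝ × ℝ => (((q.1 - p.1) ^ 2 : ℝ) : ℂ)) :=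
    Complex.ofRealCLM.contDiff.comp ((contDiff_fst.sub contDiff_const).pow 2)
  exact ((((contDiff_const.add (h1.mul contDiff_const)).add (h2.mul contDiff_const)).add
    (h3.mul contDiff_const)).add (h4.mul contDiff_const))

theorem hasDerivAt_jetPoly_fst (p : ℝ × ℝ) (a e b c d : ℂ) (x t : ℝ) :
    HasDerivAt (fun s => jetPoly p a e b c d (s, x)) (e + ((2 * (t - p.1) : ℝ) : ℂ) * d) t := by
  have h1 : HasDerivAt (fun s : ℝ => ((s - p.1 : ℝ) : ℂ)) 1 t := by
    simpa using ((hasDerivAt_id t).sub_const p.1).ofReal_comp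
  have h2 : HasDerivAt (fun s : ℝ => (((s - p.1) ^ 2 : ℝ) : ℂ)) ((2 * (t - p.1) : ℝ) : ℂ) t := by
    have := (((hasDerivAt_id t).sub_const p.1).pow 2).ofReal_comp
    simpa using this
  have := ((((hasDerivAt_const t a).add (h1.mul_const e)).add
    (hasDerivAt_const t (((x - p.2 : ℝ) : ℂ) * b))).add
    (hasDerivAt_const t ((((x - p.2) ^ 2 / 2 : ℝ) : ℂ) * c))).add (h2.mul_const d)
  refine this.congr_deriv ?_
  ring

theorem hasDerivAt_jetPoly_snd (p : ℝ × ℝ) (a e b c d : ℂ) (t x : ℝ) :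
    HasDerivAt (fun y => jetPoly p a e b c d (t, y)) (b + ((x - p.2 : ℝ) : ℂ) * c) x := by
  have h1 : HasDerivAt (fun s : ℝ => ((s - p.2 : ℝ) : ℂ)) 1 x := by
    simpa using ((hasDerivAt_id x).sub_const p.2).ofReal_comp
  have h2 : HasDerivAt (fun s : ℝ => (((s - p.2) ^ 2 / 2 : ℝ) : ℂ)) ((x - p.2 : ℝ) : ℂ) x := by
    have := ((((hasDerivAt_id x).sub_const p.2).pow 2).div_const 2).ofReal_comp
    refine this.congr_deriv ?_
    push_cast; simp
  have := ((((hasDerivAt_const x a).add (hasDerivAt_const x (((t - p.1 : ℝ) : ℂ) * e))).add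
    (h1.mul_const b)).add (h2.mul_const c)).add
    (hasDerivAt_const x ((((t - p.1) ^ 2 : ℝ) : ℂ) * d))
  refine this.congr_deriv ?_
  ring

theorem deriv_jetPoly_fst (p : ℝ × ℝ) (a e b c d : ℂ) :
    deriv (fun s => jetPoly p a e b c d (s, p.2)) p.1 = e := by
  rw [(hasDerivAt_jetPoly_fst p a e b c d p.2 p.1).deriv]; simp

theorem iteratedDeriv_jetPoly_snd (p : ℝ × ℝ) (a e b c d : ℂ) :
    iteratedDeriv 2 (fun y => jetPoly p a e b c d (p.1, y)) p.2 = c := by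
  refine iteratedDeriv_two_eq
    (Eventually.of_forall fun y => hasDerivAt_jetPoly_snd p a e b c d p.1 y) ?_
  have h1 : HasDerivAt (fun s : ℝ => ((s - p.2 : ℝ) : ℂ)) 1 p.2 := by
    simpa using ((hasDerivAt_id p.2).sub_const p.2).ofReal_comp
  simpa using (h1.mul_const c).const_add b

/-- Neither `b` (the value of `ψ_x`) nor `d` (half of `ψ_tt`) appears on the right. These are the
free directions along which a jet can be moved without leaving the solution manifold. -/
theorem nlsExpr_jetPoly (γ : ℝ) (σ : ℂ) (V : ℝ × ℝ → ℂ) (p : ℝ × ℝ) (a e b c d : ℂ) :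
    nlsExpr γ σ V (jetPoly p a e b c d) p =
      Complex.I * e + c + σ * ((‖a‖ ^ γ : ℝ) : ℂ) * a + V p * a := by
  rw [nlsExpr, deriv_jetPoly_fst, iteratedDeriv_jetPoly_snd, jetPoly_self]

theorem fderiv_jetPoly (p : ℝ × ℝ) (a e b c d : ℂ) (v : ℝ × ℝ) :
    fderiv ℝ (jetPoly p a e b c d) p v = v.1 • e + v.2 • b := by
  have hd : DifferentiableAt ℝ (jetPoly p a e b c d) p :=
    (contDiff_jetPoly p a e b c d (n := 1)).differentiable (by simp) p
  have h1 : HasDerivAt (fun s : ℝ => ((s, p.2) : ℝ × ℝ)) (1, 0) p.1 :=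
    (hasDerivAt_id p.1).prodMk (hasDerivAt_const _ _)
  have h2 : HasDerivAt (fun s : ℝ => ((p.1, s) : ℝ × ℝ)) (0, 1) p.2 :=
    (hasDerivAt_const _ _).prodMk (hasDerivAt_id p.2)
  have e1 := (hd.hasFDerivAt.comp_hasDerivAt_of_eq p.1 h1 rfl).unique
    (hasDerivAt_jetPoly_fst p a e b c d p.2 p.1)
  have e2 := (hd.hasFDerivAt.comp_hasDerivAt_of_eq p.2 h2 rfl).unique
    (hasDerivAt_jetPoly_snd p a e b c d p.1 p.2)
  have : v = v.1 • ((1, 0) : ℝ × ℝ) + v.2 • ((0, 1) : ℝ × ℝ) := by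
    ext <;> simp
  rw [this, map_add, map_smul, map_smul, e1, e2]
  simp

/-! ### Base projection and local inverses -/

/-- The projection `basePoint` as a continuous linear map. -/
noncomputable def basePointCLM : ℝ × ℝ × ℂ →L[ℝ] ℝ × ℝ :=
  (ContinuousLinearMap.fst ℝ ℝ (ℝ × ℂ)).prod
    ((ContinuousLinearMap.fst ℝ ℝ ℂ).comp (ContinuousLinearMap.snd ℝ ℝ (ℝ × ℂ)))

theorem basePointCLM_apply (z : ℝ × ℝ × ℂ) : basePointCLM z = basePoint z := rfl

theorem contDiff_basePoint {n : WithTop ℕ∞} : ContDiff ℝ n basePoint := basePointCLM.contDiff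

theorem exists_local_inverse {E F : Type*} [NormedAddCommGroup E] [NormedSpace ℝ E]
    [NormedAddCommGroup F] [NormedSpace ℝ F] [CompleteSpace E]
    {β : E → F} {p : E} (hβ : ContDiffAt ℝ ∞ β p) {B : E ≃L[ℝ] F}
    (hB : HasFDerivAt β (B : E →L[ℝ] F) p) :
    ∃ h : F → E, ContDiffAt ℝ ∞ h (β p) ∧ h (β p) = p ∧
      HasFDerivAt h (B.symm : F →L[ℝ] E) (β p) ∧
      (∀ᶠ q in 𝓝 p, h (β q) = q) ∧ ∀ᶠ r in 𝓝 (β p), β (h r) = r := by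
  have hs : HasStrictFDerivAt β (B : E →L[ℝ] F) p := hβ.hasStrictFDerivAt' hB (by simp)
  refine ⟨hs.localInverse β B p, hβ.to_localInverse hB (by simp), hs.localInverse_apply_image,
    hs.to_localInverse.hasFDerivAt, hs.eventually_left_inverse, hs.eventually_right_inverse⟩

theorem exists_equiv_of_injective {E : Type*} [NormedAddCommGroup E] [NormedSpace ℝ E]
    [FiniteDimensional ℝ E] (L : E →L[ℝ] E) (hL : ∀ v, L v = 0 → v = 0) :
    ∃ B : E ≃L[ℝ] E, (B : E →L[ℝ] E) = L := by
  have hi : Function.Injective (L : E →ₗ[ℝ] E) :=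
    (injective_iff_map_eq_zero _).2 hL
  refine ⟨(LinearEquiv.ofInjectiveEndo (L : E →ₗ[ℝ] E) hi).toContinuousLinearEquiv, ?_⟩
  ext v
  simp

/-! ### Graphs transported by a point transformation -/

namespace PointTransformation

variable (Φ : PointTransformation)

/-- The base map `q ↦ (t̃, x̃)` induced on the graph of `ψ`. -/
def baseMap (ψ : ℝ × ℝ → ℂ) (q : ℝ × ℝ) : ℝ × ℝ := basePoint (Φ.toFun (graphPoint ψ q))

variable {Φ}

theorem contDiffAt {z : ℝ × ℝ × ℂ} (hz : z ∈ Φ.source) : ContDiffAt ℝ ∞ Φ.toFun z :=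
  Φ.contDiffOn_toFun.contDiffAt (Φ.open_source.mem_nhds hz)

theorem hasFDerivAt {z : ℝ × ℝ × ℂ} (hz : z ∈ Φ.source) :
    HasFDerivAt Φ.toFun (fderiv ℝ Φ.toFun z) z :=
  ((contDiffAt hz).differentiableAt (by simp)).hasFDerivAt

theorem fderiv_inverse {z : ℝ × ℝ × ℂ} (hz : z ∈ Φ.source) :
    (∀ v, fderiv ℝ Φ.invFun (Φ.toFun z) (fderiv ℝ Φ.toFun z v) = v) ∧
      ∀ v, fderiv ℝ Φ.toFun z (fderiv ℝ Φ.invFun (Φ.toFun z) v) = v := by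
  have hz' : Φ.toFun z ∈ Φ.target := Φ.map_source' hz
  have h1 := hasFDerivAt hz
  have h2 : HasFDerivAt Φ.invFun (fderiv ℝ Φ.invFun (Φ.toFun z)) (Φ.toFun z) :=
    ((Φ.contDiffOn_invFun.contDiffAt (Φ.open_target.mem_nhds hz')).differentiableAt
      (by simp)).hasFDerivAt
  have e1 : HasFDerivAt (Φ.invFun ∘ Φ.toFun) (ContinuousLinearMap.id ℝ _) z := by
    refine (hasFDerivAt_id z).congr_of_eventuallyEq ?_
    filter_upwards [Φ.open_source.mem_nhds hz] with y hy
    exact Φ.left_inv' hy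
  have e2 : HasFDerivAt (Φ.toFun ∘ Φ.invFun) (ContinuousLinearMap.id ℝ _) (Φ.toFun z) := by
    refine (hasFDerivAt_id _).congr_of_eventuallyEq ?_
    filter_upwards [Φ.open_target.mem_nhds hz'] with y hy
    exact Φ.right_inv' hy
  have h1' : HasFDerivAt Φ.toFun (fderiv ℝ Φ.toFun z) (Φ.invFun (Φ.toFun z)) := by
    rw [Φ.left_inv' hz]; exact h1
  have c1 := (h2.comp z h1).unique e1
  have c2 := (h1'.comp _ h2).unique e2
  exact ⟨fun v => DFunLike.congr_fun c1 v, fun v => DFunLike.congr_fun c2 v⟩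

theorem fderiv_injective {z : ℝ × ℝ × ℂ} (hz : z ∈ Φ.source) {v w : ℝ × ℝ × ℂ}
    (h : fderiv ℝ Φ.toFun z v = fderiv ℝ Φ.toFun z w) : v = w := by
  rw [← (fderiv_inverse hz).1 v, h, (fderiv_inverse hz).1 w]

theorem contDiffAt_graphPoint {ψ : ℝ × ℝ → ℂ} {p : ℝ × ℝ} {n : WithTop ℕ∞}
    (hψ : ContDiffAt ℝ n ψ p) : ContDiffAt ℝ n (graphPoint ψ) p :=
  contDiffAt_fst.prodMk (contDiffAt_snd.prodMk hψ)

theorem hasFDerivAt_graphPoint {ψ : ℝ × ℝ → ℂ} {p : ℝ × ℝ} {ψ' : ℝ × ℝ →L[ℝ] ℂ}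
    (hψ : HasFDerivAt ψ ψ' p) :
    HasFDerivAt (graphPoint ψ) ((ContinuousLinearMap.fst ℝ ℝ ℝ).prod
      ((ContinuousLinearMap.snd ℝ ℝ ℝ).prod ψ')) p :=
  hasFDerivAt_fst.prodMk (hasFDerivAt_snd.prodMk hψ)

/-- The total derivative of the base map along a graph with the first jet `(e, b)`. -/
noncomputable def totalBase (D : ℝ × ℝ × ℂ →L[ℝ] ℝ × ℝ × ℂ) (e b : ℂ) (v : ℝ × ℝ) : ℝ × ℝ :=
  basePoint (D (v.1, v.2, v.1 • e + v.2 • b))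

theorem contDiffAt_baseMap {ψ : ℝ × ℝ → ℂ} {p : ℝ × ℝ} (hz : graphPoint ψ p ∈ Φ.source)
    (hψ : ContDiffAt ℝ ∞ ψ p) : ContDiffAt ℝ ∞ (Φ.baseMap ψ) p :=
  contDiff_basePoint.contDiffAt.comp p ((contDiffAt hz).comp p (contDiffAt_graphPoint hψ))

theorem hasFDerivAt_baseMap {ψ : ℝ × ℝ → ℂ} {p : ℝ × ℝ} (hz : graphPoint ψ p ∈ Φ.source)
    (hψ : ContDiffAt ℝ ∞ ψ p) {e b : ℂ} (he : ∀ v, fderiv ℝ ψ p v = v.1 • e + v.2 • b) :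
    ∃ L : ℝ × ℝ →L[ℝ] ℝ × ℝ, HasFDerivAt (Φ.baseMap ψ) L p ∧
      ∀ v, L v = totalBase (fderiv ℝ Φ.toFun (graphPoint ψ p)) e b v := by
  refine ⟨_, basePointCLM.hasFDerivAt.comp p ((hasFDerivAt hz).comp p
    (hasFDerivAt_graphPoint (hψ.differentiableAt (by simp)).hasFDerivAt)), fun v => ?_⟩
  simp [totalBase, basePointCLM_apply, he]

theorem exists_baseMap_equiv {ψ : ℝ × ℝ → ℂ} {p : ℝ × ℝ} (hz : graphPoint ψ p ∈ Φ.source)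
    (hψ : ContDiffAt ℝ ∞ ψ p) {e b : ℂ} (he : ∀ v, fderiv ℝ ψ p v = v.1 • e + v.2 • b)
    (hinj : ∀ v, totalBase (fderiv ℝ Φ.toFun (graphPoint ψ p)) e b v = 0 → v = 0) :
    ∃ B : (ℝ × ℝ) ≃L[ℝ] ℝ × ℝ, HasFDerivAt (Φ.baseMap ψ) (B : ℝ × ℝ →L[ℝ] ℝ × ℝ) p ∧
      ∀ v, B v = totalBase (fderiv ℝ Φ.toFun (graphPoint ψ p)) e b v := by
  obtain ⟨L, hL, hLv⟩ := hasFDerivAt_baseMap hz hψ he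
  obtain ⟨B, hB⟩ := exists_equiv_of_injective L fun v hv => hinj v (by rw [← hLv, hv])
  refine ⟨B, by rw [hB]; exact hL, fun v => ?_⟩
  rw [← hLv, ← hB]; rfl

/-- If the base map along the graph has invertible differential, the image of the graph is again
locally a graph: its function is the field component composed with the inverse of the base map. -/
theorem exists_carriesGraph {ψ : ℝ × ℝ → ℂ} {p : ℝ × ℝ} (hz : graphPoint ψ p ∈ Φ.source)
    (hψ : ContDiffAt ℝ ∞ ψ p) {e b : ℂ} (he : ∀ v, fderiv ℝ ψ p v = v.1 • e + v.2 • b)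
    (hinj : ∀ v, totalBase (fderiv ℝ Φ.toFun (graphPoint ψ p)) e b v = 0 → v = 0) :
    ∃ ψ', CarriesGraph Φ ψ ψ' p := by
  obtain ⟨B, hB, -⟩ := exists_baseMap_equiv hz hψ he hinj
  obtain ⟨h, hh, hhp, -, hl, -⟩ := exists_local_inverse (contDiffAt_baseMap hz hψ) hB
  refine ⟨fun r => (Φ.toFun (graphPoint ψ (h r))).2.2, hz, hψ, ?_, ?_⟩
  · have h1 : ContDiffAt ℝ ∞ (fun q => (Φ.toFun (graphPoint ψ q)).2.2) p :=
      contDiffAt_snd.comp p (contDiffAt_snd.comp p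
        ((contDiffAt hz).comp p (contDiffAt_graphPoint hψ)))
    exact ContDiffAt.comp (g := fun q => (Φ.toFun (graphPoint ψ q)).2.2) (Φ.baseMap ψ p)
      (by rw [hhp]; exact h1) hh
  · filter_upwards [hl] with q hq
    show _ = (Φ.toFun (graphPoint ψ (h (Φ.baseMap ψ q)))).2.2
    rw [hq]

theorem _root_.CarriesGraph.fderiv_apply {ψ ψ' : ℝ × ℝ → ℂ} {p : ℝ × ℝ}
    (h : CarriesGraph Φ ψ ψ' p) {e b : ℂ} (he : ∀ v, fderiv ℝ ψ p v = v.1 • e + v.2 • b)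
    (v : ℝ × ℝ) :
    fderiv ℝ ψ' (Φ.baseMap ψ p) (totalBase (fderiv ℝ Φ.toFun (graphPoint ψ p)) e b v) =
      (fderiv ℝ Φ.toFun (graphPoint ψ p) (v.1, v.2, v.1 • e + v.2 • b)).2.2 := by
  obtain ⟨hz, hψ, hψ', heq⟩ := h
  obtain ⟨L, hL, hLv⟩ := hasFDerivAt_baseMap hz hψ he
  have h1 : HasFDerivAt (fun q => ψ' (Φ.baseMap ψ q))
      ((fderiv ℝ ψ' (Φ.baseMap ψ p)).comp L) p :=
    HasFDerivAt.comp p (hψ'.differentiableAt (by simp)).hasFDerivAt hL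
  have h2 := ((hasFDerivAt hz).comp p
    (hasFDerivAt_graphPoint (hψ.differentiableAt (by simp)).hasFDerivAt)).snd.snd
  have h3 := (h1.congr_of_eventuallyEq heq).unique h2
  have h4 := DFunLike.congr_fun h3 v
  simp only [ContinuousLinearMap.comp_apply, hLv] at h4
  rw [h4]
  simp [he]

/-- Comparison of a fixed solution graph with all graphs through the same point. -/
theorem exists_comparison {ψ ψ' : ℝ × ℝ → ℂ} {p : ℝ × ℝ} (h : CarriesGraph Φ ψ ψ' p) {e b : ℂ}
    (he : ∀ v, fderiv ℝ ψ p v = v.1 • e + v.2 • b)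
    (hinj : ∀ v, totalBase (fderiv ℝ Φ.toFun (graphPoint ψ p)) e b v = 0 → v = 0) :
    ∃ M : ℂ →L[ℝ] ℂ, (∀ c, M c = 0 → c = 0) ∧
      (∀ c, M c = (fderiv ℝ Φ.toFun (graphPoint ψ p) (0, 0, c)).2.2 -
        fderiv ℝ ψ' (Φ.baseMap ψ p)
          (basePoint (fderiv ℝ Φ.toFun (graphPoint ψ p) (0, 0, c)))) ∧
      ∀ ψ₂ ψ₂', CarriesGraph Φ ψ₂ ψ₂' p → ψ₂ p = ψ p →
        (fun q => ψ₂' (Φ.baseMap ψ₂ q) - ψ' (Φ.baseMap ψ₂ q) - M (ψ₂ q - ψ q))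
          =o[𝓝 p] fun q => ψ₂ q - ψ q := by
  have hcg := h
  obtain ⟨hz, hψ, hψ', heq⟩ := h
  set z := graphPoint ψ p with hzdef
  set D := fderiv ℝ Φ.toFun z with hD
  -- `F` is the vertical defect of the image point from the graph of `ψ'`. It vanishes along the
  -- graph of `ψ`, and along the graph of `ψ₂` it equals the difference `ψ₂' - ψ'` at the image base
  -- point. Both graph points move with `q`, so strict differentiability of `F` is what is needed.
  let F : ℝ × ℝ × ℂ → ℂ := fun y => (Φ.toFun y).2.2 - ψ' (basePoint (Φ.toFun y))
  have hFs : ContDiffAt ℝ ∞ F z := by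
    refine ContDiffAt.sub (contDiffAt_snd.comp z (contDiffAt_snd.comp z (contDiffAt hz))) ?_
    exact ContDiffAt.comp z hψ' (contDiff_basePoint.contDiffAt.comp z (contDiffAt hz))
  have hFd : HasFDerivAt F (((ContinuousLinearMap.snd ℝ ℝ ℂ).comp
      ((ContinuousLinearMap.snd ℝ ℝ (ℝ × ℂ)).comp D)) -
      (fderiv ℝ ψ' (Φ.baseMap ψ p)).comp (basePointCLM.comp D)) z := by
    refine (hasFDerivAt hz).snd.snd.sub ?_
    exact HasFDerivAt.comp z (hψ'.differentiableAt (by simp)).hasFDerivAt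
      (basePointCLM.hasFDerivAt.comp z (hasFDerivAt hz))
  set F' := (((ContinuousLinearMap.snd ℝ ℝ ℂ).comp
      ((ContinuousLinearMap.snd ℝ ℝ (ℝ × ℂ)).comp D)) -
      (fderiv ℝ ψ' (Φ.baseMap ψ p)).comp (basePointCLM.comp D)) with hF'
  have hstrict : HasStrictFDerivAt F F' z := hFs.hasStrictFDerivAt' hFd (by simp)
  let M : ℂ →L[ℝ] ℂ := F'.comp ((ContinuousLinearMap.inr ℝ ℝ (ℝ × ℂ)).comp
    (ContinuousLinearMap.inr ℝ ℝ ℂ))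
  have hM : ∀ c, M c = (D (0, 0, c)).2.2 - fderiv ℝ ψ' (Φ.baseMap ψ p)
      (basePoint (D (0, 0, c))) := fun c => rfl
  refine ⟨M, fun c hc => ?_, hM, ?_⟩
  · obtain ⟨B, -, hB⟩ := exists_baseMap_equiv hz hψ he hinj
    obtain ⟨v, hv⟩ := B.surjective (basePoint (D (0, 0, c)))
    rw [hB] at hv
    have h1 := hcg.fderiv_apply he v
    rw [hv] at h1
    rw [hM, h1, sub_eq_zero] at hc
    -- If `M c = 0`, the image of the vertical vector is tangent to the image graph, hence is the
    -- image of a vector tangent to the graph of `ψ`. Injectivity of `D` makes the vertical vector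
    -- itself tangent to a graph, which forces `c = 0`.
    have h2 : D (0, 0, c) = D (v.1, v.2, v.1 • e + v.2 • b) := by
      refine Prod.ext ?_ (Prod.ext ?_ hc)
      · exact (congrArg Prod.fst hv).symm
      · exact (congrArg Prod.snd hv).symm
    have h3 := fderiv_injective hz h2
    simp only [Prod.mk.injEq] at h3
    obtain ⟨h31, h32, h33⟩ := h3
    rw [h33, ← h31, ← h32]; simp
  · intro ψ₂ ψ₂' h₂ hp
    obtain ⟨hz₂, hψ₂, -, heq₂⟩ := h₂
    have hg : graphPoint ψ₂ p = z := by simp [graphPoint, hzdef, hp]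
    have ht1 : Tendsto (graphPoint ψ) (𝓝 p) (𝓝 z) := (contDiffAt_graphPoint hψ).continuousAt
    have ht2 : Tendsto (graphPoint ψ₂) (𝓝 p) (𝓝 z) := by
      rw [← hg]; exact (contDiffAt_graphPoint hψ₂).continuousAt
    have ht := ht2.prodMk_nhds ht1
    have ho := hstrict.isLittleO.comp_tendsto ht
    have hdiff : ∀ q, graphPoint ψ₂ q - graphPoint ψ q = (0, 0, ψ₂ q - ψ q) := fun q => by
      simp [graphPoint]
    refine IsLittleO.congr' (f₁ := _) (g₁ := fun q => graphPoint ψ₂ q - graphPoint ψ q) ho ?_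
      Filter.EventuallyEq.rfl |>.trans_isBigO ?_
    · filter_upwards [heq, heq₂] with q hq hq₂
      simp only [Function.comp_apply, F]
      rw [hdiff, hq, sub_self, sub_zero, hq₂]
      rfl
    · refine IsBigO.of_bound 1 (Eventually.of_forall fun q => ?_)
      rw [hdiff, one_mul, Prod.norm_mk, Prod.norm_mk]
      simp

end PointTransformation

theorem ContDiffAt.slice_fst {E : Type*} [NormedAddCommGroup E] [NormedSpace ℝ E]
    {ψ : ℝ × ℝ → E} {p : ℝ × ℝ} {n : WithTop ℕ∞} (h : ContDiffAt ℝ n ψ p) :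
    ContDiffAt ℝ n (fun s : ℝ => ψ (s, p.2)) p.1 :=
  ContDiffAt.comp (g := ψ) p.1 h (contDiffAt_id.prodMk contDiffAt_const)

theorem ContDiffAt.slice_snd {E : Type*} [NormedAddCommGroup E] [NormedSpace ℝ E]
    {ψ : ℝ × ℝ → E} {p : ℝ × ℝ} {n : WithTop ℕ∞} (h : ContDiffAt ℝ n ψ p) :
    ContDiffAt ℝ n (fun y : ℝ => ψ (p.1, y)) p.2 :=
  ContDiffAt.comp (g := ψ) p.2 h (contDiffAt_const.prodMk contDiffAt_id)

theorem two_le_infty : (2 : WithTop ℕ∞) ≤ ∞ :=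
  WithTop.coe_le_coe.2 (le_top : (2 : ℕ∞) ≤ ⊤)

theorem nlsExpr_sub_nlsExpr {γ : ℝ} {σ : ℂ} {V ψ₁ ψ₂ : ℝ × ℝ → ℂ} {p : ℝ × ℝ}
    (h1 : ContDiffAt ℝ ∞ ψ₁ p) (h2 : ContDiffAt ℝ ∞ ψ₂ p) (h : ψ₂ p = ψ₁ p) :
    nlsExpr γ σ V ψ₂ p - nlsExpr γ σ V ψ₁ p =
      Complex.I * deriv (fun s : ℝ => ψ₂ (s, p.2) - ψ₁ (s, p.2)) p.1 +
        iteratedDeriv 2 (fun y : ℝ => ψ₂ (p.1, y) - ψ₁ (p.1, y)) p.2 := by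
  have e1 : deriv (fun s : ℝ => ψ₂ (s, p.2) - ψ₁ (s, p.2)) p.1 =
      deriv (fun s : ℝ => ψ₂ (s, p.2)) p.1 - deriv (fun s : ℝ => ψ₁ (s, p.2)) p.1 :=
    deriv_fun_sub (h2.slice_fst.differentiableAt (by simp))
      (h1.slice_fst.differentiableAt (by simp))
  have e2 : iteratedDeriv 2 (fun y : ℝ => ψ₂ (p.1, y) - ψ₁ (p.1, y)) p.2 =
      iteratedDeriv 2 (fun y : ℝ => ψ₂ (p.1, y)) p.2 -
        iteratedDeriv 2 (fun y : ℝ => ψ₁ (p.1, y)) p.2 :=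
    iteratedDeriv_fun_sub (h2.slice_snd.of_le two_le_infty) (h1.slice_snd.of_le two_le_infty)
  rw [e1, e2, nlsExpr, nlsExpr, h]
  ring

theorem HasDerivAt.sq_sub_sq_isLittleO {k : ℝ → ℝ} {k' : ℝ} (hk : HasDerivAt k k' 0)
    (h0 : k 0 = 0) : (fun s => k s ^ 2 - s ^ 2 * k' ^ 2) =o[𝓝 0] fun s : ℝ => s ^ 2 := by
  have h1 : (fun s => k s - s * k') =o[𝓝 0] fun s : ℝ => s := by
    have := hasDerivAt_iff_isLittleO.1 hk
    simpa [h0] using this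
  have h2 : (fun s => k s + s * k') =O[𝓝 0] fun s : ℝ => s := by
    have h3 : (fun s : ℝ => 2 * (s * k')) =O[𝓝 0] fun s : ℝ => s := by
      refine IsBigO.of_bound (2 * |k'|) (Eventually.of_forall fun s => ?_)
      rw [norm_mul, norm_mul, Real.norm_eq_abs, Real.norm_eq_abs, Real.norm_eq_abs]
      norm_num
      apply le_of_eq; ring
    refine (h1.isBigO.add h3).congr_left fun s => ?_
    ring
  refine (h1.mul_isBigO h2).congr (fun s => ?_) fun s => ?_ <;> ring

/-! ### The new time depends on the old time only -/

namespace PointTransformation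

variable {Φ : PointTransformation} {γ : ℝ} {σ σ' : ℂ} {V V' : ℝ × ℝ → ℂ}

/-- The value of `ψ_xx` that solves the equation for a given value `a` of `ψ` and `e` of `ψ_t`. -/
noncomputable def solvedJet (γ : ℝ) (σ : ℂ) (V : ℝ × ℝ → ℂ) (p : ℝ × ℝ) (a e : ℂ) : ℂ :=
  -(Complex.I * e + σ * ((‖a‖ ^ γ : ℝ) : ℂ) * a + V p * a)

theorem nlsExpr_solvedJet (p : ℝ × ℝ) (a e b d : ℂ) :
    nlsExpr γ σ V (jetPoly p a e b (solvedJet γ σ V p a e) d) p = 0 := by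
  rw [nlsExpr_jetPoly, solvedJet]; ring

theorem graphPoint_jetPoly (z : ℝ × ℝ × ℂ) (e b c d : ℂ) :
    graphPoint (jetPoly (basePoint z) z.2.2 e b c d) (basePoint z) = z := by
  simp [graphPoint, jetPoly_self, basePoint]

theorem _root_.CarriesGraph.apply {ψ ψ' : ℝ × ℝ → ℂ} {p : ℝ × ℝ} (h : CarriesGraph Φ ψ ψ' p) :
    ψ' (Φ.baseMap ψ p) = (Φ.toFun (graphPoint ψ p)).2.2 := h.2.2.2.self_of_nhds.symm

theorem exists_carriesGraph_jetPoly {z : ℝ × ℝ × ℂ} (hz : z ∈ Φ.source) {e b : ℂ}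
    (hinj : ∀ v, totalBase (fderiv ℝ Φ.toFun z) e b v = 0 → v = 0) (c d : ℂ) :
    ∃ ψ', CarriesGraph Φ (jetPoly (basePoint z) z.2.2 e b c d) ψ' (basePoint z) := by
  refine exists_carriesGraph (e := e) (b := b) ?_ (contDiff_jetPoly _ _ _ _ _ _).contDiffAt
    (fderiv_jetPoly _ _ _ _ _ _) ?_
  · rw [graphPoint_jetPoly]; exact hz
  · rw [graphPoint_jetPoly]; exact hinj

/-- The equation does not see `ψ_tt`. Two solution jets that differ only there have images that
differ to second order by `(δt)² M 1`, where `δt` is the displacement of the old time. Both images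
solve the target equation, so their second derivatives in the new `x` agree. Since `M 1 ≠ 0`, moving
along the new `x`-axis does not change the old time to first order. -/
theorem fst_eq_zero_of_totalBase_eq (hE : MapsEquation Φ γ σ V σ' V') {z : ℝ × ℝ × ℂ}
    (hz : z ∈ Φ.source) {e b : ℂ}
    (hinj : ∀ v, totalBase (fderiv ℝ Φ.toFun z) e b v = 0 → v = 0) {v : ℝ × ℝ}
    (hv : totalBase (fderiv ℝ Φ.toFun z) e b v = (0, 1)) : v.1 = 0 := by
  set p := basePoint z with hp
  set a := z.2.2 with ha
  set c := solvedJet γ σ V p a e with hc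
  set ψ := jetPoly p a e b c 0 with hψdef
  set ψ₂ := jetPoly p a e b c 1 with hψ₂def
  have hgψ : graphPoint ψ p = z := graphPoint_jetPoly z e b c 0
  have hgψ₂ : graphPoint ψ₂ p = z := graphPoint_jetPoly z e b c 1
  obtain ⟨ψ', h1⟩ : ∃ ψ', CarriesGraph Φ ψ ψ' p := exists_carriesGraph_jetPoly hz hinj c 0
  obtain ⟨ψ₂', h2⟩ : ∃ ψ', CarriesGraph Φ ψ₂ ψ' p := exists_carriesGraph_jetPoly hz hinj c 1
  have hd : ∀ v, fderiv ℝ ψ p v = v.1 • e + v.2 • b := fderiv_jetPoly _ _ _ _ _ _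
  have hd₂ : ∀ v, fderiv ℝ ψ₂ p v = v.1 • e + v.2 • b := fderiv_jetPoly _ _ _ _ _ _
  obtain ⟨M, hM0, -, hM⟩ := exists_comparison h1 hd (by rw [hgψ]; exact hinj)
  have hval : ψ₂ p = ψ p := by rw [hψdef, hψ₂def, jetPoly_self, jetPoly_self]
  have hcmp := hM ψ₂ ψ₂' h2 hval
  have hsq : ∀ q, ψ₂ q - ψ q = (((q.1 - p.1) ^ 2 : ℝ) : ℂ) := fun q => by
    simp only [hψdef, hψ₂def, jetPoly]; ring
  have hbase : Φ.baseMap ψ p = Φ.baseMap ψ₂ p := by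
    simp only [baseMap, hgψ, hgψ₂]
  set r := Φ.baseMap ψ₂ p with hr
  have hs' : ContDiffAt ℝ ∞ ψ' r := by rw [← hbase]; exact h1.2.2.1
  have hs₂' : ContDiffAt ℝ ∞ ψ₂' r := h2.2.2.1
  obtain ⟨B, hB, hBv⟩ := exists_baseMap_equiv (Φ := Φ) (by rw [hgψ₂]; exact hz) h2.2.1 hd₂
    (by rw [hgψ₂]; exact hinj)
  rw [hgψ₂] at hBv
  obtain ⟨k, hk, hkp, hkd, -, hkr⟩ := exists_local_inverse
    (contDiffAt_baseMap (by rw [hgψ₂]; exact hz) h2.2.1) hB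
  change k r = p at hkp
  -- Along any straight line through `r` with direction `w` the old time moves by `s (B⁻¹ w).1 +
  -- o(s)`, so the difference of the two images is `s² (B⁻¹ w).1² M 1 + o(s²)`. The directions `(1,
  -- 0)` and `(0, 1)` are needed below.
  have key : ∀ (w : ℝ × ℝ) (line : ℝ → ℝ × ℝ) (x₀ : ℝ), (∀ s, line (x₀ + s) = r + s • w) →
      ContDiffAt ℝ ∞ line x₀ →
      deriv (fun s => ψ₂' (line s) - ψ' (line s)) x₀ = 0 ∧
      iteratedDeriv 2 (fun s => ψ₂' (line s) - ψ' (line s)) x₀ =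
        (2 : ℝ) • ((B.symm w).1 ^ 2 • M 1) := by
    intro w line x₀ hline hlined
    have hl0 : line x₀ = r := by simpa using hline 0
    have hg : ContDiffAt ℝ 2 (fun s => ψ₂' (line s) - ψ' (line s)) x₀ := by
      have e1 : ContDiffAt ℝ ∞ (fun s => ψ₂' (line s)) x₀ :=
        ContDiffAt.comp (g := ψ₂') x₀ (by rw [hl0]; exact hs₂') hlined
      have e2 : ContDiffAt ℝ ∞ (fun s => ψ' (line s)) x₀ :=
        ContDiffAt.comp (g := ψ') x₀ (by rw [hl0]; exact hs') hlined
      exact (e1.sub e2).of_le two_le_infty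
    have hcurve : HasDerivAt (fun s : ℝ => r + s • w) w 0 := by
      simpa using ((hasDerivAt_id (0:ℝ)).smul_const w).const_add r
    have hq : HasDerivAt (fun s : ℝ => k (r + s • w)) (B.symm w) 0 :=
      HasFDerivAt.comp_hasDerivAt_of_eq (0:ℝ) hkd hcurve (by simp; rfl)
    have hrt : Tendsto (fun s : ℝ => r + s • w) (𝓝 0) (𝓝 r) := by
      simpa using hcurve.continuousAt.tendsto
    have hqt : Tendsto (fun s : ℝ => k (r + s • w)) (𝓝 0) (𝓝 p) := by
      have := hq.continuousAt.tendsto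
      simpa [hkp] using this
    have hq1 : HasDerivAt (fun s : ℝ => (k (r + s • w)).1 - p.1) (B.symm w).1 0 :=
      hq.fst.sub_const p.1
    have hκ := hq1.sq_sub_sq_isLittleO (by simp [hkp])
    have hO : (fun s : ℝ => ψ₂ (k (r + s • w)) - ψ (k (r + s • w))) =O[𝓝 0]
        fun s : ℝ => s ^ 2 := by
      have h3 : (fun s : ℝ => ((k (r + s • w)).1 - p.1) ^ 2) =O[𝓝 0] fun s : ℝ => s ^ 2 := by
        have h4 : (fun s : ℝ => s ^ 2 * (B.symm w).1 ^ 2) =O[𝓝 0] fun s : ℝ => s ^ 2 := by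
          refine IsBigO.of_bound ((B.symm w).1 ^ 2) (Eventually.of_forall fun s => ?_)
          rw [norm_mul, mul_comm, Real.norm_of_nonneg (sq_nonneg (B.symm w).1)]
        refine (hκ.isBigO.add h4).congr_left fun s => ?_
        ring
      refine IsBigO.congr_left (f₁ := fun s : ℝ => ((((k (r + s • w)).1 - p.1) ^ 2 : ℝ) : ℂ)) ?_
        fun s => (hsq _).symm
      exact (isBigO_of_le _ fun s => by rw [Complex.norm_real]).trans h3
    have ho := (hcmp.comp_tendsto hqt).trans_isBigO hO
    have ho2 : (fun s : ℝ => (((k (r + s • w)).1 - p.1) ^ 2 - s ^ 2 * (B.symm w).1 ^ 2) • M 1)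
        =o[𝓝 0] fun s : ℝ => s ^ 2 := by
      refine (hκ.smul_isBigO (isBigO_refl (fun _ : ℝ => M 1) _)).trans_isBigO ?_
      refine IsBigO.of_bound ‖M 1‖ (Eventually.of_forall fun s => ?_)
      rw [norm_smul, mul_comm]
    have hfin := (derivs_of_isLittleO_sq hg (k := (B.symm w).1 ^ 2 • M 1) ?_).2
    · exact hfin
    · refine (ho.add ho2).congr' ?_ Filter.EventuallyEq.rfl
      filter_upwards [hrt.eventually hkr] with s hs
      simp only [Function.comp_apply]
      rw [hs, hline, hsq]
      have : M (((((k (r + s • w)).1 - p.1) ^ 2 : ℝ)) : ℂ) =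
          ((k (r + s • w)).1 - p.1) ^ 2 • M 1 := by
        rw [← map_smul]; congr 1; simp
      rw [this]
      module
  have kt := (key (1, 0) (fun s => (s, r.2)) r.1 (fun s => by ext <;> simp)
    (contDiffAt_id.prodMk contDiffAt_const)).1
  have kx := (key (0, 1) (fun s => (r.1, s)) r.2 (fun s => by ext <;> simp)
    (contDiffAt_const.prodMk contDiffAt_id)).2
  have hn1 : nlsExpr γ σ' V' ψ' r = 0 := by
    rw [← hbase]; exact (hE ψ ψ' p h1).1 (nlsExpr_solvedJet p a e b 0)
  have hn2 : nlsExpr γ σ' V' ψ₂' r = 0 := (hE ψ₂ ψ₂' p h2).1 (nlsExpr_solvedJet p a e b 1)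
  have hval' : ψ₂' r = ψ' r := by
    have e1 := h1.apply
    have e2 := h2.apply
    change ψ' (Φ.baseMap ψ p) = (Φ.toFun (graphPoint ψ p)).2.2 at e1
    change ψ₂' r = (Φ.toFun (graphPoint ψ₂ p)).2.2 at e2
    rw [hbase, hgψ] at e1
    rw [hgψ₂] at e2
    rw [e1, e2]
  have hsub := nlsExpr_sub_nlsExpr (γ := γ) (σ := σ') (V := V') hs' hs₂' hval'
  rw [hn1, hn2, kt, kx] at hsub
  have hw : B.symm (0, 1) = v := by rw [← hv, ← hBv, B.symm_apply_apply]
  rw [hw] at hsub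
  simp only [sub_zero, mul_zero, zero_add] at hsub
  have h3 : (2 : ℝ) • (v.1 ^ 2 • M 1) = 0 := hsub.symm
  rw [smul_eq_zero, smul_eq_zero] at h3
  rcases h3 with h3 | h3 | h3
  · norm_num at h3
  · exact pow_eq_zero_iff (two_ne_zero) |>.1 h3
  · exact absurd (hM0 1 h3) one_ne_zero

end PointTransformation

/-! ### Linear algebra of the Jacobian along graphs -/

/-- The Jacobian of the base map along a graph with the first jet `(e, b)`. -/
noncomputable def jac (D : ℝ × ℝ × ℂ →L[ℝ] ℝ × ℝ × ℂ) (e b : ℂ) : ℝ :=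
  (D (1, 0, e)).1 * (D (0, 1, b)).2.1 - (D (1, 0, e)).2.1 * (D (0, 1, b)).1

theorem split_time (D : ℝ × ℝ × ℂ →L[ℝ] ℝ × ℝ × ℂ) (e : ℂ) :
    D (1, 0, e) = D (1, 0, 0) + D (0, 0, e) := by
  rw [← map_add]; simp

theorem split_space (D : ℝ × ℝ × ℂ →L[ℝ] ℝ × ℝ × ℂ) (b : ℂ) :
    D (0, 1, b) = D (0, 1, 0) + D (0, 0, b) := by
  rw [← map_add]; simp

theorem split_all (D : ℝ × ℝ × ℂ →L[ℝ] ℝ × ℝ × ℂ) (u : ℝ × ℝ × ℂ) :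
    D u = u.1 • D (1, 0, 0) + u.2.1 • D (0, 1, 0) + D (0, 0, u.2.2) := by
  rw [← map_smul, ← map_smul, ← map_add, ← map_add]; simp

theorem jac_expand (D : ℝ × ℝ × ℂ →L[ℝ] ℝ × ℝ × ℂ) (e b : ℂ) :
    jac D e b = ((D (1, 0, 0)).1 + (D (0, 0, e)).1) * ((D (0, 1, 0)).2.1 + (D (0, 0, b)).2.1) -
      ((D (1, 0, 0)).2.1 + (D (0, 0, e)).2.1) * ((D (0, 1, 0)).1 + (D (0, 0, b)).1) := by
  rw [jac, split_time D e, split_space D b]; rfl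

/-- The Jacobian is affine in `e` and in `b` separately, so its identical vanishing kills every 2×2
minor of the base part of `D`. That part would then have rank at most one, against the surjectivity
of `D`. -/
theorem exists_jac_ne_zero {D : ℝ × ℝ × ℂ →L[ℝ] ℝ × ℝ × ℂ} (hD : Function.Surjective D) :
    ∃ e b, jac D e b ≠ 0 := by
  by_contra! H
  obtain ⟨u, hu⟩ := hD (1, 0, 0)
  obtain ⟨u', hu'⟩ := hD (0, 1, 0)
  have h00 := H 0 0
  have h1 := fun b => H 0 b
  have h2 := fun e => H e 0
  have h3 := H
  simp only [jac_expand] at h00 h1 h2 h3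
  rw [split_all] at hu hu'
  have a1 := congrArg Prod.fst hu
  have a2 := congrArg (fun z => z.2.1) hu
  have b1 := congrArg Prod.fst hu'
  have b2 := congrArg (fun z => z.2.1) hu'
  simp only [Prod.fst_add, Prod.snd_add, Prod.smul_fst, Prod.smul_snd, smul_eq_mul] at a1 a2 b1 b2
  have z0 : D (0, 0, 0) = 0 := by
    have : ((0, 0, 0) : ℝ × ℝ × ℂ) = 0 := rfl
    rw [this, map_zero]
  simp only [z0, Prod.fst_zero, Prod.snd_zero, add_zero] at h00 h1 h2
  have c1 : ∀ b, (D (1, 0, 0)).1 * (D (0, 0, b)).2.1 - (D (1, 0, 0)).2.1 * (D (0, 0, b)).1 = 0 :=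
    fun b => by linear_combination h1 b - h00
  have c2 : ∀ e, (D (0, 0, e)).1 * (D (0, 1, 0)).2.1 - (D (0, 0, e)).2.1 * (D (0, 1, 0)).1 = 0 :=
    fun e => by linear_combination h2 e - h00
  have c3 : ∀ e b, (D (0, 0, e)).1 * (D (0, 0, b)).2.1 - (D (0, 0, e)).2.1 * (D (0, 0, b)).1 = 0 :=
    fun e b => by linear_combination h3 e b - h00 - c1 b - c2 e
  generalize (D (1, 0, 0)).1 = τ1 at *
  generalize (D (1, 0, 0)).2.1 = ξ1 at *
  generalize (D (0, 1, 0)).1 = τ2 at *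
  generalize (D (0, 1, 0)).2.1 = ξ2 at *
  have d1 := c1 u.2.2
  have d1' := c1 u'.2.2
  have d2 := c2 u.2.2
  have d2' := c2 u'.2.2
  have d3 := c3 u.2.2 u'.2.2
  have key : (u.1 * τ1 + u.2.1 * τ2 + (D (0, 0, u.2.2)).1) *
      (u'.1 * ξ1 + u'.2.1 * ξ2 + (D (0, 0, u'.2.2)).2.1) -
      (u.1 * ξ1 + u.2.1 * ξ2 + (D (0, 0, u.2.2)).2.1) *
      (u'.1 * τ1 + u'.2.1 * τ2 + (D (0, 0, u'.2.2)).1) = 0 := by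
    linear_combination (u.1 * u'.2.1 - u.2.1 * u'.1) * h00 + u.1 * d1' - u'.1 * d1
      - u.2.1 * d2' + u'.2.1 * d2 + d3
  rw [a1, a2, b1, b2] at key
  norm_num at key

theorem jac_add_smul (D : ℝ × ℝ × ℂ →L[ℝ] ℝ × ℝ × ℂ) (e b c : ℂ) (s : ℝ) :
    jac D e (b + s • c) = jac D e b +
      s * ((D (1, 0, e)).1 * (D (0, 0, c)).2.1 - (D (1, 0, e)).2.1 * (D (0, 0, c)).1) := by
  have h : D (0, 1, b + s • c) = D (0, 1, b) + s • D (0, 0, c) := by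
    rw [← map_smul, ← map_add]; simp
  simp only [jac, h, Prod.fst_add, Prod.snd_add, Prod.smul_fst, Prod.smul_snd, smul_eq_mul]
  ring

/-- Removes the genericity condition on jets. The Jacobian is affine along `b + s c`, so if it is
nonzero at `s = 0` it cannot vanish at both `s = 1` and `s = 2`. The hypothesis thus holds at two
points of the line and gives the vanishing in the direction `c`. -/
theorem eq_zero_of_generic {D : ℝ × ℝ × ℂ →L[ℝ] ℝ × ℝ × ℂ} (hD : Function.Surjective D)
    (H : ∀ e b, jac D e b ≠ 0 → (D (0, 1, b)).1 = 0) :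
    (D (0, 1, 0)).1 = 0 ∧ ∀ c, (D (0, 0, c)).1 = 0 := by
  obtain ⟨e, b, hJ⟩ := exists_jac_ne_zero hD
  have hc : ∀ c, (D (0, 0, c)).1 = 0 := by
    intro c
    have hs : ∃ s : ℝ, s ≠ 0 ∧ jac D e (b + s • c) ≠ 0 := by
      by_contra! hcon
      have h1 := hcon 1 one_ne_zero
      have h2 := hcon 2 two_ne_zero
      rw [jac_add_smul] at h1 h2
      exact hJ (by linear_combination 2 * h1 - h2)
    obtain ⟨s, hs0, hs⟩ := hs
    have h1 := H e b hJ
    have h2 := H e _ hs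
    have h : D (0, 1, b + s • c) = D (0, 1, b) + s • D (0, 0, c) := by
      rw [← map_smul, ← map_add]; simp
    rw [h, Prod.fst_add, h1, zero_add, Prod.smul_fst, smul_eq_mul] at h2
    exact (mul_eq_zero.1 h2).resolve_left hs0
  refine ⟨?_, hc⟩
  have := H e b hJ
  rwa [split_space, Prod.fst_add, hc, add_zero] at this

theorem eventually_eq_of_hasDerivAt_zero {E : Type*} [NormedAddCommGroup E] [NormedSpace ℝ E]
    {g : ℝ → E} {x : ℝ} (h : ∀ᶠ y in 𝓝 x, HasDerivAt g 0 y) : ∀ᶠ y in 𝓝 x, g y = g x := by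
  obtain ⟨r, hr, hb⟩ := Metric.eventually_nhds_iff_ball.1 h
  filter_upwards [Metric.ball_mem_nhds x hr] with y hy
  exact Metric.isOpen_ball.is_const_of_deriv_eq_zero (convex_ball x r).isPreconnected
    (fun z hz => (hb z hz).differentiableAt.differentiableWithinAt)
    (fun z hz => (hb z hz).deriv) hy (Metric.mem_ball_self hr)

/-! ### First derivatives of admissible transformations -/

namespace PointTransformation

variable {Φ : PointTransformation} {γ : ℝ} {σ σ' : ℂ} {V V' : ℝ × ℝ → ℂ}

theorem totalBase_apply (D : ℝ × ℝ × ℂ →L[ℝ] ℝ × ℝ × ℂ) (e b : ℂ) (v : ℝ × ℝ) :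
    totalBase D e b v = (v.1 * (D (1, 0, e)).1 + v.2 * (D (0, 1, b)).1,
      v.1 * (D (1, 0, e)).2.1 + v.2 * (D (0, 1, b)).2.1) := by
  have : ((v.1, v.2, v.1 • e + v.2 • b) : ℝ × ℝ × ℂ) = v.1 • (1, 0, e) + v.2 • (0, 1, b) := by
    simp
  rw [totalBase, this, map_add, map_smul, map_smul]
  rfl

theorem totalBase_injective {D : ℝ × ℝ × ℂ →L[ℝ] ℝ × ℝ × ℂ} {e b : ℂ} (h : jac D e b ≠ 0)
    (v : ℝ × ℝ) (hv : totalBase D e b v = 0) : v = 0 := by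
  rw [totalBase_apply] at hv
  have h1 := congrArg Prod.fst hv
  have h2 := congrArg Prod.snd hv
  simp only [Prod.fst_zero, Prod.snd_zero] at h1 h2
  have e1 : v.1 * jac D e b = 0 := by
    rw [jac]; linear_combination (D (0, 1, b)).2.1 * h1 - (D (0, 1, b)).1 * h2
  have e2 : v.2 * jac D e b = 0 := by
    rw [jac]; linear_combination (D (1, 0, e)).1 * h2 - (D (1, 0, e)).2.1 * h1
  exact Prod.ext ((mul_eq_zero.1 e1).resolve_right h) ((mul_eq_zero.1 e2).resolve_right h)

theorem fderiv_surjective {z : ℝ × ℝ × ℂ} (hz : z ∈ Φ.source) :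
    Function.Surjective (fderiv ℝ Φ.toFun z) := fun v => ⟨_, (fderiv_inverse hz).2 v⟩

/-- The new time does not depend on `x` and `ψ`. -/
theorem fderiv_fst_eq_zero (hE : MapsEquation Φ γ σ V σ' V') {z : ℝ × ℝ × ℂ}
    (hz : z ∈ Φ.source) : (fderiv ℝ Φ.toFun z (0, 1, 0)).1 = 0 ∧
      ∀ c, (fderiv ℝ Φ.toFun z (0, 0, c)).1 = 0 := by
  refine eq_zero_of_generic (fderiv_surjective hz) fun e b hJ => ?_
  set D := fderiv ℝ Φ.toFun z with hD
  -- The vector `v` is the preimage of `(0, 1)` under the differential of the base map, by Cramer's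
  -- rule. Its first entry is, up to the factor `-1 / jac`, the total `x`-derivative of the new
  -- time.
  have := fst_eq_zero_of_totalBase_eq hE hz (totalBase_injective hJ)
    (v := (-(D (0, 1, b)).1 / jac D e b, (D (1, 0, e)).1 / jac D e b)) (by
      rw [totalBase_apply]
      refine Prod.ext ?_ ?_
      · simp only; ring
      · simp only
        field_simp
        rw [jac]; ring)
  simpa [hJ] using this

theorem jac_eq {D : ℝ × ℝ × ℂ →L[ℝ] ℝ × ℝ × ℂ} (h1 : (D (0, 1, 0)).1 = 0)
    (h2 : ∀ c, (D (0, 0, c)).1 = 0) (e b : ℂ) :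
    jac D e b = (D (1, 0, 0)).1 * (D (0, 1, b)).2.1 := by
  rw [jac, split_time D e, split_space D b]
  simp [h1, h2]

/-- The relation between the first derivatives of a graph comparison. -/
theorem comparison_relation (hE : MapsEquation Φ γ σ V σ' V') {z : ℝ × ℝ × ℂ}
    (hz : z ∈ Φ.source) {e b : ℂ} (hJ : jac (fderiv ℝ Φ.toFun z) e b ≠ 0) :
    ∃ (M : ℂ →L[ℝ] ℂ) (A : ℝ × ℝ →L[ℝ] ℂ), (∀ c, M c = 0 → c = 0) ∧
      (∀ c, M c = (fderiv ℝ Φ.toFun z (0, 0, c)).2.2 -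
        A (basePoint (fderiv ℝ Φ.toFun z (0, 0, c)))) ∧
      ∀ c, ((fderiv ℝ Φ.toFun z (0, 1, b)).2.1 ^ 2) • (Complex.I * M (Complex.I * c)) +
        (fderiv ℝ Φ.toFun z (1, 0, 0)).1 • M c = 0 := by
  set p := basePoint z with hp
  set a := z.2.2 with ha
  set D := fderiv ℝ Φ.toFun z with hDdef
  set c₀ := solvedJet γ σ V p a e with hc₀
  set ψ := jetPoly p a e b c₀ 0 with hψdef
  have hinj := totalBase_injective hJ
  have hgψ : graphPoint ψ p = z := graphPoint_jetPoly z e b c₀ 0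
  obtain ⟨ψ', h1⟩ : ∃ ψ', CarriesGraph Φ ψ ψ' p := exists_carriesGraph_jetPoly hz hinj c₀ 0
  have hd : ∀ v, fderiv ℝ ψ p v = v.1 • e + v.2 • b := fderiv_jetPoly _ _ _ _ _ _
  obtain ⟨M, hM0, hMf, hM⟩ := exists_comparison h1 hd (by rw [hgψ]; exact hinj)
  rw [hgψ] at hMf
  refine ⟨M, _, hM0, hMf, fun c => ?_⟩
  obtain ⟨hx0, hc0⟩ := fderiv_fst_eq_zero hE hz
  rw [← hDdef] at hx0 hc0
  have hJ' := hJ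
  rw [jac_eq hx0 hc0] at hJ'
  have hτ : (D (1, 0, 0)).1 ≠ 0 := left_ne_zero_of_mul hJ'
  have hm : (D (0, 1, b)).2.1 ≠ 0 := right_ne_zero_of_mul hJ'
  -- the perturbed graph
  set ψ₂ := jetPoly p a (e + Complex.I * c) b (c₀ + c) 0 with hψ₂def
  have hgψ₂ : graphPoint ψ₂ p = z := graphPoint_jetPoly z _ b _ 0
  have hJ₂ : jac D (e + Complex.I * c) b ≠ 0 := by
    rw [jac_eq hx0 hc0]; exact hJ'
  obtain ⟨ψ₂', h2⟩ : ∃ ψ', CarriesGraph Φ ψ₂ ψ' p :=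
    exists_carriesGraph_jetPoly hz (totalBase_injective hJ₂) _ 0
  have hd₂ : ∀ v, fderiv ℝ ψ₂ p v = v.1 • (e + Complex.I * c) + v.2 • b :=
    fderiv_jetPoly _ _ _ _ _ _
  have hval : ψ₂ p = ψ p := by rw [hψdef, hψ₂def, jetPoly_self, jetPoly_self]
  have hcmp := hM ψ₂ ψ₂' h2 hval
  have hbase : Φ.baseMap ψ p = Φ.baseMap ψ₂ p := by
    simp only [baseMap, hgψ, hgψ₂]
  set r := Φ.baseMap ψ₂ p with hr
  have hs' : ContDiffAt ℝ ∞ ψ' r := by rw [← hbase]; exact h1.2.2.1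
  have hs₂' : ContDiffAt ℝ ∞ ψ₂' r := h2.2.2.1
  have hz₂ : graphPoint ψ₂ p ∈ Φ.source := by rw [hgψ₂]; exact hz
  obtain ⟨L, hL, hLv⟩ := hasFDerivAt_baseMap hz₂ h2.2.1 hd₂
  rw [hgψ₂] at hLv
  have hbs := contDiffAt_baseMap hz₂ h2.2.1
  have hn1 : nlsExpr γ σ' V' ψ' r = 0 := by
    rw [← hbase]; exact (hE ψ ψ' p h1).1 (nlsExpr_solvedJet p a e b 0)
  have hn2 : nlsExpr γ σ' V' ψ₂' r = 0 := by
    refine (hE ψ₂ ψ₂' p h2).1 ?_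
    -- The increments `I c` of `ψ_t` and `c` of `ψ_xx` cancel in `i ψ_t + ψ_xx`, so the perturbed
    -- jet remains on the solution manifold.
    rw [hψ₂def, nlsExpr_jetPoly, hc₀, solvedJet]
    linear_combination c * Complex.I_mul_I
  have hval' : ψ₂' r = ψ' r := by
    have e1 := h1.apply
    have e2 := h2.apply
    rw [hbase, hgψ] at e1
    rw [hgψ₂] at e2
    rw [e1, ← e2]
  have hsub := nlsExpr_sub_nlsExpr (γ := γ) (σ := σ') (V := V') hs' hs₂' hval'
  rw [hn1, hn2, sub_zero] at hsub
  -- the space direction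
  have hdx : ContDiffAt ℝ ∞ (fun x => Φ.baseMap ψ₂ (p.1, x)) p.2 := hbs.slice_snd
  have hdx1 : HasDerivAt (fun x => Φ.baseMap ψ₂ (p.1, x)) (L (0, 1)) p.2 :=
    HasFDerivAt.comp_hasDerivAt_of_eq p.2 hL
      ((hasDerivAt_const p.2 p.1).prodMk (hasDerivAt_id p.2)) rfl
  have hL01 : L (0, 1) = (0, (D (0, 1, b)).2.1) := by
    rw [hLv, totalBase_apply, split_space D b]
    simp [hx0, hc0]
  have hL10 : L (1, 0) = ((D (1, 0, 0)).1, (D (1, 0, e + Complex.I * c)).2.1) := by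
    rw [hLv, totalBase_apply, split_time D]
    simp [hc0]
  -- The slice at fixed old time is mapped into a slice at fixed new time, because
  -- `fderiv_fst_eq_zero` applies at all nearby points of the graph. The second-order comparison
  -- therefore involves the new `x` alone.
  have hconst : ∀ᶠ x in 𝓝 p.2, (Φ.baseMap ψ₂ (p.1, x)).1 = r.1 := by
    refine eventually_eq_of_hasDerivAt_zero (g := fun x => (Φ.baseMap ψ₂ (p.1, x)).1) ?_
    have hcont : ContinuousAt (fun x : ℝ => graphPoint ψ₂ (p.1, x)) p.2 :=
      (contDiffAt_graphPoint (h2.2.1)).slice_snd.continuousAt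
    have hsrc : ∀ᶠ x in 𝓝 p.2, graphPoint ψ₂ (p.1, x) ∈ Φ.source :=
      hcont.eventually (Φ.open_source.mem_nhds hz₂)
    filter_upwards [hsrc] with x hx
    have hg : HasFDerivAt ψ₂ (fderiv ℝ ψ₂ (p.1, x)) (p.1, x) :=
      (((contDiff_jetPoly p a _ b _ 0 (n := 1)).differentiable (by simp)) _).hasFDerivAt
    have h3 := (((hasFDerivAt hx).comp _ (hasFDerivAt_graphPoint hg)).fst).comp_hasDerivAt_of_eq
      x ((hasDerivAt_const x p.1).prodMk (hasDerivAt_id x)) rfl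
    refine h3.congr_deriv ?_
    obtain ⟨k1, k2⟩ := fderiv_fst_eq_zero hE hx
    change (fderiv ℝ Φ.toFun (graphPoint ψ₂ (p.1, x)) (0, 1, fderiv ℝ ψ₂ (p.1, x) (0, 1))).1 = 0
    rw [split_space, Prod.fst_add, k1, k2, add_zero]
  set ρ : ℝ → ℝ := fun x => (Φ.baseMap ψ₂ (p.1, x)).2 with hρ
  have hρ0 : ρ p.2 = r.2 := rfl
  have hρs : ContDiffAt ℝ ∞ ρ p.2 := contDiffAt_snd.comp p.2 hdx
  have hρd : deriv ρ p.2 = (D (0, 1, b)).2.1 := by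
    have : HasDerivAt ρ (L (0, 1)).2 p.2 := hdx1.snd
    rw [hL01] at this
    exact this.deriv
  set g : ℝ → ℂ := fun y => ψ₂' (r.1, y) - ψ' (r.1, y) with hg
  have hgs : ContDiffAt ℝ ∞ g r.2 := hs₂'.slice_snd.sub hs'.slice_snd
  have hsqx : ∀ s : ℝ, ψ₂ (p.1, p.2 + s) - ψ (p.1, p.2 + s) = ((s ^ 2 / 2 : ℝ) : ℂ) * c := by
    intro s
    simp only [hψdef, hψ₂def, jetPoly]
    push_cast; ring
  have hgρ : ContDiffAt ℝ 2 (fun x => g (ρ x)) p.2 :=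
    (ContDiffAt.comp (g := g) p.2 hgs hρs).of_le two_le_infty
  have hX := derivs_of_isLittleO_sq hgρ (k := (1 / 2 : ℝ) • M c) (by
    have ht : Tendsto (fun s : ℝ => (p.1, p.2 + s)) (𝓝 0) (𝓝 p) := by
      have : ContinuousAt (fun s : ℝ => (p.1, p.2 + s)) 0 := by fun_prop
      simpa [ContinuousAt] using this
    have ht2 : Tendsto (fun s : ℝ => p.2 + s) (𝓝 0) (𝓝 p.2) := by
      have : ContinuousAt (fun s : ℝ => p.2 + s) 0 := by fun_prop
      simpa [ContinuousAt] using this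
    have hO : (fun s : ℝ => ψ₂ (p.1, p.2 + s) - ψ (p.1, p.2 + s)) =O[𝓝 0] fun s : ℝ => s ^ 2 := by
      refine IsBigO.of_bound (‖c‖ / 2) (Eventually.of_forall fun s => ?_)
      rw [hsqx, norm_mul, Complex.norm_real, norm_div]
      norm_num
      apply le_of_eq; ring
    refine ((hcmp.comp_tendsto ht).trans_isBigO hO).congr' ?_ Filter.EventuallyEq.rfl
    filter_upwards [ht2.eventually hconst] with s hs
    simp only [Function.comp_apply]
    rw [hsqx]
    have hb : Φ.baseMap ψ₂ (p.1, p.2 + s) = (r.1, ρ (p.2 + s)) := Prod.ext hs rfl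
    rw [hb]
    have : M (((s ^ 2 / 2 : ℝ) : ℂ) * c) = (s ^ 2 / 2) • M c := by
      rw [← map_smul]; congr 1
    rw [this]
    simp only [hg]
    module)
  obtain ⟨-, hX1, hX2⟩ := hX
  have hg1 : deriv g r.2 = 0 := by
    have h3 : HasDerivAt (fun x => g (ρ x)) (deriv ρ p.2 • deriv g r.2) p.2 := by
      have hgd : HasDerivAt g (deriv g r.2) (ρ p.2) :=
        (hgs.differentiableAt (by simp)).hasDerivAt
      exact hgd.scomp p.2 (hρs.differentiableAt (by simp)).hasDerivAt
    rw [h3.deriv, hρd, smul_eq_zero] at hX1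
    exact hX1.resolve_left hm
  have hg2 : ((D (0, 1, b)).2.1) ^ 2 • iteratedDeriv 2 g r.2 = M c := by
    rw [iteratedDeriv_two_comp (hgs.of_le two_le_infty) (hρs.of_le two_le_infty), hρ0, hg1, hρd,
      smul_zero, add_zero, smul_smul] at hX2
    rw [hX2]; norm_num
  -- the time direction
  set G : ℝ × ℝ → ℂ := fun q => ψ₂' q - ψ' q with hG
  have hGs : ContDiffAt ℝ ∞ G r := hs₂'.sub hs'
  have hGd : HasFDerivAt G (fderiv ℝ G r) r := (hGs.differentiableAt (by simp)).hasFDerivAt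
  have hGx : fderiv ℝ G r (0, 1) = 0 := by
    have h3 : HasDerivAt g (fderiv ℝ G r (0, 1)) r.2 := hGd.comp_hasDerivAt_of_eq r.2
      ((hasDerivAt_const r.2 r.1).prodMk (hasDerivAt_id r.2)) rfl
    rw [← h3.deriv, hg1]
  have hGt : deriv (fun s => ψ₂' (s, r.2) - ψ' (s, r.2)) r.1 = fderiv ℝ G r (1, 0) :=
    (hGd.comp_hasDerivAt_of_eq r.1 ((hasDerivAt_id r.1).prodMk (hasDerivAt_const r.1 r.2))
      rfl).deriv
  have hlin : ∀ s : ℝ, ψ₂ (p.1 + s, p.2) - ψ (p.1 + s, p.2) = s • (Complex.I * c) := by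
    intro s
    simp only [hψdef, hψ₂def, jetPoly, Complex.real_smul]
    push_cast; ring
  have hT : HasDerivAt (fun t => G (Φ.baseMap ψ₂ (t, p.2))) (M (Complex.I * c)) p.1 := by
    rw [hasDerivAt_iff_isLittleO_nhds_zero]
    have ht : Tendsto (fun s : ℝ => (p.1 + s, p.2)) (𝓝 0) (𝓝 p) := by
      have : ContinuousAt (fun s : ℝ => (p.1 + s, p.2)) 0 := by fun_prop
      simpa [ContinuousAt] using this
    have hO : (fun s : ℝ => ψ₂ (p.1 + s, p.2) - ψ (p.1 + s, p.2)) =O[𝓝 0] fun s : ℝ => s := by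
      refine IsBigO.of_bound ‖Complex.I * c‖ (Eventually.of_forall fun s => ?_)
      rw [hlin, norm_smul, mul_comm]
    refine ((hcmp.comp_tendsto ht).trans_isBigO hO).congr_left fun s => ?_
    simp only [Function.comp_apply]
    rw [hlin, map_smul]
    have hz0 : G (Φ.baseMap ψ₂ (p.1, p.2)) = 0 := sub_eq_zero.2 hval'
    rw [hz0, sub_zero]
  have hT2 : HasDerivAt (fun t => G (Φ.baseMap ψ₂ (t, p.2))) (fderiv ℝ G r (L (1, 0))) p.1 :=
    (HasFDerivAt.comp (g := G) p hGd hL).comp_hasDerivAt_of_eq p.1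
      ((hasDerivAt_id p.1).prodMk (hasDerivAt_const p.1 p.2)) rfl
  -- The drift of the new `x` along the old time axis does not contribute, since the difference of
  -- the two images has zero first derivative in the new `x`.
  have hT3 : (D (1, 0, 0)).1 • fderiv ℝ G r (1, 0) = M (Complex.I * c) := by
    rw [hT.unique hT2, hL10]
    have : (((D (1, 0, 0)).1, (D (1, 0, e + Complex.I * c)).2.1) : ℝ × ℝ) =
      (D (1, 0, 0)).1 • ((1, 0) : ℝ × ℝ) +
        (D (1, 0, e + Complex.I * c)).2.1 • ((0, 1) : ℝ × ℝ) := by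
      simp
    rw [this, map_add, map_smul, map_smul, hGx]
    simp
  rw [hGt] at hsub
  rw [← hT3, ← hg2]
  simp only [Complex.real_smul] at *
  linear_combination (-((D (1, 0, 0)).1 : ℂ) * (((D (0, 1, b)).2.1 ^ 2 : ℝ) : ℂ)) * hsub

end PointTransformation

theorem iteratedDeriv_two {E : Type*} [NormedAddCommGroup E] [NormedSpace ℝ E] (f : ℝ → E) :
    iteratedDeriv 2 f = deriv (deriv f) := by
  rw [iteratedDeriv_succ, iteratedDeriv_one]

namespace PointTransformation

variable {Φ : PointTransformation} {γ : ℝ} {σ σ' : ℂ} {V V' : ℝ × ℝ → ℂ}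

/-- The first derivatives of a point transformation between equations of the class. -/
structure FirstOrderStructure (D : ℝ × ℝ × ℂ →L[ℝ] ℝ × ℝ × ℂ) : Prop where
  time_space : (D (0, 1, 0)).1 = 0
  time_field : ∀ c, (D (0, 0, c)).1 = 0
  space_field : ∀ c, (D (0, 0, c)).2.1 = 0
  time_ne : (D (1, 0, 0)).1 ≠ 0
  space_sq : (D (0, 1, 0)).2.1 ^ 2 = |(D (1, 0, 0)).1|
  field_rotate : ∀ c, (D (1, 0, 0)).1 • (D (0, 0, Complex.I * c)).2.2 =
    |(D (1, 0, 0)).1| • (Complex.I * (D (0, 0, c)).2.2)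

/-- Write `τ` for the derivative of the new time and `m` for the total `x`-derivative of the new
`x`. The relation `m² i M(i c) + τ M c = 0`, taken at `c` and at `i c`, gives `τ² = m⁴`, because `M`
has trivial kernel. So `m² = |τ|` whatever `b` is, and `M` commutes or anticommutes with `i`
according to the sign of `τ`. -/
theorem firstOrderStructure (hE : MapsEquation Φ γ σ V σ' V') {z : ℝ × ℝ × ℂ}
    (hz : z ∈ Φ.source) : FirstOrderStructure (fderiv ℝ Φ.toFun z) := by
  obtain ⟨hx0, hc0⟩ := fderiv_fst_eq_zero hE hz
  obtain ⟨e₀, b₀, hJ₀⟩ := exists_jac_ne_zero (fderiv_surjective hz)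
  have hrel := fun b h => comparison_relation (e := e₀) (b := b) hE hz h
  set D := fderiv ℝ Φ.toFun z with hD
  rw [jac_eq hx0 hc0] at hJ₀
  have hτ : (D (1, 0, 0)).1 ≠ 0 := left_ne_zero_of_mul hJ₀
  have hm₀ : (D (0, 1, b₀)).2.1 ≠ 0 := right_ne_zero_of_mul hJ₀
  have hcomm : ∀ (M : ℂ →L[ℝ] ℂ) (m t : ℝ),
      (∀ c, m • (Complex.I * M (Complex.I * c)) + t • M c = 0) →
      ∀ c, t • M (Complex.I * c) = m • (Complex.I * M c) := by
    intro M m t h c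
    have h1 := h (Complex.I * c)
    have h2 : Complex.I * (Complex.I * c) = -c := by
      rw [← mul_assoc, Complex.I_mul_I, neg_one_mul]
    rw [h2, map_neg] at h1
    simp only [Complex.real_smul] at h1 ⊢
    linear_combination h1
  have hsq : ∀ b, (D (0, 1, b)).2.1 ≠ 0 → (D (0, 1, b)).2.1 ^ 2 = |(D (1, 0, 0)).1| := by
    intro b hb
    obtain ⟨M, A, hM0, -, hM⟩ := hrel b (by rw [jac_eq hx0 hc0]; exact mul_ne_zero hτ hb)
    generalize (D (0, 1, b)).2.1 = m at *
    generalize (D (1, 0, 0)).1 = t at *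
    have h1 := hcomm M _ _ hM 1
    have h2 := hM 1
    simp only [Complex.real_smul] at h1 h2
    have h3 : ((t : ℂ) ^ 2 - ((m ^ 2 : ℝ) : ℂ) ^ 2) * M 1 = 0 := by
      linear_combination (t : ℂ) * h2 - ((m ^ 2 : ℝ) : ℂ) * Complex.I * h1 -
        ((m ^ 2 : ℝ) : ℂ) ^ 2 * M 1 * Complex.I_mul_I
    have h4 := (mul_eq_zero.1 h3).resolve_right fun h => one_ne_zero (hM0 1 h)
    have h5 : t ^ 2 = (m ^ 2) ^ 2 := by
      have := sub_eq_zero.1 h4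
      exact_mod_cast this
    rw [sq_eq_sq_iff_abs_eq_abs, abs_of_nonneg (sq_nonneg m)] at h5
    exact h5.symm
  have hξ : ∀ c, (D (0, 0, c)).2.1 = 0 := by
    intro c
    by_contra hne
    -- If the new `x` depended on the field, `m` would be a nonconstant affine function of `b` and
    -- could be given the value `|τ| + 1`. But `(|τ| + 1)² = |τ|` is impossible.
    set s := (|(D (1, 0, 0)).1| + 1 - (D (0, 1, 0)).2.1) / (D (0, 0, c)).2.1 with hs
    have h1 : (D (0, 1, s • c)).2.1 = |(D (1, 0, 0)).1| + 1 := by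
      have : ((0, 0, s • c) : ℝ × ℝ × ℂ) = s • ((0, 0, c) : ℝ × ℝ × ℂ) := by simp
      rw [split_space, this, map_smul, Prod.snd_add, Prod.fst_add, Prod.smul_snd, Prod.smul_fst,
        smul_eq_mul, hs, div_mul_cancel₀ _ hne]
      ring
    have hpos := abs_nonneg (D (1, 0, 0)).1
    have h2 := hsq (s • c) (by rw [h1]; positivity)
    rw [h1] at h2
    nlinarith
  have hm : ∀ b, (D (0, 1, b)).2.1 = (D (0, 1, 0)).2.1 := fun b => by
    rw [split_space, Prod.snd_add, Prod.fst_add, hξ, add_zero]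
  rw [hm] at hm₀
  refine ⟨hx0, hc0, hξ, hτ, hsq 0 hm₀, ?_⟩
  obtain ⟨M, A, -, hMD, hM⟩ := hrel 0 (by rw [jac_eq hx0 hc0]; exact mul_ne_zero hτ hm₀)
  -- With no field dependence in the base components, the correction term in `M` disappears and `M`
  -- is the field derivative of the field component.
  have hMD' : ∀ c, M c = (D (0, 0, c)).2.2 := fun c => by
    have : basePoint (D (0, 0, c)) = 0 := Prod.ext (hc0 c) (hξ c)
    rw [hMD, this, map_zero, sub_zero]
  intro c
  have := hcomm M _ _ hM c
  rwa [hMD', hMD', hsq 0 hm₀] at this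

/-! ### Time reflection -/

/-- The reflection `(t, x, ψ) ↦ (-t, x, ψ*)`. -/
noncomputable def reflection : (ℝ × ℝ × ℂ) ≃L[ℝ] ℝ × ℝ × ℂ :=
  (ContinuousLinearEquiv.neg ℝ).prodCongr
    ((ContinuousLinearEquiv.refl ℝ ℝ).prodCongr Complex.conjCLE)

theorem reflection_apply (z : ℝ × ℝ × ℂ) :
    reflection z = (-z.1, z.2.1, (starRingEnd ℂ) z.2.2) := rfl

theorem reflection_symm_apply (z : ℝ × ℝ × ℂ) : reflection.symm z = reflection z := by
  rw [ContinuousLinearEquiv.symm_apply_eq]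
  simp [reflection_apply]

variable (Φ) in
/-- A point transformation followed by the reflection. -/
noncomputable def reflect : PointTransformation where
  toOpenPartialHomeomorph := Φ.toOpenPartialHomeomorph.transHomeomorph reflection.toHomeomorph
  contDiffOn_toFun := reflection.contDiff.comp_contDiffOn Φ.contDiffOn_toFun
  contDiffOn_invFun := Φ.contDiffOn_invFun.comp reflection.symm.contDiff.contDiffOn
    fun _ hx => hx

theorem reflect_toFun (z : ℝ × ℝ × ℂ) : (reflect Φ).toFun z = reflection (Φ.toFun z) := rfl

theorem mem_reflect_target {z : ℝ × ℝ × ℂ} :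
    z ∈ (reflect Φ).target ↔ reflection z ∈ Φ.target := by
  rw [← reflection_symm_apply]; rfl

theorem deriv_conj_comp (f : ℝ → ℂ) (x : ℝ) :
    deriv (fun s => (starRingEnd ℂ) (f s)) x = (starRingEnd ℂ) (deriv f x) := by
  exact deriv.star

/-- Reversing time changes the sign of `ψ_t` and conjugation changes the sign of `i`. The two signs
cancel, so the class is preserved with conjugated `σ` and with `V` conjugated and reflected. -/
theorem nlsExpr_conj (γ : ℝ) (σ : ℂ) (V ψ : ℝ × ℝ → ℂ) (p : ℝ × ℝ) :
    nlsExpr γ σ V (fun q => (starRingEnd ℂ) (ψ (-q.1, q.2))) p =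
      (starRingEnd ℂ) (nlsExpr γ ((starRingEnd ℂ) σ)
        (fun q => (starRingEnd ℂ) (V (-q.1, q.2))) ψ (-p.1, p.2)) := by
  have h1 : deriv (fun s : ℝ => (starRingEnd ℂ) (ψ (-s, p.2))) p.1 =
      -(starRingEnd ℂ) (deriv (fun s : ℝ => ψ (s, p.2)) (-p.1)) := by
    rw [deriv_conj_comp, deriv_comp_neg (fun s => ψ (s, p.2)), map_neg]
  have h2 : iteratedDeriv 2 (fun y : ℝ => (starRingEnd ℂ) (ψ (-p.1, y))) p.2 =
      (starRingEnd ℂ) (iteratedDeriv 2 (fun y : ℝ => ψ (-p.1, y)) p.2) := by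
    rw [iteratedDeriv_two, iteratedDeriv_two, ← deriv_conj_comp]
    congr 1
    funext y
    exact deriv_conj_comp _ _
  simp only [nlsExpr, h1, h2, map_add, map_mul, Complex.conj_I, Complex.conj_conj,
    Complex.conj_ofReal, neg_neg, RCLike.norm_conj]
  ring

theorem MapsEquation_reflect (hE : MapsEquation Φ γ σ V σ' V') :
    MapsEquation (reflect Φ) γ σ V ((starRingEnd ℂ) σ')
      (fun q => (starRingEnd ℂ) (V' (-q.1, q.2))) := by
  intro ψ ψ'' p h
  have hb : ∀ q, basePoint ((reflect Φ).toFun (graphPoint ψ q)) =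
    (-(basePoint (Φ.toFun (graphPoint ψ q))).1, (basePoint (Φ.toFun (graphPoint ψ q))).2) :=
    fun q => rfl
  obtain ⟨hz, hψ, hψ'', heq⟩ := h
  have hc : CarriesGraph Φ ψ (fun q => (starRingEnd ℂ) (ψ'' (-q.1, q.2))) p := by
    refine ⟨hz, hψ, ?_, ?_⟩
    · refine Complex.conjCLE.contDiff.contDiffAt.comp _ (ContDiffAt.comp (g := ψ'') _ ?_
        (contDiffAt_fst.neg.prodMk contDiffAt_snd))
      exact hψ''
    · filter_upwards [heq] with q hq
      rw [hb] at hq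
      rw [← hq, reflect_toFun, reflection_apply, Complex.conj_conj]
  have := hE _ _ p hc
  rw [nlsExpr_conj, map_eq_zero_iff _ (RingHom.injective _)] at this
  exact this

end PointTransformation

/-! ### Rigidity of the modular nonlinearity -/

theorem hasDerivAt_norm_rpow_mul (γ : ℝ) {a : ℂ} (ha : a ≠ 0) (c : ℂ) :
    HasDerivAt (fun r : ℝ => ((‖a + r * c‖ ^ γ : ℝ) : ℂ) * (a + r * c))
      (((‖a‖ ^ γ : ℝ) : ℂ) * c + ((γ * ‖a‖ ^ (γ - 2) * (conj a * c).re : ℝ) : ℂ) * a) 0 := by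
  have h1 : HasDerivAt (fun r : ℝ => a + r * c) c 0 := by
    have := ((hasDerivAt_id (0 : ℝ)).ofReal_comp.mul_const c).const_add a
    simpa using this
  have hnpos : 0 < ‖a‖ := norm_pos_iff.2 ha
  have hn : HasDerivAt (fun r : ℝ => ‖a + r * c‖ ^ 2) (2 * (conj a * c).re) 0 := by
    have := h1.norm_sq
    refine this.congr_deriv ?_
    simp only [Complex.ofReal_zero, zero_mul, add_zero]
    rw [Complex.inner, mul_comm c]
  have h2 : HasDerivAt (fun r : ℝ => ‖a + r * c‖ ^ γ)
      (γ * ‖a‖ ^ (γ - 2) * (conj a * c).re) 0 := by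
    have h3 := hn.rpow_const (p := γ / 2) (Or.inl (by simpa using ha))
    have h4 : (fun r : ℝ => ‖a + r * c‖ ^ γ) = fun r : ℝ => (‖a + r * c‖ ^ 2) ^ (γ / 2) := by
      funext r
      rw [← Real.rpow_natCast, ← Real.rpow_mul (norm_nonneg _)]
      congr 1; push_cast; ring
    rw [h4]
    refine h3.congr_deriv ?_
    simp only [Complex.ofReal_zero, zero_mul, add_zero]
    have h5 : (‖a‖ ^ 2) ^ (γ / 2 - 1) = ‖a‖ ^ (γ - 2) := by
      rw [← Real.rpow_natCast, ← Real.rpow_mul (norm_nonneg _)]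
      congr 1; push_cast; ring
    rw [h5]; ring
  have := h2.ofReal_comp.mul h1
  refine this.congr_deriv ?_
  simp only [Complex.ofReal_zero, zero_mul, add_zero]
  ring

/-- The combination `f'(1) + i f'(i)` of directional derivatives is twice the antiholomorphic
derivative. This is its value on the real-linear form `c ↦ Re (w c)`. -/
theorem re_add_I_mul_re (w : ℂ) : (w.re : ℂ) + Complex.I * ((Complex.I * w).re : ℂ) = conj w := by
  apply Complex.ext <;> simp

/-- The antiholomorphic derivative annihilates the affine right-hand side. On the left, only the
derivative of the modulus survives, with a factor `γ` that is cancelled. -/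
theorem antilinear_part_identity {γ : ℝ} (hγ : γ ≠ 0) {A B σ k α β a : ℂ} (ha : a ≠ 0)
    (hg : A * a + B ≠ 0)
    (h : ∀ᶠ w in 𝓝 a, A * σ * (((‖w‖ ^ γ : ℝ) : ℂ) * w) -
      k * (((‖A * w + B‖ ^ γ : ℝ) : ℂ) * (A * w + B)) = α * w + β) :
    A * σ * ((‖a‖ ^ (γ - 2) : ℝ) : ℂ) * a ^ 2 =
      k * ((‖A * a + B‖ ^ (γ - 2) : ℝ) : ℂ) * (A * a + B) ^ 2 * conj A := by
  have key : ∀ c : ℂ, A * σ * (((‖a‖ ^ γ : ℝ) : ℂ) * c +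
      ((γ * ‖a‖ ^ (γ - 2) * (conj a * c).re : ℝ) : ℂ) * a) -
      k * (((‖A * a + B‖ ^ γ : ℝ) : ℂ) * (A * c) +
      ((γ * ‖A * a + B‖ ^ (γ - 2) * (conj (A * a + B) * (A * c)).re : ℝ) : ℂ) * (A * a + B)) =
      α * c := by
    intro c
    have h1 := ((hasDerivAt_norm_rpow_mul γ ha c).const_mul (A * σ)).sub
      ((hasDerivAt_norm_rpow_mul γ hg (A * c)).const_mul k)
    have h2 : HasDerivAt (fun r : ℝ => α * (a + r * c) + β) (α * c) 0 := by
      have := ((((hasDerivAt_id (0 : ℝ)).ofReal_comp.mul_const c).const_add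
        a).const_mul α).add_const β
      simpa using this
    have ht : Tendsto (fun r : ℝ => a + r * c) (𝓝 0) (𝓝 a) := by
      have : ContinuousAt (fun r : ℝ => a + r * c) 0 := by fun_prop
      simpa [ContinuousAt] using this
    refine h1.unique (h2.congr_of_eventuallyEq ?_)
    filter_upwards [ht.eventually h] with r hr
    rw [← hr]
    have : A * a + B + r * (A * c) = A * (a + r * c) + B := by ring
    simp only [Pi.sub_apply, this]
  have k1 := key 1
  have k2 := key Complex.I
  have e1 := re_add_I_mul_re (conj a * 1)
  have e2 := re_add_I_mul_re (conj (A * a + B) * (A * 1))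
  have e3 : conj a * Complex.I = Complex.I * (conj a * 1) := by ring
  have e4 : conj (A * a + B) * (A * Complex.I) = Complex.I * (conj (A * a + B) * (A * 1)) := by ring
  rw [e3, e4] at k2
  have hγ' : (γ : ℂ) ≠ 0 := Complex.ofReal_ne_zero.2 hγ
  apply mul_left_cancel₀ hγ'
  simp only [map_mul, Complex.conj_conj, mul_one] at e1 e2 k1 k2
  push_cast at k1 k2 ⊢
  linear_combination k1 + Complex.I * k2 -
    A * σ * γ * ((‖a‖ ^ (γ - 2) : ℝ) : ℂ) * a * e1 +
    k * γ * ((‖A * a + B‖ ^ (γ - 2) : ℝ) : ℂ) * (A * a + B) * e2 +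
    (α - A * σ * ((‖a‖ ^ γ : ℝ) : ℂ) + k * ((‖A * a + B‖ ^ γ : ℝ) : ℂ) * A) * Complex.I_mul_I

/-- Three equally spaced points suffice to compare coefficients of polynomials of degree at most two
by first and second differences. -/
theorem Complex.eventually_real_shift {P : ℂ → Prop} {a : ℂ} (h : ∀ᶠ w in 𝓝 a, P w) :
    ∃ d : ℝ, d ≠ 0 ∧ P a ∧ P (a + d) ∧ P (a - d) := by
  obtain ⟨r, hr, hb⟩ := Metric.eventually_nhds_iff_ball.1 h
  refine ⟨r / 2, by positivity, hb _ (Metric.mem_ball_self hr), hb _ ?_, hb _ ?_⟩ <;>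
  · rw [Metric.mem_ball, dist_eq_norm]
    simp only [add_sub_cancel_left, sub_sub_cancel_left, norm_neg, Complex.norm_real,
      Real.norm_eq_abs]
    rw [abs_of_pos (by positivity)]
    linarith

/-- Rigidity of the modular nonlinearity under affine substitutions. -/
theorem affine_rigidity {γ : ℝ} (hγ : γ ≠ 0) {A B σ k α β a₀ : ℂ} (ha : a₀ ≠ 0) (hA : A ≠ 0)
    (hσ : σ ≠ 0) (hk : k ≠ 0) (hg : A * a₀ + B ≠ 0)
    (h : ∀ᶠ w in 𝓝 a₀, A * σ * (((‖w‖ ^ γ : ℝ) : ℂ) * w) -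
      k * (((‖A * w + B‖ ^ γ : ℝ) : ℂ) * (A * w + B)) = α * w + β) :
    B = 0 ∧ σ = k * ((‖A‖ ^ γ : ℝ) : ℂ) ∧ α = 0 := by
  have hne : ∀ᶠ w in 𝓝 a₀, w ≠ 0 := eventually_ne_nhds ha
  have hgne : ∀ᶠ w in 𝓝 a₀, A * w + B ≠ 0 := by
    have : ContinuousAt (fun w : ℂ => A * w + B) a₀ := by fun_prop
    exact this.eventually_ne hg
  have hid : ∀ᶠ w in 𝓝 a₀, A * σ * ((‖w‖ ^ (γ - 2) : ℝ) : ℂ) * w ^ 2 =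
      k * ((‖A * w + B‖ ^ (γ - 2) : ℝ) : ℂ) * (A * w + B) ^ 2 * conj A := by
    filter_upwards [hne, hgne, h.eventually_nhds] with w h1 h2 h3
    exact antilinear_part_identity hγ h1 h2 h3
  set μ : ℝ := (‖σ‖ / ‖k‖) ^ (1 / γ) with hμ
  have hσ' : 0 < ‖σ‖ := norm_pos_iff.2 hσ
  have hk' : 0 < ‖k‖ := norm_pos_iff.2 hk
  have hA' : 0 < ‖A‖ := norm_pos_iff.2 hA
  have hμpos : 0 < μ := by positivity
  -- Taking norms in `hid` gives `|σ| |w|^γ = |k| |A w + B|^γ`. As `γ ≠ 0`, the root can be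
  -- extracted, and `|A w + B|` is a constant multiple of `|w|`.
  have hmod : ∀ᶠ w in 𝓝 a₀, ‖A * w + B‖ = μ * ‖w‖ := by
    filter_upwards [hne, hgne, hid] with w h1 h2 h3
    have hw : 0 < ‖w‖ := norm_pos_iff.2 h1
    have hgw : 0 < ‖A * w + B‖ := norm_pos_iff.2 h2
    have h4 := congrArg norm h3
    simp only [norm_mul, norm_pow, Complex.norm_real, RCLike.norm_conj] at h4
    rw [Real.norm_of_nonneg (by positivity), Real.norm_of_nonneg (by positivity)] at h4
    have h5 : ∀ y : ℝ, 0 < y → y ^ (γ - 2) * y ^ 2 = y ^ γ := fun y hy => by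
      rw [← Real.rpow_natCast, ← Real.rpow_add hy]; norm_num
    have h6 : ‖σ‖ * ‖w‖ ^ γ = ‖k‖ * ‖A * w + B‖ ^ γ := by
      rw [← h5 _ hw, ← h5 _ hgw]
      apply mul_left_cancel₀ hA'.ne'
      linear_combination h4
    have h7 : ‖A * w + B‖ ^ γ = (‖σ‖ / ‖k‖) * ‖w‖ ^ γ := by
      field_simp
      linear_combination -h6
    have h8 : ‖A * w + B‖ = (‖A * w + B‖ ^ γ) ^ (1 / γ) := by
      rw [← Real.rpow_mul hgw.le, mul_one_div_cancel hγ, Real.rpow_one]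
    rw [h8, h7, Real.mul_rpow (by positivity) (by positivity), ← Real.rpow_mul hw.le,
      mul_one_div_cancel hγ, Real.rpow_one]
  -- With the moduli proportional, the powers of `|w|` cancel in `hid`, and a polynomial identity in
  -- `w` is left.
  have hpoly : ∀ᶠ w in 𝓝 a₀, A * σ * w ^ 2 =
      k * ((μ ^ (γ - 2) : ℝ) : ℂ) * conj A * (A * w + B) ^ 2 := by
    filter_upwards [hne, hid, hmod] with w h1 h3 h4
    have hw : 0 < ‖w‖ := norm_pos_iff.2 h1
    rw [h4, Real.mul_rpow hμpos.le hw.le] at h3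
    have h5 : ((‖w‖ ^ (γ - 2) : ℝ) : ℂ) ≠ 0 :=
      Complex.ofReal_ne_zero.2 (Real.rpow_pos_of_pos hw _).ne'
    apply mul_left_cancel₀ h5
    push_cast at h3 ⊢
    linear_combination h3
  have hK : k * ((μ ^ (γ - 2) : ℝ) : ℂ) * conj A ≠ 0 :=
    mul_ne_zero (mul_ne_zero hk (Complex.ofReal_ne_zero.2 (Real.rpow_pos_of_pos hμpos _).ne'))
      ((map_ne_zero _).2 hA)
  have hB : B = 0 := by
    obtain ⟨d, hd, p0, p1, p2⟩ := Complex.eventually_real_shift hpoly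
    have hd' : (d : ℂ) ≠ 0 := Complex.ofReal_ne_zero.2 hd
    generalize k * ((μ ^ (γ - 2) : ℝ) : ℂ) * conj A = K at *
    have q1 : A * σ - K * A ^ 2 = 0 := by
      have : (d : ℂ) ^ 2 * (2 * (A * σ - K * A ^ 2)) = 0 := by
        linear_combination p1 + p2 - 2 * p0
      have := (mul_eq_zero.1 this).resolve_left (pow_ne_zero 2 hd')
      exact (mul_eq_zero.1 this).resolve_left two_ne_zero
    have q2 : (d : ℂ) * (4 * K * A * B) = 0 := by
      linear_combination -(p1 - p2) + 4 * a₀ * d * q1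
    have q3 := (mul_eq_zero.1 q2).resolve_left hd'
    exact (mul_eq_zero.1 q3).resolve_left
      (mul_ne_zero (mul_ne_zero (by norm_num) hK) hA)
  subst hB
  simp only [add_zero] at *
  have hσk : σ = k * ((‖A‖ ^ γ : ℝ) : ℂ) := by
    have h1 := hid.self_of_nhds
    have ha' : 0 < ‖a₀‖ := norm_pos_iff.2 ha
    rw [norm_mul, Real.mul_rpow hA'.le ha'.le] at h1
    have h2 : ((‖A‖ ^ γ : ℝ) : ℂ) = ((‖A‖ ^ (γ - 2) : ℝ) : ℂ) * (conj A * A) := by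
      rw [mul_comm (conj A), Complex.mul_conj, Complex.normSq_eq_norm_sq, ← Complex.ofReal_mul]
      congr 1
      rw [← Real.rpow_natCast, ← Real.rpow_add hA']; norm_num
    have h5 : ((‖a₀‖ ^ (γ - 2) : ℝ) : ℂ) ≠ 0 :=
      Complex.ofReal_ne_zero.2 (Real.rpow_pos_of_pos ha' _).ne'
    rw [h2]
    have h6 : A * ((‖a₀‖ ^ (γ - 2) : ℝ) : ℂ) * a₀ ^ 2 ≠ 0 :=
      mul_ne_zero (mul_ne_zero hA h5) (pow_ne_zero 2 ha)
    apply mul_left_cancel₀ h6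
    push_cast at h1 ⊢
    linear_combination h1
  refine ⟨trivial, hσk, ?_⟩
  -- For `B = 0` and `σ = k |A|^γ` the two nonlinear terms cancel exactly, so the affine right-hand
  -- side vanishes near `a₀`.
  have hlin : ∀ᶠ w in 𝓝 a₀, α * w + β = 0 := by
    filter_upwards [h] with w hw
    rw [← hw, norm_mul, Real.mul_rpow hA'.le (norm_nonneg _), hσk]
    push_cast; ring
  obtain ⟨d, hd, p0, p1, -⟩ := Complex.eventually_real_shift hlin
  have hd' : (d : ℂ) ≠ 0 := Complex.ofReal_ne_zero.2 hd
  have : (d : ℂ) * α = 0 := by linear_combination p1 - p0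
  exact (mul_eq_zero.1 this).resolve_left hd'

theorem HasDerivAt.prod_fst {E F : Type*} [NormedAddCommGroup E] [NormedSpace ℝ E]
    [NormedAddCommGroup F] [NormedSpace ℝ F] {g : ℝ → E × F} {g' : E × F} {x : ℝ}
    (h : HasDerivAt g g' x) : HasDerivAt (fun y => (g y).1) g'.1 x := by
  simpa using (HasFDerivAt.fst h.hasFDerivAt).hasDerivAt

theorem HasDerivAt.prod_snd {E F : Type*} [NormedAddCommGroup E] [NormedSpace ℝ E]
    [NormedAddCommGroup F] [NormedSpace ℝ F] {g : ℝ → E × F} {g' : E × F} {x : ℝ}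
    (h : HasDerivAt g g' x) : HasDerivAt (fun y => (g y).2) g'.2 x := by
  simpa using (HasFDerivAt.snd h.hasFDerivAt).hasDerivAt

/-! ### Normal form of the base components -/

namespace PointTransformation

variable {Φ : PointTransformation} {γ : ℝ} {σ σ' : ℂ} {V V' : ℝ × ℝ → ℂ}

theorem mem_ball_triple {z₀ z : ℝ × ℝ × ℂ} {r : ℝ} : z ∈ Metric.ball z₀ r ↔
    z.1 ∈ Metric.ball z₀.1 r ∧ z.2.1 ∈ Metric.ball z₀.2.1 r ∧ z.2.2 ∈ Metric.ball z₀.2.2 r := by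
  simp [Metric.mem_ball, Prod.dist_eq]

theorem eq_of_hasFDerivAt_eq_zero {E F : Type*} [NormedAddCommGroup E] [NormedSpace ℝ E]
    [NormedAddCommGroup F] [NormedSpace ℝ F] {s : Set E} (hs : Convex ℝ s) {g : E → F}
    (h : ∀ x ∈ s, HasFDerivAt g (0 : E →L[ℝ] F) x) {x y : E} (hx : x ∈ s) (hy : y ∈ s) :
    g x = g y := by
  have := hs.norm_image_sub_le_of_norm_hasFDerivWithin_le (𝕜 := ℝ) (f := g)
    (f' := fun _ => (0 : E →L[ℝ] F)) (C := 0)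
    (fun z hz => (h z hz).hasFDerivWithinAt) (by simp) hy hx
  rw [zero_mul, norm_le_zero_iff, sub_eq_zero] at this
  exact this

theorem hasFDerivAt_slice {f : ℝ × ℝ × ℂ → ℝ × ℝ × ℂ} {D : ℝ × ℝ × ℂ →L[ℝ] ℝ × ℝ × ℂ} {t x : ℝ}
    {a : ℂ} (h : HasFDerivAt f D (t, x, a)) :
    HasDerivAt (fun s => f (s, x, a)) (D (1, 0, 0)) t ∧
    HasDerivAt (fun y => f (t, y, a)) (D (0, 1, 0)) x ∧
    HasFDerivAt (fun c => f (t, x, c)) (D.comp ((ContinuousLinearMap.inr ℝ ℝ (ℝ × ℂ)).comp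
      (ContinuousLinearMap.inr ℝ ℝ ℂ))) a := by
  refine ⟨h.comp_hasDerivAt_of_eq t ((hasDerivAt_id t).prodMk ((hasDerivAt_const t x).prodMk
      (hasDerivAt_const t a))) rfl,
    h.comp_hasDerivAt_of_eq x ((hasDerivAt_const x t).prodMk ((hasDerivAt_id x).prodMk
      (hasDerivAt_const x a))) rfl, ?_⟩
  have hi : HasFDerivAt (fun c : ℂ => ((t, x, c) : ℝ × ℝ × ℂ))
      ((ContinuousLinearMap.inr ℝ ℝ (ℝ × ℂ)).comp (ContinuousLinearMap.inr ℝ ℝ ℂ)) a := by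
    exact (hasFDerivAt_const (𝕜 := ℝ) t a).prodMk
      ((hasFDerivAt_const (𝕜 := ℝ) x a).prodMk (hasFDerivAt_id (𝕜 := ℝ) a))
  exact h.comp a hi

/-- The normal form of the base components of a time-orientation preserving transformation. -/
theorem exists_base_normalForm (hE : MapsEquation Φ γ σ V σ' V') {z₀ : ℝ × ℝ × ℂ}
    (hz₀ : z₀ ∈ Φ.source) (hpos : 0 < (fderiv ℝ Φ.toFun z₀ (1, 0, 0)).1) :
    ∃ r > 0, Metric.ball z₀ r ⊆ Φ.source ∧ ∃ T s η : ℝ → ℝ,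
      ContDiffOn ℝ ∞ s (Metric.ball z₀.1 r) ∧ ContDiffOn ℝ ∞ η (Metric.ball z₀.1 r) ∧
      (∀ t ∈ Metric.ball z₀.1 r, s t ≠ 0 ∧ HasDerivAt T (s t ^ 2) t) ∧
      (∀ z ∈ Metric.ball z₀ r, basePoint (Φ.toFun z) = (T z.1, s z.1 * z.2.1 + η z.1)) ∧
      ∀ z ∈ Metric.ball z₀ r, ∀ c, (fderiv ℝ Φ.toFun z (0, 0, Complex.I * c)).2.2 =
        Complex.I * (fderiv ℝ Φ.toFun z (0, 0, c)).2.2 := by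
  obtain ⟨t₀, x₀, a₀⟩ := z₀
  have hDs : ∀ z ∈ Φ.source, ContDiffAt ℝ ∞ (fderiv ℝ Φ.toFun) z := fun z hz =>
    (contDiffAt hz).fderiv_right (by simp)
  have hev : ∀ᶠ z in 𝓝 ((t₀, x₀, a₀) : ℝ × ℝ × ℂ), z ∈ Φ.source ∧
      0 < (fderiv ℝ Φ.toFun z (1, 0, 0)).1 := by
    refine Filter.Eventually.and (Φ.open_source.mem_nhds hz₀) ?_
    have hc : ContinuousAt (fun z => (fderiv ℝ Φ.toFun z (1, 0, 0)).1) (t₀, x₀, a₀) :=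
      continuousAt_fst.comp ((hDs _ hz₀).clm_apply contDiffAt_const).continuousAt
    exact hc.eventually (lt_mem_nhds hpos)
  obtain ⟨r, hr, hb⟩ := Metric.eventually_nhds_iff_ball.1 hev
  have hsub : Metric.ball (t₀, x₀, a₀) r ⊆ Φ.source := fun z hz => (hb z hz).1
  have hS := fun z hz => firstOrderStructure hE (hsub hz : z ∈ Φ.source)
  set f := Φ.toFun with hf
  have hfd : ∀ z ∈ Metric.ball ((t₀, x₀, a₀) : ℝ × ℝ × ℂ) r, HasFDerivAt f (fderiv ℝ f z) z :=
    fun z hz => hasFDerivAt (hsub hz)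
  have hx₀ : x₀ ∈ Metric.ball x₀ r := Metric.mem_ball_self hr
  have ha₀ : a₀ ∈ Metric.ball a₀ r := Metric.mem_ball_self hr
  have hmem : ∀ {t x a}, t ∈ Metric.ball t₀ r → x ∈ Metric.ball x₀ r → a ∈ Metric.ball a₀ r →
      ((t, x, a) : ℝ × ℝ × ℂ) ∈ Metric.ball (t₀, x₀, a₀) r := fun h1 h2 h3 =>
    mem_ball_triple.2 ⟨h1, h2, h3⟩
  -- independence of the field variable
  have hind : ∀ {t x a}, t ∈ Metric.ball t₀ r → x ∈ Metric.ball x₀ r → a ∈ Metric.ball a₀ r →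
      basePoint (f (t, x, a)) = basePoint (f (t, x, a₀)) := by
    intro t x a ht hx ha
    refine eq_of_hasFDerivAt_eq_zero (convex_ball a₀ r)
      (g := fun c => basePoint (f (t, x, c))) (fun c hc => ?_) ha ha₀
    have h1 := basePointCLM.hasFDerivAt.comp c (hasFDerivAt_slice (hfd _ (hmem ht hx hc))).2.2
    refine h1.congr_fderiv ?_
    ext v
    · exact (hS _ (hmem ht hx hc)).time_field v
    · exact (hS _ (hmem ht hx hc)).space_field v
  have hindT : ∀ {t x}, t ∈ Metric.ball t₀ r → x ∈ Metric.ball x₀ r →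
      (f (t, x, a₀)).1 = (f (t, x₀, a₀)).1 := by
    intro t x ht hx
    refine Metric.isOpen_ball.is_const_of_deriv_eq_zero (f := fun y => (f (t, y, a₀)).1)
      (convex_ball x₀ r).isPreconnected ?_ ?_ hx hx₀
    · exact fun y hy => ((hasFDerivAt_slice
        (hfd _ (hmem ht hy ha₀))).2.1.prod_fst).differentiableAt.differentiableWithinAt
    · intro y hy
      have := (hasFDerivAt_slice (hfd _ (hmem ht hy ha₀))).2.1.prod_fst
      rw [this.deriv]
      exact (hS _ (hmem ht hy ha₀)).time_space
  -- the time derivative does not depend on `x`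
  have hτ : ∀ {t x}, t ∈ Metric.ball t₀ r → x ∈ Metric.ball x₀ r →
      (fderiv ℝ f (t, x, a₀) (1, 0, 0)).1 = (fderiv ℝ f (t, x₀, a₀) (1, 0, 0)).1 := by
    intro t x ht hx
    have h1 := (hasFDerivAt_slice (hfd _ (hmem ht hx ha₀))).1.prod_fst
    have h2 := (hasFDerivAt_slice (hfd _ (hmem ht hx₀ ha₀))).1.prod_fst
    refine h1.unique (h2.congr_of_eventuallyEq ?_)
    filter_upwards [Metric.isOpen_ball.mem_nhds ht] with y hy
    exact hindT hy hx
  have hsq : ∀ {t x}, t ∈ Metric.ball t₀ r → x ∈ Metric.ball x₀ r →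
      (fderiv ℝ f (t, x, a₀) (0, 1, 0)).2.1 ^ 2 = (fderiv ℝ f (t, x₀, a₀) (1, 0, 0)).1 := by
    intro t x ht hx
    rw [(hS _ (hmem ht hx ha₀)).space_sq, abs_of_pos (hb _ (hmem ht hx ha₀)).2, hτ ht hx]
  set s : ℝ → ℝ := fun t => (fderiv ℝ f (t, x₀, a₀) (0, 1, 0)).2.1 with hs
  have hs0 : ∀ t ∈ Metric.ball t₀ r, s t ≠ 0 := by
    intro t ht h0
    have h1 := hsq ht hx₀
    have h2 := (hb _ (hmem ht hx₀ ha₀)).2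
    have h3 : (fderiv ℝ f (t, x₀, a₀) (0, 1, 0)).2.1 = 0 := h0
    rw [h3] at h1
    norm_num at h1
    linarith
  -- The square of the `x`-derivative is independent of `x` and nonzero. By continuity on an
  -- interval the derivative keeps its sign, so it does not depend on `x` either.
  have hsx : ∀ {t x}, t ∈ Metric.ball t₀ r → x ∈ Metric.ball x₀ r →
      (fderiv ℝ f (t, x, a₀) (0, 1, 0)).2.1 = s t := by
    intro t x ht hx
    refine (convex_ball x₀ r).isPreconnected.eq_of_sq_eq
      (f := fun y => (fderiv ℝ f (t, y, a₀) (0, 1, 0)).2.1) (g := fun _ => s t)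
      ?_ continuousOn_const ?_ (fun _ => hs0 t ht) hx₀ rfl hx
    · intro y hy
      refine ContinuousAt.continuousWithinAt ?_
      have h1 := (hDs _ (hsub (hmem ht hy ha₀)))
      have h2 : ContDiffAt ℝ ∞ (fun y : ℝ => ((t, y, a₀) : ℝ × ℝ × ℂ)) y :=
        contDiffAt_const.prodMk (contDiffAt_id.prodMk contDiffAt_const)
      have h3 : ContDiffAt ℝ ∞ (fun y : ℝ => fderiv ℝ f (t, y, a₀)) y :=
        ContDiffAt.comp (g := fderiv ℝ f) y h1 h2
      exact ((h3.clm_apply contDiffAt_const).snd.fst).continuousAt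
    · intro y hy
      simp only [Pi.pow_apply]
      rw [hsq ht hy, ← hsq ht hx₀]
  have hslin : ∀ {t x}, t ∈ Metric.ball t₀ r → x ∈ Metric.ball x₀ r →
      (f (t, x, a₀)).2.1 - s t * x = (f (t, x₀, a₀)).2.1 - s t * x₀ := by
    intro t x ht hx
    have hd : ∀ y ∈ Metric.ball x₀ r,
        HasDerivAt (fun y => (f (t, y, a₀)).2.1 - s t * y) 0 y := by
      intro y hy
      have h1 : HasDerivAt (fun y => (f (t, y, a₀)).2.1) (fderiv ℝ f (t, y, a₀) (0, 1, 0)).2.1 y :=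
        (hasFDerivAt_slice (hfd _ (hmem ht hy ha₀))).2.1.prod_snd.prod_fst
      refine (h1.sub ((hasDerivAt_id y).const_mul (s t))).congr_deriv ?_
      rw [hsx ht hy]; ring
    exact Metric.isOpen_ball.is_const_of_deriv_eq_zero
      (f := fun y => (f (t, y, a₀)).2.1 - s t * y) (convex_ball x₀ r).isPreconnected
      (fun y hy => (hd y hy).differentiableAt.differentiableWithinAt)
      (fun y hy => (hd y hy).deriv) hx hx₀
  have hcurve : ∀ t, ContDiffAt ℝ ∞ (fun t : ℝ => ((t, x₀, a₀) : ℝ × ℝ × ℂ)) t := fun t =>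
    contDiffAt_id.prodMk (contDiffAt_const.prodMk contDiffAt_const)
  have hss : ∀ t ∈ Metric.ball t₀ r, ContDiffAt ℝ ∞ s t := by
    intro t ht
    have h3 : ContDiffAt ℝ ∞ (fun t : ℝ => fderiv ℝ f (t, x₀, a₀)) t :=
      ContDiffAt.comp (g := fderiv ℝ f) t (hDs _ (hsub (hmem ht hx₀ ha₀))) (hcurve t)
    exact (h3.clm_apply contDiffAt_const).snd.fst
  refine ⟨r, hr, hsub, fun t => (f (t, x₀, a₀)).1, s, fun t => (f (t, x₀, a₀)).2.1 - s t * x₀,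
    fun t ht => (hss t ht).contDiffWithinAt, fun t ht => ?_, fun t ht => ⟨hs0 t ht, ?_⟩, ?_, ?_⟩
  · refine ContDiffAt.contDiffWithinAt ?_
    have h3 : ContDiffAt ℝ ∞ (fun t : ℝ => f (t, x₀, a₀)) t :=
      ContDiffAt.comp (g := f) t (contDiffAt (hsub (hmem ht hx₀ ha₀))) (hcurve t)
    exact h3.snd.fst.sub ((hss t ht).mul contDiffAt_const)
  · have := (hasFDerivAt_slice (hfd _ (hmem ht hx₀ ha₀))).1.prod_fst
    rw [show s t ^ 2 = (fderiv ℝ f (t, x₀, a₀) (1, 0, 0)).1 from hsq ht hx₀]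
    exact this
  · rintro ⟨t, x, a⟩ hz
    obtain ⟨ht, hx, ha⟩ := mem_ball_triple.1 hz
    simp only at ht hx ha ⊢
    rw [hind ht hx ha]
    refine Prod.ext (hindT ht hx) ?_
    simp only [basePoint]
    linear_combination hslin ht hx
  · intro z hz c
    have h1 := (hS z hz).field_rotate c
    have h2 := (hb z hz).2
    rw [abs_of_pos h2] at h1
    exact smul_right_injective ℂ h2.ne' h1

end PointTransformation

/-! ### The equation for the field component -/

namespace PointTransformation

variable {Φ : PointTransformation} {γ : ℝ} {σ σ' : ℂ} {V V' : ℝ × ℝ → ℂ}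

variable (Φ) in
/-- The field component of a point transformation. -/
def field (z : ℝ × ℝ × ℂ) : ℂ := (Φ.toFun z).2.2

theorem contDiffAt_field {z : ℝ × ℝ × ℂ} (hz : z ∈ Φ.source) : ContDiffAt ℝ ∞ Φ.field z :=
  (contDiffAt hz).snd.snd

theorem hasFDerivAt_field {z : ℝ × ℝ × ℂ} (hz : z ∈ Φ.source) :
    HasFDerivAt Φ.field (fderiv ℝ Φ.field z) z :=
  ((contDiffAt_field hz).differentiableAt (by simp)).hasFDerivAt

theorem hasFDerivAt_fderiv_field {z : ℝ × ℝ × ℂ} (hz : z ∈ Φ.source) :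
    HasFDerivAt (fderiv ℝ Φ.field) (fderiv ℝ (fderiv ℝ Φ.field) z) z :=
  (((contDiffAt_field hz).fderiv_right (m := ∞) (by simp)).differentiableAt (by simp)).hasFDerivAt

theorem fderiv_field_apply {z : ℝ × ℝ × ℂ} (hz : z ∈ Φ.source) (v : ℝ × ℝ × ℂ) :
    fderiv ℝ Φ.field z v = (fderiv ℝ Φ.toFun z v).2.2 := by
  have := (hasFDerivAt hz).snd.snd
  exact DFunLike.congr_fun ((hasFDerivAt_field hz).unique this) v

/-- The equation for the field component on all first jets. -/
theorem field_relation (hE : MapsEquation Φ γ σ V σ' V') {z₀ : ℝ × ℝ × ℂ} {r : ℝ}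
    (hsub : Metric.ball z₀ r ⊆ Φ.source) {T s η : ℝ → ℝ}
    (hs : ContDiffOn ℝ ∞ s (Metric.ball z₀.1 r)) (hη : ContDiffOn ℝ ∞ η (Metric.ball z₀.1 r))
    (hT : ∀ t ∈ Metric.ball z₀.1 r, s t ≠ 0 ∧ HasDerivAt T (s t ^ 2) t)
    (hbase : ∀ z ∈ Metric.ball z₀ r, basePoint (Φ.toFun z) = (T z.1, s z.1 * z.2.1 + η z.1))
    {t x : ℝ} {a : ℂ} (hz : (t, x, a) ∈ Metric.ball z₀ r) (b : ℂ) :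
    Complex.I * (fderiv ℝ Φ.field (t, x, a)
        (1, 0, Complex.I * (σ * ((‖a‖ ^ γ : ℝ) : ℂ) * a + V (t, x) * a)) -
      ((deriv s t * x + deriv η t) / s t) • fderiv ℝ Φ.field (t, x, a) (0, 1, b)) +
      fderiv ℝ (fderiv ℝ Φ.field) (t, x, a) (0, 1, b) (0, 1, b) +
      s t ^ 2 • (σ' * ((‖Φ.field (t, x, a)‖ ^ γ : ℝ) : ℂ) * Φ.field (t, x, a) +
        V' (T t, s t * x + η t) * Φ.field (t, x, a)) = 0 := by
  set z : ℝ × ℝ × ℂ := (t, x, a) with hzdef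
  set p : ℝ × ℝ := (t, x) with hp
  -- This value of `ψ_t` solves the equation with `ψ_xx = 0`. The test graph is then affine in `x`,
  -- and the second `x`-derivative of the field component along it is its Hessian on `(0, 1, b)`,
  -- with no first-order term. The slope `b` stays free.
  set e := Complex.I * (σ * ((‖a‖ ^ γ : ℝ) : ℂ) * a + V (t, x) * a) with he
  set ψ := jetPoly p a e b 0 0 with hψ
  have hzs : z ∈ Φ.source := hsub hz
  have ht : t ∈ Metric.ball z₀.1 r := (mem_ball_triple.1 hz).1
  obtain ⟨hs0, hTd⟩ := hT t ht
  have hS := firstOrderStructure hE hzs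
  have hJ : jac (fderiv ℝ Φ.toFun z) e b ≠ 0 := by
    rw [jac_eq hS.time_space hS.time_field, split_space, Prod.snd_add, Prod.fst_add,
      hS.space_field, add_zero]
    refine mul_ne_zero hS.time_ne fun h0 => ?_
    have h1 := hS.space_sq
    rw [h0] at h1
    have h2 := abs_pos.2 hS.time_ne
    norm_num at h1
    exact h2.ne h1
  have hgψ : graphPoint ψ p = z := graphPoint_jetPoly z e b 0 0
  obtain ⟨ψ', hc⟩ : ∃ ψ', CarriesGraph Φ ψ ψ' p :=
    exists_carriesGraph_jetPoly hzs (totalBase_injective hJ) 0 0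
  have hn : nlsExpr γ σ V ψ p = 0 := by
    rw [hψ, nlsExpr_jetPoly, he]
    linear_combination (σ * ((‖a‖ ^ γ : ℝ) : ℂ) * a + V (t, x) * a) * Complex.I_mul_I
  have hn' := (hE ψ ψ' p hc).1 hn
  have hval := hc.apply
  obtain ⟨-, hψs, hψ's, heq⟩ := hc
  rw [baseMap, hgψ] at hval
  rw [hgψ] at hn' hψ's
  rw [hbase z hz] at hn' hval hψ's
  change nlsExpr γ σ' V' ψ' (T t, s t * x + η t) = 0 at hn'
  change ψ' (T t, s t * x + η t) = Φ.field z at hval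
  change ContDiffAt ℝ ∞ ψ' (T t, s t * x + η t) at hψ's
  set P : ℝ × ℝ := (T t, s t * x + η t) with hP
  have hG : ∀ᶠ q in 𝓝 p, Φ.field (graphPoint ψ q) = ψ' (T q.1, s q.1 * q.2 + η q.1) := by
    have hcont : ContinuousAt (graphPoint ψ) p := (contDiffAt_graphPoint hψs).continuousAt
    have h1 : ∀ᶠ q in 𝓝 p, graphPoint ψ q ∈ Metric.ball z₀ r := by
      refine hcont.eventually (Metric.isOpen_ball.mem_nhds ?_)
      rw [hgψ]; exact hz
    filter_upwards [heq, h1] with q hq h2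
    rw [hbase _ h2] at hq
    exact hq
  have hψ'd : HasFDerivAt ψ' (fderiv ℝ ψ' P) P := (hψ's.differentiableAt (by simp)).hasFDerivAt
  -- time direction
  have hsd : HasDerivAt s (deriv s t) t :=
    ((hs.contDiffAt (Metric.isOpen_ball.mem_nhds ht)).differentiableAt (by simp)).hasDerivAt
  have hηd : HasDerivAt η (deriv η t) t :=
    ((hη.contDiffAt (Metric.isOpen_ball.mem_nhds ht)).differentiableAt (by simp)).hasDerivAt
  have htime : fderiv ℝ Φ.field z (1, 0, e) = s t ^ 2 • fderiv ℝ ψ' P (1, 0) +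
      (deriv s t * x + deriv η t) • fderiv ℝ ψ' P (0, 1) := by
    have h1 : HasDerivAt (fun u => Φ.field (graphPoint ψ (u, x)))
        (fderiv ℝ Φ.field z (1, 0, e)) t := by
      have h2 : HasDerivAt (fun u => graphPoint ψ (u, x)) ((1, 0, e) : ℝ × ℝ × ℂ) t := by
        refine (hasDerivAt_id t).prodMk ((hasDerivAt_const t x).prodMk ?_)
        refine (hasDerivAt_jetPoly_fst p a e b 0 0 x t).congr_deriv ?_
        simp
      exact (hasFDerivAt_field hzs).comp_hasDerivAt_of_eq t h2 hgψ.symm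
    have h3 : HasDerivAt (fun u => ψ' (T u, s u * x + η u))
        (fderiv ℝ ψ' P (s t ^ 2, deriv s t * x + deriv η t)) t :=
      hψ'd.comp_hasDerivAt_of_eq t (hTd.prodMk ((hsd.mul_const x).add hηd)) rfl
    have ht0 : Tendsto (fun u : ℝ => (u, x)) (𝓝 t) (𝓝 p) := by
      have : ContinuousAt (fun u : ℝ => (u, x)) t := by fun_prop
      exact this
    rw [h1.unique (h3.congr_of_eventuallyEq (ht0.eventually hG))]
    have : ((s t ^ 2, deriv s t * x + deriv η t) : ℝ × ℝ) =
      s t ^ 2 • ((1, 0) : ℝ × ℝ) + (deriv s t * x + deriv η t) • ((0, 1) : ℝ × ℝ) := by simp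
    rw [this, map_add, map_smul, map_smul]
  have hψt : deriv (fun u => ψ' (u, P.2)) P.1 = fderiv ℝ ψ' P (1, 0) :=
    (hψ'd.comp_hasDerivAt_of_eq P.1 ((hasDerivAt_id P.1).prodMk (hasDerivAt_const P.1 P.2))
      rfl).deriv
  -- space direction
  have hψx : deriv (fun y => ψ' (P.1, y)) P.2 = fderiv ℝ ψ' P (0, 1) :=
    (hψ'd.comp_hasDerivAt_of_eq P.2 ((hasDerivAt_const P.2 P.1).prodMk (hasDerivAt_id P.2))
      rfl).deriv
  have hgx : ∀ y, HasDerivAt (fun y => graphPoint ψ (t, y)) ((0, 1, b) : ℝ × ℝ × ℂ) y := by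
    intro y
    refine (hasDerivAt_const y t).prodMk ((hasDerivAt_id y).prodMk ?_)
    refine (hasDerivAt_jetPoly_snd p a e b 0 0 t y).congr_deriv ?_
    simp
  have hx0 : Tendsto (fun y : ℝ => (t, y)) (𝓝 x) (𝓝 p) := by
    have : ContinuousAt (fun y : ℝ => (t, y)) x := by fun_prop
    exact this
  have hGx := hx0.eventually hG
  have hfirst : ∀ᶠ y in 𝓝 x, HasDerivAt (fun y => Φ.field (graphPoint ψ (t, y)))
      (fderiv ℝ Φ.field (graphPoint ψ (t, y)) (0, 1, b)) y := by
    have hcont : ContinuousAt (fun y => graphPoint ψ (t, y)) x := (hgx x).continuousAt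
    have h1 : ∀ᶠ y in 𝓝 x, graphPoint ψ (t, y) ∈ Φ.source := by
      refine hcont.eventually (Φ.open_source.mem_nhds ?_)
      change graphPoint ψ p ∈ Φ.source
      rw [hgψ]; exact hzs
    filter_upwards [h1] with y hy
    exact (hasFDerivAt_field hy).comp_hasDerivAt y (hgx y)
  have hsecond : HasDerivAt (fun y => fderiv ℝ Φ.field (graphPoint ψ (t, y)) (0, 1, b))
      (fderiv ℝ (fderiv ℝ Φ.field) z (0, 1, b) (0, 1, b)) x := by
    have h1 : HasDerivAt (fun y => fderiv ℝ Φ.field (graphPoint ψ (t, y)))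
        (fderiv ℝ (fderiv ℝ Φ.field) z (0, 1, b)) x :=
      (hasFDerivAt_fderiv_field hzs).comp_hasDerivAt_of_eq x (hgx x) hgψ.symm
    have h2 := h1.clm_apply (hasDerivAt_const x ((0, 1, b) : ℝ × ℝ × ℂ))
    simpa using h2
  have hr : HasDerivAt (fun y => s t * y + η t) (s t) x := by
    simpa using ((hasDerivAt_id x).const_mul (s t)).add_const (η t)
  have hrs : ContDiffAt ℝ 2 (fun y : ℝ => s t * y + η t) x := by fun_prop
  have hxx := iteratedDeriv_two_comp (g := fun y => ψ' (P.1, y)) (r := fun y => s t * y + η t)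
    (x := x) (hψ's.slice_snd.of_le two_le_infty) hrs
  have hr2 : iteratedDeriv 2 (fun y => s t * y + η t) x = 0 := by
    refine iteratedDeriv_two_eq (g' := fun _ => s t) (Eventually.of_forall fun y => ?_)
      (hasDerivAt_const x (s t))
    simpa using ((hasDerivAt_id y).const_mul (s t)).add_const (η t)
  rw [hr.deriv, hr2, zero_smul, add_zero] at hxx
  have hxx2 : iteratedDeriv 2 (fun y => ψ' (P.1, s t * y + η t)) x =
      fderiv ℝ (fderiv ℝ Φ.field) z (0, 1, b) (0, 1, b) := by
    have h1 : (fun y => Φ.field (graphPoint ψ (t, y))) =ᶠ[𝓝 x]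
        fun y => ψ' (P.1, s t * y + η t) := hGx
    rw [← h1.iteratedDeriv_eq 2]
    exact iteratedDeriv_two_eq hfirst hsecond
  rw [hxx2] at hxx
  have hx1 : fderiv ℝ Φ.field z (0, 1, b) = s t • fderiv ℝ ψ' P (0, 1) := by
    have h1 : HasDerivAt (fun y => ψ' (P.1, s t * y + η t)) (fderiv ℝ ψ' P (0, s t)) x :=
      hψ'd.comp_hasDerivAt_of_eq x ((hasDerivAt_const x P.1).prodMk hr) rfl
    have h2 := hfirst.self_of_nhds
    rw [show graphPoint ψ (t, x) = z from hgψ] at h2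
    rw [h2.unique (h1.congr_of_eventuallyEq hGx)]
    have : ((0, s t) : ℝ × ℝ) = s t • ((0, 1) : ℝ × ℝ) := by simp
    rw [this, map_smul]
  rw [nlsExpr, hψt, hval] at hn'
  change fderiv ℝ (fderiv ℝ Φ.field) z (0, 1, b) (0, 1, b) =
    s t ^ 2 • iteratedDeriv 2 (fun y => ψ' (P.1, y)) P.2 at hxx
  rw [htime, hx1, hxx]
  have hs0' : (s t : ℂ) ≠ 0 := Complex.ofReal_ne_zero.2 hs0
  simp only [Complex.real_smul] at *
  push_cast
  have hcancel : (((deriv s t : ℝ) : ℂ) * x + ((deriv η t : ℝ) : ℂ)) / s t *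
      (s t * fderiv ℝ ψ' P (0, 1)) =
      (((deriv s t : ℝ) : ℂ) * x + ((deriv η t : ℝ) : ℂ)) * fderiv ℝ ψ' P (0, 1) := by
    field_simp
  rw [hcancel]
  linear_combination ((s t : ℂ) ^ 2) * hn'

end PointTransformation

/-! ### Amplitude, coefficient and potential -/

namespace PointTransformation

variable {Φ : PointTransformation} {γ : ℝ} {σ σ' : ℂ} {V V' : ℝ × ℝ → ℂ}

theorem hasDerivAt_field_time {t x : ℝ} {a : ℂ} (hz : (t, x, a) ∈ Φ.source) :
    HasDerivAt (fun u => Φ.field (u, x, a)) (fderiv ℝ Φ.field (t, x, a) (1, 0, 0)) t :=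
  (hasFDerivAt_field hz).comp_hasDerivAt_of_eq t
    ((hasDerivAt_id t).prodMk ((hasDerivAt_const t x).prodMk (hasDerivAt_const t a))) rfl

theorem hasDerivAt_field_space {t x : ℝ} {a : ℂ} (hz : (t, x, a) ∈ Φ.source) :
    HasDerivAt (fun y => Φ.field (t, y, a)) (fderiv ℝ Φ.field (t, x, a) (0, 1, 0)) x :=
  (hasFDerivAt_field hz).comp_hasDerivAt_of_eq x
    ((hasDerivAt_const x t).prodMk ((hasDerivAt_id x).prodMk (hasDerivAt_const x a))) rfl

theorem hasDerivAt_fderiv_field_space {t x : ℝ} {a : ℂ} (hz : (t, x, a) ∈ Φ.source)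
    (w : ℝ × ℝ × ℂ) : HasDerivAt (fun y => fderiv ℝ Φ.field (t, y, a) w)
      (fderiv ℝ (fderiv ℝ Φ.field) (t, x, a) (0, 1, 0) w) x := by
  have h1 : HasDerivAt (fun y => fderiv ℝ Φ.field (t, y, a))
      (fderiv ℝ (fderiv ℝ Φ.field) (t, x, a) (0, 1, 0)) x :=
    (hasFDerivAt_fderiv_field hz).comp_hasDerivAt x
      ((hasDerivAt_const x t).prodMk ((hasDerivAt_id x).prodMk (hasDerivAt_const x a)))
  simpa using h1.clm_apply (hasDerivAt_const x w)

theorem hasFDerivAt_fieldCurve (t x : ℝ) (c : ℂ) :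
    HasFDerivAt (fun c : ℂ => ((t, x, c) : ℝ × ℝ × ℂ))
      ((ContinuousLinearMap.inr ℝ ℝ (ℝ × ℂ)).comp (ContinuousLinearMap.inr ℝ ℝ ℂ)) c :=
  (hasFDerivAt_const (𝕜 := ℝ) t c).prodMk
    ((hasFDerivAt_const (𝕜 := ℝ) x c).prodMk (hasFDerivAt_id (𝕜 := ℝ) c))

theorem hasFDerivAt_field_field {t x : ℝ} {a : ℂ} (hz : (t, x, a) ∈ Φ.source) :
    HasFDerivAt (fun c => Φ.field (t, x, c)) ((fderiv ℝ Φ.field (t, x, a)).comp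
      ((ContinuousLinearMap.inr ℝ ℝ (ℝ × ℂ)).comp (ContinuousLinearMap.inr ℝ ℝ ℂ))) a :=
  HasFDerivAt.comp (g := Φ.field) (f := fun c : ℂ => ((t, x, c) : ℝ × ℝ × ℂ)) a
    (hasFDerivAt_field hz) (hasFDerivAt_fieldCurve t x a)

theorem hasFDerivAt_fderiv_field_field {t x : ℝ} {a : ℂ} (hz : (t, x, a) ∈ Φ.source)
    (w : ℝ × ℝ × ℂ) (h : ∀ v, fderiv ℝ (fderiv ℝ Φ.field) (t, x, a) (0, 0, v) w = 0) :
    HasFDerivAt (fun c => fderiv ℝ Φ.field (t, x, c) w) (0 : ℂ →L[ℝ] ℂ) a := by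
  have h1 : HasFDerivAt (fun c => fderiv ℝ Φ.field (t, x, c)) _ a :=
    (hasFDerivAt_fderiv_field hz).comp a (hasFDerivAt_fieldCurve t x a)
  refine (h1.clm_apply (hasFDerivAt_const w a)).congr_fderiv ?_
  ext v
  simpa using h v

/-- The transformation of a time-orientation preserving admissible transformation: amplitude and
potential. -/
theorem exists_amplitude (hγ : γ ≠ 0) (hσ : σ ≠ 0) (hσ' : σ' ≠ 0)
    (hE : MapsEquation Φ γ σ V σ' V') {z₀ : ℝ × ℝ × ℂ} {r : ℝ} (hr : 0 < r)
    (hsub : Metric.ball z₀ r ⊆ Φ.source) (ha₀ : z₀.2.2 ≠ 0)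
    (hfield : ∀ z ∈ Metric.ball z₀ r, Φ.field z ≠ 0) {T s η : ℝ → ℝ}
    (hs : ContDiffOn ℝ ∞ s (Metric.ball z₀.1 r)) (hη : ContDiffOn ℝ ∞ η (Metric.ball z₀.1 r))
    (hT : ∀ t ∈ Metric.ball z₀.1 r, s t ≠ 0 ∧ HasDerivAt T (s t ^ 2) t)
    (hbase : ∀ z ∈ Metric.ball z₀ r, basePoint (Φ.toFun z) = (T z.1, s z.1 * z.2.1 + η z.1))
    (hrot : ∀ z ∈ Metric.ball z₀ r, ∀ c, (fderiv ℝ Φ.toFun z (0, 0, Complex.I * c)).2.2 =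
        Complex.I * (fderiv ℝ Φ.toFun z (0, 0, c)).2.2) :
    ∃ A : ℝ × ℝ → ℂ, ∀ t ∈ Metric.ball z₀.1 r, ∀ x ∈ Metric.ball z₀.2.1 r,
      ContDiffAt ℝ ∞ A (t, x) ∧ A (t, x) ≠ 0 ∧
      HasDerivAt (fun y => A (t, y))
        (Complex.I * ((deriv s t * x + deriv η t) / (2 * s t) : ℝ) * A (t, x)) x ∧
      σ = ((s t ^ 2 : ℝ) : ℂ) * σ' * ((‖A (t, x)‖ ^ γ : ℝ) : ℂ) ∧
      Complex.I * deriv (fun u => A (u, x)) t +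
        ((((deriv s t * x + deriv η t) / (2 * s t) : ℝ) : ℂ) ^ 2 +
          Complex.I * ((deriv s t / (2 * s t) : ℝ) : ℂ)) * A (t, x) +
        ((s t ^ 2 : ℝ) : ℂ) * V' (T t, s t * x + η t) * A (t, x) = V (t, x) * A (t, x) := by
  obtain ⟨t₀, x₀, a₀⟩ := z₀
  simp only at hs hη hT ha₀ ⊢
  have hmem : ∀ {t x a}, t ∈ Metric.ball t₀ r → x ∈ Metric.ball x₀ r → a ∈ Metric.ball a₀ r →
      ((t, x, a) : ℝ × ℝ × ℂ) ∈ Metric.ball (t₀, x₀, a₀) r := fun h1 h2 h3 =>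
    mem_ball_triple.2 ⟨h1, h2, h3⟩
  have ha₀m : a₀ ∈ Metric.ball a₀ r := Metric.mem_ball_self hr
  set h : ℝ → ℝ → ℝ := fun t x => (deriv s t * x + deriv η t) / (2 * s t) with hh
  set Ψ₁ := fderiv ℝ Φ.field with hΨ₁
  set Ψ₂ := fderiv ℝ Ψ₁ with hΨ₂
  -- A real-linear map that commutes with multiplication by `i` is multiplication by its value at
  -- `1`.
  have hlin : ∀ z ∈ Metric.ball ((t₀, x₀, a₀) : ℝ × ℝ × ℂ) r, ∀ c,
      Ψ₁ z (0, 0, c) = c * Ψ₁ z (0, 0, 1) := by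
    intro z hz c
    have h1 := hrot z hz 1
    rw [← fderiv_field_apply (hsub hz), ← fderiv_field_apply (hsub hz), mul_one, ← hΨ₁] at h1
    have h2 : ((0, 0, c) : ℝ × ℝ × ℂ) = c.re • ((0, 0, 1) : ℝ × ℝ × ℂ) +
        c.im • ((0, 0, Complex.I) : ℝ × ℝ × ℂ) := by
      simp [Complex.re_add_im]
    rw [h2, map_add, map_smul, map_smul, h1, Complex.real_smul, Complex.real_smul]
    linear_combination Ψ₁ z (0, 0, 1) * Complex.re_add_im c
  have hsymm : ∀ z ∈ Metric.ball ((t₀, x₀, a₀) : ℝ × ℝ × ℂ) r, ∀ v w, Ψ₂ z v w = Ψ₂ z w v :=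
    fun z hz v w => ((contDiffAt_field
      (hsub hz)).isSymmSndFDerivAt (by simpa using two_le_infty)) v w
  -- the coefficients of the relation as a polynomial in the first `x`-derivative
  have hrel : ∀ {t x a}, ((t, x, a) : ℝ × ℝ × ℂ) ∈ Metric.ball (t₀, x₀, a₀) r →
      (∀ b, Ψ₂ (t, x, a) (0, 0, b) (0, 0, b) = 0) ∧
      (∀ b, Ψ₂ (t, x, a) (0, 1, 0) (0, 0, b) = Complex.I * h t x * Ψ₁ (t, x, a) (0, 0, b)) ∧
      Complex.I * (Ψ₁ (t, x, a) (1, 0, 0) + Complex.I * (σ * ((‖a‖ ^ γ : ℝ) : ℂ) * a +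
          V (t, x) * a) * Ψ₁ (t, x, a) (0, 0, 1) - 2 * h t x * Ψ₁ (t, x, a) (0, 1, 0)) +
        Ψ₂ (t, x, a) (0, 1, 0) (0, 1, 0) +
        ((s t ^ 2 : ℝ) : ℂ) * (σ' * ((‖Φ.field (t, x, a)‖ ^ γ : ℝ) : ℂ) * Φ.field (t, x, a) +
        V' (T t, s t * x + η t) * Φ.field (t, x, a)) = 0 := by
    intro t x a hz
    have hst : s t ≠ 0 := (hT t (mem_ball_triple.1 hz).1).1
    have key := field_relation hE hsub hs hη hT hbase hz
    have h2h : (deriv s t * x + deriv η t) / s t = 2 * h t x := by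
      simp only [hh]; field_simp
    have hsplit : ∀ b : ℂ, ((0, 1, b) : ℝ × ℝ × ℂ) = (0, 1, 0) + (0, 0, b) := fun b => by simp
    have hsplit2 : ∀ e : ℂ, ((1, 0, e) : ℝ × ℝ × ℂ) = (1, 0, 0) + (0, 0, e) := fun e => by simp
    have hneg : ∀ b : ℂ, ((0, 0, -b) : ℝ × ℝ × ℂ) = -(0, 0, b) := fun b => by simp
    simp only [h2h, Complex.real_smul] at key
    have k0 := key 0
    rw [← hΨ₁, ← hΨ₂, hsplit2, map_add, hlin _ hz] at k0
    have kp := fun b => key b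
    have km := fun b => key (-b)
    simp only [← hΨ₁, ← hΨ₂] at kp km
    -- The relation is quadratic in `b`. Its part even in `b`, minus the value at `b = 0`, is the
    -- quadratic coefficient, and its odd part is the linear one. In the odd part, the mixed
    -- derivative occurs twice by symmetry of the Hessian.
    have kb : ∀ b, Ψ₂ (t, x, a) (0, 0, b) (0, 0, b) = 0 ∧
        Ψ₂ (t, x, a) (0, 1, 0) (0, 0, b) = Complex.I * h t x * Ψ₁ (t, x, a) (0, 0, b) := by
      intro b
      have k1 := kp b
      have k2 := km b
      rw [hsplit2, hsplit b, map_add, map_add, map_add, map_add, add_apply,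
        add_apply, hsymm _ hz (0, 0, b) (0, 1, 0), hlin _ hz (Complex.I * _)]
        at k1
      rw [hsplit2, hsplit (-b), hneg, map_add, map_add, map_add, map_add, map_neg, map_neg, map_neg,
        add_apply, add_apply, neg_apply, neg_apply,
        hsymm _ hz (0, 0, b) (0, 1, 0), hlin _ hz (Complex.I * _)] at k2
      push_cast at k0 k1 k2
      constructor
      · linear_combination (1 / 2 : ℂ) * k1 + (1 / 2 : ℂ) * k2 - k0
      · linear_combination (1 / 4 : ℂ) * k1 - (1 / 4 : ℂ) * k2
    refine ⟨fun b => (kb b).1, fun b => (kb b).2, ?_⟩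
    push_cast at k0 ⊢
    linear_combination k0
  set A : ℝ × ℝ → ℂ := fun q => Ψ₁ (q.1, q.2, a₀) (0, 0, 1) with hA
  -- the field component is affine in the field variable
  have haff : ∀ {t x a}, t ∈ Metric.ball t₀ r → x ∈ Metric.ball x₀ r → a ∈ Metric.ball a₀ r →
      Ψ₁ (t, x, a) (0, 0, 1) = A (t, x) ∧
      Φ.field (t, x, a) = Φ.field (t, x, a₀) + A (t, x) * (a - a₀) := by
    intro t x a ht hx ha
    have h1 : ∀ c ∈ Metric.ball a₀ r, Ψ₁ (t, x, c) (0, 0, 1) = A (t, x) := by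
      intro c hc
      refine eq_of_hasFDerivAt_eq_zero (convex_ball a₀ r)
        (g := fun c => Ψ₁ (t, x, c) (0, 0, 1)) (fun c hc => ?_) hc ha₀m
      have hz := hmem ht hx hc
      refine hasFDerivAt_fderiv_field_field (hsub hz) _ fun v => ?_
      -- Polarization: the symmetric form vanishes on the diagonal, hence on the pair `(v, 1)`. So
      -- the field derivative is independent of the field variable.
      have e1 := (hrel hz).1 v
      have e2 := (hrel hz).1 1
      have e3 := (hrel hz).1 (v + 1)
      have e4 : ((0, 0, v + 1) : ℝ × ℝ × ℂ) = (0, 0, v) + (0, 0, 1) := by simp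
      rw [e4, map_add, map_add, add_apply, add_apply,
          hsymm _ hz (0, 0, 1) (0, 0, v)] at e3
      linear_combination (1 / 2 : ℂ) * (e3 - e1 - e2)
    refine ⟨h1 a ha, ?_⟩
    have h4 := eq_of_hasFDerivAt_eq_zero (convex_ball a₀ r)
      (g := fun c => Φ.field (t, x, c) - A (t, x) * c) (fun c hc => ?_) ha ha₀m
    · linear_combination h4
    · have hz := hmem ht hx hc
      have h5 := (hasFDerivAt_field_field (hsub hz)).sub
        ((hasFDerivAt_id (𝕜 := ℝ) c).const_mul (A (t, x)))
      refine h5.congr_fderiv ?_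
      ext v
      have h6 := hlin _ hz v
      rw [h1 c hc] at h6
      have h7 : Ψ₁ (t, x, c) (0, 0, v) - A (t, x) * v = 0 := by rw [h6]; ring
      exact h7
  have hAs : ∀ {t x}, t ∈ Metric.ball t₀ r → x ∈ Metric.ball x₀ r → ContDiffAt ℝ ∞ A (t, x) := by
    intro t x ht hx
    have h1 : ContDiffAt ℝ ∞ Ψ₁ (t, x, a₀) :=
      (contDiffAt_field (hsub (hmem ht hx ha₀m))).fderiv_right (by simp)
    have h2 : ContDiffAt ℝ ∞ (fun q : ℝ × ℝ => ((q.1, q.2, a₀) : ℝ × ℝ × ℂ)) (t, x) :=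
      contDiffAt_fst.prodMk (contDiffAt_snd.prodMk contDiffAt_const)
    exact (ContDiffAt.comp (g := Ψ₁) (t, x) h1 h2).clm_apply contDiffAt_const
  have hAx : ∀ {t x}, t ∈ Metric.ball t₀ r → x ∈ Metric.ball x₀ r →
      HasDerivAt (fun y => A (t, y)) (Complex.I * h t x * A (t, x)) x := by
    intro t x ht hx
    have hz := hmem ht hx ha₀m
    exact (hasDerivAt_fderiv_field_space (hsub hz) (0, 0, 1)).congr_deriv ((hrel hz).2.1 1)
  refine ⟨A, fun t ht x hx => ?_⟩
  have hz₁ := hmem ht hx ha₀m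
  have hst : s t ≠ 0 := (hT t ht).1
  have hA0 : A (t, x) ≠ 0 := by
    intro h0
    have hS := firstOrderStructure hE (hsub hz₁)
    have h1 : (fderiv ℝ Φ.toFun (t, x, a₀) (0, 0, 1)).2.2 = 0 := by
      rw [← fderiv_field_apply (hsub hz₁)]; exact h0
    have h2 : fderiv ℝ Φ.toFun (t, x, a₀) (0, 0, 1) = fderiv ℝ Φ.toFun (t, x, a₀) 0 := by
      rw [map_zero]
      exact Prod.ext (hS.time_field 1) (Prod.ext (hS.space_field 1) h1)
    have h3 := fderiv_injective (hsub hz₁) h2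
    exact one_ne_zero (congrArg (fun z => z.2.2) h3)
  have hAt : HasDerivAt (fun u => A (u, x)) (deriv (fun u => A (u, x)) t) t :=
    ((hAs ht hx).slice_fst.differentiableAt (by simp)).hasDerivAt
  have hhx : HasDerivAt (fun y => h t y) (deriv s t / (2 * s t)) x := by
    have := (((hasDerivAt_id x).const_mul (deriv s t)).add_const (deriv η t)).div_const (2 * s t)
    simpa using this
  set κ : ℝ := deriv s t / (2 * s t) with hκ
  set h₀ := h t x with hh₀
  -- This is `A_xx = (i κ - h²) A`, from differentiating `A_x = i h A` with `h_x = κ`.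
  have hAxx : HasDerivAt (fun y => Complex.I * h t y * A (t, y))
      ((Complex.I * κ - (h₀ : ℂ) ^ 2) * A (t, x)) x := by
    have h1 := (hhx.ofReal_comp.const_mul Complex.I).mul (hAx ht hx)
    refine h1.congr_deriv ?_
    linear_combination (h₀ : ℂ) ^ 2 * A (t, x) * Complex.I_mul_I
  have hd1 : ∀ a ∈ Metric.ball a₀ r, Ψ₁ (t, x, a) (1, 0, 0) =
      Ψ₁ (t, x, a₀) (1, 0, 0) + deriv (fun u => A (u, x)) t * (a - a₀) := by
    intro a ha
    have h1 := hasDerivAt_field_time (hsub (hmem ht hx ha))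
    have h2 := (hasDerivAt_field_time (hsub hz₁)).add
      (hAt.mul_const (a - a₀))
    refine h1.unique (h2.congr_of_eventuallyEq ?_)
    filter_upwards [Metric.isOpen_ball.mem_nhds ht] with u hu
    exact (haff hu hx ha).2
  have hd2 : ∀ a ∈ Metric.ball a₀ r, ∀ y ∈ Metric.ball x₀ r, Ψ₁ (t, y, a) (0, 1, 0) =
      Ψ₁ (t, y, a₀) (0, 1, 0) + Complex.I * h t y * A (t, y) * (a - a₀) := by
    intro a ha y hy
    have h1 := hasDerivAt_field_space (hsub (hmem ht hy ha))
    have h2 := (hasDerivAt_field_space (hsub (hmem ht hy ha₀m))).add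
      ((hAx ht hy).mul_const (a - a₀))
    refine h1.unique (h2.congr_of_eventuallyEq ?_)
    filter_upwards [Metric.isOpen_ball.mem_nhds hy] with u hu
    exact (haff ht hu ha).2
  have hd3 : ∀ a ∈ Metric.ball a₀ r, Ψ₂ (t, x, a) (0, 1, 0) (0, 1, 0) =
      Ψ₂ (t, x, a₀) (0, 1, 0) (0, 1, 0) +
        (Complex.I * κ - (h₀ : ℂ) ^ 2) * A (t, x) * (a - a₀) := by
    intro a ha
    have hX : ∀ a ∈ Metric.ball a₀ r, HasDerivAt (fun y => Ψ₁ (t, y, a) (0, 1, 0))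
        (Ψ₂ (t, x, a) (0, 1, 0) (0, 1, 0)) x := fun a ha =>
      hasDerivAt_fderiv_field_space (hsub (hmem ht hx ha)) _
    refine (hX a ha).unique (((hX a₀ ha₀m).add (hAxx.mul_const (a - a₀))).congr_of_eventuallyEq ?_)
    filter_upwards [Metric.isOpen_ball.mem_nhds hx] with y hy
    exact hd2 a ha y hy
  set B : ℂ := Φ.field (t, x, a₀) - A (t, x) * a₀ with hB
  set At := deriv (fun u => A (u, x)) t with hAtdef
  set V₁ := V' (T t, s t * x + η t) with hV₁
  have hfa : ∀ a ∈ Metric.ball a₀ r, Φ.field (t, x, a) = A (t, x) * a + B := fun a ha => by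
    rw [(haff ht hx ha).2, hB]; ring
  -- With `Ψ = A w + B`, the part of the relation free of `b` equates the difference of the two
  -- modular terms with an affine function of `w`. By rigidity its linear coefficient vanishes,
  -- which is the claimed relation between `V` and `V'`.
  have hev : ∀ᶠ w in 𝓝 a₀, A (t, x) * σ * (((‖w‖ ^ γ : ℝ) : ℂ) * w) -
      (((s t ^ 2 : ℝ) : ℂ) * σ') * (((‖A (t, x) * w + B‖ ^ γ : ℝ) : ℂ) * (A (t, x) * w + B)) =
      (Complex.I * At + ((h₀ : ℂ) ^ 2 + Complex.I * κ) * A (t, x) +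
        ((s t ^ 2 : ℝ) : ℂ) * V₁ * A (t, x) - V (t, x) * A (t, x)) * w +
      (Complex.I * (Ψ₁ (t, x, a₀) (1, 0, 0) - At * a₀ - 2 * h₀ * (Ψ₁ (t, x, a₀) (0, 1, 0) -
          Complex.I * h₀ * A (t, x) * a₀)) + Ψ₂ (t, x, a₀) (0, 1, 0) (0, 1, 0) -
          (Complex.I * κ - (h₀ : ℂ) ^ 2) * A (t, x) * a₀ + ((s t ^ 2 : ℝ) : ℂ) * V₁ * B) := by
    filter_upwards [Metric.isOpen_ball.mem_nhds ha₀m] with w hw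
    have h1 := (hrel (hmem ht hx hw)).2.2
    rw [(haff ht hx hw).1, hd1 w hw, hd2 w hw x hx, hd3 w hw, hfa w hw] at h1
    linear_combination (-1 : ℂ) * h1 + ((σ * ((‖w‖ ^ γ : ℝ) : ℂ) * w + V (t, x) * w) * A (t, x) -
      2 * (h₀ : ℂ) ^ 2 * A (t, x) * w + 2 * (h₀ : ℂ) ^ 2 * A (t, x) * a₀ -
      2 * (h₀ : ℂ) ^ 2 * A (t, x) * a₀) * Complex.I_mul_I
  have hg : A (t, x) * a₀ + B ≠ 0 := by
    rw [← hfa a₀ ha₀m]; exact hfield _ hz₁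
  have hk : ((s t ^ 2 : ℝ) : ℂ) * σ' ≠ 0 :=
    mul_ne_zero (Complex.ofReal_ne_zero.2 (pow_ne_zero 2 hst)) hσ'
  obtain ⟨-, hσA, hα⟩ := affine_rigidity hγ ha₀ hA0 hσ hk hg hev
  exact ⟨hAs ht hx, hA0, hAx ht hx, hσA, sub_eq_zero.1 hα⟩

end PointTransformation

/-! ### Necessary form of reducible potentials -/

namespace PointTransformation

variable {Φ : PointTransformation} {γ : ℝ} {σ σ' : ℂ} {V V' : ℝ × ℝ → ℂ}

/-- The local data of a reduction of the equation with the potential `V` near `(t₀, x₀)` to an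
equation with an `x`-free potential. -/
structure ReductionData (γ : ℝ) (σ : ℂ) (V : ℝ × ℝ → ℂ) (σ' : ℂ) (W : ℝ → ℂ) (t₀ x₀ r : ℝ)
    (T s η : ℝ → ℝ) (A : ℝ × ℝ → ℂ) : Prop where
  pos : 0 < r
  coeff_ne : σ' ≠ 0
  smooth_s : ContDiffOn ℝ ∞ s (Metric.ball t₀ r)
  smooth_η : ContDiffOn ℝ ∞ η (Metric.ball t₀ r)
  s_ne : ∀ t ∈ Metric.ball t₀ r, s t ≠ 0
  smooth_A : ∀ t ∈ Metric.ball t₀ r, ∀ x ∈ Metric.ball x₀ r, ContDiffAt ℝ ∞ A (t, x)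
  A_ne : ∀ t ∈ Metric.ball t₀ r, ∀ x ∈ Metric.ball x₀ r, A (t, x) ≠ 0
  deriv_A : ∀ t ∈ Metric.ball t₀ r, ∀ x ∈ Metric.ball x₀ r, HasDerivAt (fun y => A (t, y))
    (Complex.I * ((deriv s t * x + deriv η t) / (2 * s t) : ℝ) * A (t, x)) x
  coeff : ∀ t ∈ Metric.ball t₀ r, ∀ x ∈ Metric.ball x₀ r,
    σ = ((s t ^ 2 : ℝ) : ℂ) * σ' * ((‖A (t, x)‖ ^ γ : ℝ) : ℂ)
  potential : ∀ t ∈ Metric.ball t₀ r, ∀ x ∈ Metric.ball x₀ r,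
    Complex.I * deriv (fun u => A (u, x)) t +
        ((((deriv s t * x + deriv η t) / (2 * s t) : ℝ) : ℂ) ^ 2 +
          Complex.I * ((deriv s t / (2 * s t) : ℝ) : ℂ)) * A (t, x) +
        ((s t ^ 2 : ℝ) : ℂ) * W (T t) * A (t, x) = V (t, x) * A (t, x)

theorem exists_reductionData_of_pos (hγ : γ ≠ 0) (hσ : σ ≠ 0) (hσ' : σ' ≠ 0) {W : ℝ → ℂ}
    (hE : MapsEquation Φ γ σ V σ' fun q => W q.1) {z₀ : ℝ × ℝ × ℂ} (hz₀ : z₀ ∈ Φ.source)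
    (ha₀ : z₀.2.2 ≠ 0) (hfield : ∀ z ∈ Φ.target, z.2.2 ≠ 0)
    (hpos : 0 < (fderiv ℝ Φ.toFun z₀ (1, 0, 0)).1) :
    ∃ r T s η A, ReductionData γ σ V σ' W z₀.1 z₀.2.1 r T s η A := by
  obtain ⟨r, hr, hsub, T, s, η, hs, hη, hT, hbase, hrot⟩ := exists_base_normalForm hE hz₀ hpos
  obtain ⟨A, hA⟩ := exists_amplitude hγ hσ hσ' hE hr hsub ha₀
    (fun z hz => hfield _ (Φ.map_source' (hsub hz))) hs hη hT hbase hrot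
  exact ⟨r, T, s, η, A, hr, hσ', hs, hη, fun t ht => (hT t ht).1,
    fun t ht x hx => (hA t ht x hx).1, fun t ht x hx => (hA t ht x hx).2.1,
    fun t ht x hx => (hA t ht x hx).2.2.1, fun t ht x hx => (hA t ht x hx).2.2.2.1,
    fun t ht x hx => (hA t ht x hx).2.2.2.2⟩

/-- If the transformation reverses time, it is followed by the reflection. The target potential is
then replaced by its reflected conjugate, so of the target potential only its vanishing is recorded.
-/
theorem exists_reductionData (hγ : γ ≠ 0) (hσ : σ ≠ 0) {Ω Ω' : Set (ℝ × ℝ)} {W : ℝ → ℂ}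
    {z₀ : ℝ × ℝ × ℂ} (h : PotentialEquivNear γ σ Ω V Ω' (fun q => W q.1) z₀) :
    ∃ σ' W' r T s η A, (W = 0 → W' = 0) ∧
      ReductionData γ σ V σ' W' z₀.1 z₀.2.1 r T s η A := by
  obtain ⟨Φ, σ', hσ', hz₀, hsrc, htgt, hE⟩ := h
  have ha₀ : z₀.2.2 ≠ 0 := (hsrc hz₀).2
  have hS := firstOrderStructure hE hz₀
  rcases lt_or_gt_of_ne hS.time_ne with hneg | hpos
  · have hE' := MapsEquation_reflect hE
    have hfd : fderiv ℝ (reflect Φ).toFun z₀ (1, 0, 0) =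
        reflection (fderiv ℝ Φ.toFun z₀ (1, 0, 0)) := by
      have h1 : HasFDerivAt (reflect Φ).toFun _ z₀ :=
        (reflection : (ℝ × ℝ × ℂ) →L[ℝ] ℝ × ℝ × ℂ).hasFDerivAt.comp z₀ (hasFDerivAt hz₀)
      rw [h1.fderiv]; rfl
    obtain ⟨r, T, s, η, A, hR⟩ := exists_reductionData_of_pos (Φ := reflect Φ)
      (W := fun t => conj (W (-t))) hγ hσ ((map_ne_zero _).2 hσ') hE' hz₀ ha₀ (fun z hz => by
        have h1 := (htgt (mem_reflect_target.1 hz)).2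
        rw [reflection_apply] at h1
        exact fun h0 => h1 (by simp [h0]))
      (by rw [hfd, reflection_apply]; exact neg_pos.2 hneg)
    refine ⟨_, _, r, T, s, η, A, fun hW => ?_, hR⟩
    funext t
    simp [hW]
  · obtain ⟨r, T, s, η, A, hR⟩ := exists_reductionData_of_pos hγ hσ hσ' hE hz₀ ha₀
      (fun z hz => (htgt hz).2) hpos
    exact ⟨σ', W, r, T, s, η, A, fun h => h, hR⟩

namespace ReductionData

variable {W : ℝ → ℂ} {t₀ x₀ r : ℝ} {T s η : ℝ → ℝ} {A : ℝ × ℝ → ℂ}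

/-- The potential of a reducible equation is quadratic in `x`. -/
theorem exists_quadratic (h : ReductionData γ σ V σ' W t₀ x₀ r T s η A) :
    ∃ (k m : ℝ → ℝ) (C : ℝ → ℂ), (∀ t, k t = deriv s t / (2 * s t)) ∧
      ContDiffOn ℝ ∞ k (Metric.ball t₀ r) ∧ ContDiffOn ℝ ∞ m (Metric.ball t₀ r) ∧
      (∀ t ∈ Metric.ball t₀ r, C t ≠ 0 ∧ DifferentiableAt ℝ C t ∧ ‖C t‖ = ‖A (t, x₀)‖) ∧
      ∀ t ∈ Metric.ball t₀ r, ∀ x ∈ Metric.ball x₀ r,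
        V (t, x) = (((k t ^ 2 - deriv k t / 2) * x ^ 2 + (2 * k t * m t - deriv m t) * x : ℝ) : ℂ)
          + (((m t ^ 2 : ℝ) : ℂ) + Complex.I * k t + Complex.I * (deriv C t / C t) +
            ((s t ^ 2 : ℝ) : ℂ) * W (T t)) := by
  have hx₀ : x₀ ∈ Metric.ball x₀ r := Metric.mem_ball_self h.pos
  set k : ℝ → ℝ := fun t => deriv s t / (2 * s t) with hk
  set m : ℝ → ℝ := fun t => deriv η t / (2 * s t) with hm
  have hds : ContDiffOn ℝ ∞ (deriv s) (Metric.ball t₀ r) :=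
    ((contDiffOn_infty_iff_deriv_of_isOpen Metric.isOpen_ball).1 h.smooth_s).2
  have hdη : ContDiffOn ℝ ∞ (deriv η) (Metric.ball t₀ r) :=
    ((contDiffOn_infty_iff_deriv_of_isOpen Metric.isOpen_ball).1 h.smooth_η).2
  have h2s : ContDiffOn ℝ ∞ (fun t => 2 * s t) (Metric.ball t₀ r) :=
    contDiffOn_const.mul h.smooth_s
  have h2s0 : ∀ t ∈ Metric.ball t₀ r, 2 * s t ≠ 0 := fun t ht =>
    mul_ne_zero two_ne_zero (h.s_ne t ht)
  have hks : ContDiffOn ℝ ∞ k (Metric.ball t₀ r) := hds.div h2s h2s0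
  have hms : ContDiffOn ℝ ∞ m (Metric.ball t₀ r) := hdη.div h2s h2s0
  -- `E` is the unimodular solution of `A_x = i (k x + m) A` with value `1` at `x = 0`. The quotient
  -- `C = A / E` is then independent of `x` on the ball and has the modulus of `A`.
  set E : ℝ → ℝ → ℂ := fun t x => Complex.exp (Complex.I * ((k t * x ^ 2 / 2 + m t * x : ℝ) : ℂ))
    with hE
  have hE0 : ∀ t x, E t x ≠ 0 := fun t x => Complex.exp_ne_zero _
  have hEn : ∀ t x, ‖E t x‖ = 1 := fun t x => by
    simp only [hE]; rw [mul_comm]; exact Complex.norm_exp_ofReal_mul_I _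
  have hkd : ∀ t ∈ Metric.ball t₀ r, HasDerivAt k (deriv k t) t := fun t ht =>
    ((hks.contDiffAt (Metric.isOpen_ball.mem_nhds ht)).differentiableAt (by simp)).hasDerivAt
  have hmd : ∀ t ∈ Metric.ball t₀ r, HasDerivAt m (deriv m t) t := fun t ht =>
    ((hms.contDiffAt (Metric.isOpen_ball.mem_nhds ht)).differentiableAt (by simp)).hasDerivAt
  have hEx : ∀ t x, HasDerivAt (fun y => E t y)
      (Complex.I * ((k t * x + m t : ℝ) : ℂ) * E t x) x := by
    intro t x
    have h1 : HasDerivAt (fun y : ℝ => k t * y ^ 2 / 2 + m t * y) (k t * x + m t) x := by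
      have := ((((hasDerivAt_id x).pow 2).const_mul (k t)).div_const 2).add
        ((hasDerivAt_id x).const_mul (m t))
      refine this.congr_deriv ?_
      simp
      ring
    have := (h1.ofReal_comp.const_mul Complex.I).cexp
    refine this.congr_deriv ?_
    simp only [hE]; ring
  have hEt : ∀ t ∈ Metric.ball t₀ r, ∀ x, HasDerivAt (fun u => E u x)
      (Complex.I * ((deriv k t * x ^ 2 / 2 + deriv m t * x : ℝ) : ℂ) * E t x) t := by
    intro t ht x
    have h1 : HasDerivAt (fun u : ℝ => k u * x ^ 2 / 2 + m u * x)
        (deriv k t * x ^ 2 / 2 + deriv m t * x) t :=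
      (((hkd t ht).mul_const (x ^ 2)).div_const 2).add ((hmd t ht).mul_const x)
    have := (h1.ofReal_comp.const_mul Complex.I).cexp
    refine this.congr_deriv ?_
    simp only [hE]; ring
  set C : ℝ → ℂ := fun t => A (t, x₀) / E t x₀ with hC
  have hslope : ∀ t ∈ Metric.ball t₀ r, ∀ x, (deriv s t * x + deriv η t) / (2 * s t) =
      k t * x + m t := fun t ht x => by simp only [hk, hm]; ring
  have hAC : ∀ t ∈ Metric.ball t₀ r, ∀ x ∈ Metric.ball x₀ r, A (t, x) = C t * E t x := by
    intro t ht x hx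
    have hd : ∀ y ∈ Metric.ball x₀ r, HasDerivAt (fun y => A (t, y) / E t y) 0 y := by
      intro y hy
      refine ((h.deriv_A t ht y hy).div (hEx t y) (hE0 t y)).congr_deriv ?_
      rw [hslope t ht]
      ring
    have h1 := Metric.isOpen_ball.is_const_of_deriv_eq_zero
      (f := fun y => A (t, y) / E t y) (convex_ball x₀ r).isPreconnected
      (fun y hy => (hd y hy).differentiableAt.differentiableWithinAt)
      (fun y hy => (hd y hy).deriv) hx hx₀
    rw [← div_eq_iff (hE0 t x)]
    exact h1
  have hCd : ∀ t ∈ Metric.ball t₀ r, DifferentiableAt ℝ C t := fun t ht =>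
    DifferentiableAt.div ((h.smooth_A t ht x₀ hx₀).slice_fst.differentiableAt (by simp))
      (hEt t ht x₀).differentiableAt (hE0 t x₀)
  have hC0 : ∀ t ∈ Metric.ball t₀ r, C t ≠ 0 := fun t ht =>
    div_ne_zero (h.A_ne t ht x₀ hx₀) (hE0 t x₀)
  refine ⟨k, m, C, fun t => rfl, hks, hms, fun t ht => ⟨hC0 t ht, hCd t ht, ?_⟩,
    fun t ht x hx => ?_⟩
  · simp only [hC]; rw [norm_div, hEn, div_one]
  · have hAt : deriv (fun u => A (u, x)) t = deriv C t * E t x +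
        C t * (Complex.I * ((deriv k t * x ^ 2 / 2 + deriv m t * x : ℝ) : ℂ) * E t x) := by
      have h1 : HasDerivAt (fun u => C u * E u x) _ t := (hCd t ht).hasDerivAt.mul (hEt t ht x)
      refine (h1.congr_of_eventuallyEq ?_).deriv
      filter_upwards [Metric.isOpen_ball.mem_nhds ht] with u hu
      exact hAC u hu x hx
    have h1 := h.potential t ht x hx
    rw [hAt, hslope t ht, hAC t ht x hx, show deriv s t / (2 * s t) = k t from rfl] at h1
    have hne : C t * E t x ≠ 0 := mul_ne_zero (hC0 t ht) (hE0 t x)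
    apply mul_right_cancel₀ hne
    rw [← h1]
    have h2 : deriv C t / C t * C t = deriv C t := div_mul_cancel₀ _ (hC0 t ht)
    push_cast
    linear_combination -(Complex.I * E t x) * h2 + C t * E t x *
      ((deriv k t : ℝ) * x ^ 2 / 2 + (deriv m t : ℝ) * x : ℂ) * Complex.I_mul_I

/-- The logarithmic derivative of the amplitude. -/
theorem re_logDeriv (h : ReductionData γ σ V σ' W t₀ x₀ r T s η A) {C : ℝ → ℂ}
    (hC : ∀ t ∈ Metric.ball t₀ r, C t ≠ 0 ∧ DifferentiableAt ℝ C t ∧ ‖C t‖ = ‖A (t, x₀)‖)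
    {t : ℝ} (ht : t ∈ Metric.ball t₀ r) :
    γ * (deriv C t / C t).re = -4 * (deriv s t / (2 * s t)) := by
  have hx₀ : x₀ ∈ Metric.ball x₀ r := Metric.mem_ball_self h.pos
  -- The coefficient relation says that `s² |C|^γ` is constant. Its logarithm, written with squares
  -- to keep every term differentiable, has zero derivative.
  have hconst : ∀ u ∈ Metric.ball t₀ r, γ / 2 * Real.log (‖C u‖ ^ 2) + Real.log (s u ^ 2) =
      Real.log (‖σ‖ / ‖σ'‖) := by
    intro u hu
    have h1 := congrArg norm (h.coeff u hu x₀ hx₀)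
    obtain ⟨hC0, -, hCn⟩ := hC u hu
    have hCpos : 0 < ‖C u‖ := norm_pos_iff.2 hC0
    have hσ'0 : 0 < ‖σ'‖ := norm_pos_iff.2 h.coeff_ne
    have hs2 : 0 < s u ^ 2 := by have := h.s_ne u hu; positivity
    rw [norm_mul, norm_mul, Complex.norm_real, Complex.norm_real, ← hCn,
      Real.norm_of_nonneg hs2.le, Real.norm_of_nonneg (by positivity)] at h1
    have h2 : ‖σ‖ / ‖σ'‖ = s u ^ 2 * ‖C u‖ ^ γ := by
      rw [h1]; field_simp
    rw [h2, Real.log_mul hs2.ne' (by positivity), Real.log_rpow hCpos, Real.log_pow]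
    push_cast; ring
  obtain ⟨hC0, hCd, -⟩ := hC t ht
  have hs0 := h.s_ne t ht
  have hsd : HasDerivAt s (deriv s t) t :=
    ((h.smooth_s.contDiffAt (Metric.isOpen_ball.mem_nhds ht)).differentiableAt
      (by simp)).hasDerivAt
  have hCpos : 0 < ‖C t‖ := norm_pos_iff.2 hC0
  have h1 := ((hCd.hasDerivAt.norm_sq.log (by positivity)).const_mul (γ / 2)).add
    ((hsd.pow 2).log (pow_ne_zero 2 hs0))
  have h2 : HasDerivAt (fun u => γ / 2 * Real.log (‖C u‖ ^ 2) + Real.log (s u ^ 2)) 0 t := by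
    refine (hasDerivAt_const t (Real.log (‖σ‖ / ‖σ'‖))).congr_of_eventuallyEq ?_
    filter_upwards [Metric.isOpen_ball.mem_nhds ht] with u hu
    exact hconst u hu
  have h3 := h1.unique h2
  have h4 : (deriv C t / C t).re = inner ℝ (C t) (deriv C t) / ‖C t‖ ^ 2 := by
    rw [Complex.inner, Complex.div_re, ← Complex.normSq_eq_norm_sq]
    simp
    ring
  rw [h4]
  simp only [Pi.pow_apply, Nat.cast_ofNat, Nat.add_one_sub_one, pow_one] at h3
  have h5 : 2 * s t * deriv s t / s t ^ 2 = 4 * (deriv s t / (2 * s t)) := by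
    field_simp; ring
  rw [h5] at h3
  linear_combination h3

end ReductionData

/-- A potential that can locally be made `x`-free is quadratic with real leading coefficients. -/
theorem exists_quadratic_of_potentialEquivNear (hγ : γ ≠ 0) (hσ : σ ≠ 0) {Ω Ω' : Set (ℝ × ℝ)}
    {W : ℝ → ℂ} {z₀ : ℝ × ℝ × ℂ} (h : PotentialEquivNear γ σ Ω V Ω' (fun q => W q.1) z₀) :
    ∃ r > 0, ∃ (v u : ℝ → ℝ) (f : ℝ → ℂ), ContDiffOn ℝ ∞ v (Metric.ball z₀.1 r) ∧
      ContDiffOn ℝ ∞ u (Metric.ball z₀.1 r) ∧ ∀ t ∈ Metric.ball z₀.1 r,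
        ∀ x ∈ Metric.ball z₀.2.1 r, V (t, x) = ((v t * x ^ 2 + u t * x : ℝ) : ℂ) + f t := by
  obtain ⟨σ', W', r, T, s, η, A, -, hR⟩ := exists_reductionData hγ hσ h
  obtain ⟨k, m, C, -, hk, hm, -, hV⟩ := hR.exists_quadratic
  have hdk := ((contDiffOn_infty_iff_deriv_of_isOpen Metric.isOpen_ball).1 hk).2
  have hdm := ((contDiffOn_infty_iff_deriv_of_isOpen Metric.isOpen_ball).1 hm).2
  exact ⟨r, hR.pos, _, _, _, (hk.pow 2).sub (hdk.div_const 2),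
    ((contDiffOn_const.mul hk).mul hm).sub hdm, hV⟩

/-- The necessary condition for a quadratic potential to be locally equivalent to zero. -/
theorem condition_of_equiv_zero (hγ : γ ≠ 0) (hσ : σ ≠ 0) {Ω Ω' : Set (ℝ × ℝ)}
    {v u w₁ w : ℝ → ℝ} {z₀ : ℝ × ℝ × ℂ}
    (h : PotentialEquivNear γ σ Ω (quadraticPotential v u w₁ w) Ω' (fun _ => 0) z₀) :
    16 * gammaPrime γ ^ 2 * v z₀.1 = 2 * gammaPrime γ * deriv w z₀.1 + w z₀.1 ^ 2 := by
  obtain ⟨σ', W', r, T, s, η, A, hW, hR⟩ := exists_reductionData (W := 0) hγ hσ h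
  obtain rfl := hW rfl
  obtain ⟨k, m, C, hks, hk, hm, hC, hV⟩ := hR.exists_quadratic
  have ht₀ : z₀.1 ∈ Metric.ball z₀.1 r := Metric.mem_ball_self hR.pos
  have hx₀ : z₀.2.1 ∈ Metric.ball z₀.2.1 r := Metric.mem_ball_self hR.pos
  -- The imaginary part of the potential is `k + Re (C' / C) = k - 4 k / γ`, that is, `-4 γ' k`.
  have hw : ∀ t ∈ Metric.ball z₀.1 r, w t = -4 * gammaPrime γ * k t := by
    intro t ht
    have h1 := congrArg Complex.im (hV t ht _ hx₀)
    have h2 := hR.re_logDeriv hC ht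
    rw [← hks] at h2
    simp only [quadraticPotential, Complex.add_im, Complex.ofReal_im, Complex.mul_im,
      Complex.I_re, Complex.I_im, Complex.ofReal_re, Pi.zero_apply, mul_zero, zero_mul, zero_add,
      one_mul, add_zero] at h1
    rw [h1, gammaPrime]
    field_simp
    linear_combination h2
  have hdw : deriv w z₀.1 = -4 * gammaPrime γ * deriv k z₀.1 := by
    have hkd : HasDerivAt k (deriv k z₀.1) z₀.1 :=
      ((hk.contDiffAt (Metric.isOpen_ball.mem_nhds ht₀)).differentiableAt (by simp)).hasDerivAt
    refine ((hkd.const_mul (-4 * gammaPrime γ)).congr_of_eventuallyEq ?_).deriv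
    filter_upwards [Metric.isOpen_ball.mem_nhds ht₀] with t ht
    exact hw t ht
  -- The real parts are two quadratic polynomials in `x` that agree on a ball. A second difference
  -- with step `r / 2` isolates the leading coefficients.
  have hv : v z₀.1 = k z₀.1 ^ 2 - deriv k z₀.1 / 2 := by
    have h1 : ∀ x ∈ Metric.ball z₀.2.1 r, v z₀.1 * x ^ 2 + u z₀.1 * x + w₁ z₀.1 =
        (k z₀.1 ^ 2 - deriv k z₀.1 / 2) * x ^ 2 +
          (2 * k z₀.1 * m z₀.1 - deriv m z₀.1) * x +
          (m z₀.1 ^ 2 - (deriv C z₀.1 / C z₀.1).im) := by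
      intro x hx
      have h1 := congrArg Complex.re (hV _ ht₀ x hx)
      simp only [quadraticPotential, Complex.add_re, Complex.ofReal_re, Complex.mul_re,
        Complex.I_re, Complex.I_im, Complex.ofReal_im, Pi.zero_apply, mul_zero, zero_mul,
        one_mul, add_zero, sub_zero, zero_sub] at h1
      rw [h1]; ring
    have hr := hR.pos
    have e0 := h1 _ hx₀
    have e1 := h1 (z₀.2.1 + r / 2) (by
      rw [Metric.mem_ball, Real.dist_eq, add_sub_cancel_left, abs_of_pos (by positivity)]; linarith)
    have e2 := h1 (z₀.2.1 - r / 2) (by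
      rw [Metric.mem_ball, Real.dist_eq, sub_sub_cancel_left, abs_neg, abs_of_pos (by positivity)]
      linarith)
    have e3 : (r ^ 2 / 2) * (v z₀.1 - (k z₀.1 ^ 2 - deriv k z₀.1 / 2)) = 0 := by
      linear_combination e1 + e2 - 2 * e0
    exact sub_eq_zero.1 ((mul_eq_zero.1 e3).resolve_left (by positivity))
  rw [hdw, hw _ ht₀, hv]
  ring

end PointTransformation

/-! ### Construction of transformations from an amplitude -/

namespace PointTransformation

variable {Φ : PointTransformation} {γ : ℝ} {σ σ' : ℂ} {V V' : ℝ × ℝ → ℂ}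

/-- Transformations linear in the field variable, with the amplitude and the potentials related as
in `exists_amplitude`, map the one equation to the other. -/
theorem mapsEquation_of_amplitude {T s s₁ η η₁ : ℝ → ℝ} {A A₁ : ℝ × ℝ → ℂ}
    (hform : ∀ z ∈ Φ.source,
      Φ.toFun z = (T z.1, s z.1 * z.2.1 + η z.1, A (z.1, z.2.1) * z.2.2))
    (hs0 : ∀ z ∈ Φ.source, s z.1 ≠ 0) (hT : ∀ z ∈ Φ.source, HasDerivAt T (s z.1 ^ 2) z.1)
    (hs : ∀ z ∈ Φ.source, HasDerivAt s (s₁ z.1) z.1)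
    (hη : ∀ z ∈ Φ.source, HasDerivAt η (η₁ z.1) z.1)
    (hA0 : ∀ z ∈ Φ.source, A (z.1, z.2.1) ≠ 0)
    (hAx : ∀ z ∈ Φ.source, ∀ y, HasDerivAt (fun y => A (z.1, y))
      (Complex.I * ((s₁ z.1 * y + η₁ z.1) / (2 * s z.1) : ℝ) * A (z.1, y)) y)
    (hAt : ∀ z ∈ Φ.source, HasDerivAt (fun u => A (u, z.2.1)) (A₁ (z.1, z.2.1)) z.1)
    (hσ : ∀ z ∈ Φ.source,
      σ = ((s z.1 ^ 2 : ℝ) : ℂ) * σ' * ((‖A (z.1, z.2.1)‖ ^ γ : ℝ) : ℂ))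
    (hV : ∀ z ∈ Φ.source, Complex.I * A₁ (z.1, z.2.1) +
        ((((s₁ z.1 * z.2.1 + η₁ z.1) / (2 * s z.1) : ℝ) : ℂ) ^ 2 +
          Complex.I * ((s₁ z.1 / (2 * s z.1) : ℝ) : ℂ)) * A (z.1, z.2.1) +
        ((s z.1 ^ 2 : ℝ) : ℂ) * V' (T z.1, s z.1 * z.2.1 + η z.1) * A (z.1, z.2.1) =
        V (z.1, z.2.1) * A (z.1, z.2.1)) :
    MapsEquation Φ γ σ V σ' V' := by
  intro ψ ψ' p hc
  have hval := hc.apply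
  obtain ⟨hz, hψs, hψ's, heq⟩ := hc
  obtain ⟨t, x⟩ := p
  have hz' := hz
  simp only [graphPoint] at hz'
  have hs0 := hs0 _ hz'
  have hT := hT _ hz'
  have hs := hs _ hz'
  have hη := hη _ hz'
  have hA0 := hA0 _ hz'
  have hAx := hAx _ hz'
  have hAt := hAt _ hz'
  have hσ := hσ _ hz'
  have hV := hV _ hz'
  simp only at hs0 hT hs hη hA0 hAx hAt hσ hV
  rw [baseMap] at hval
  have hb : basePoint (Φ.toFun (graphPoint ψ (t, x))) = (T t, s t * x + η t) := by
    rw [hform _ hz]; rfl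
  have hf : (Φ.toFun (graphPoint ψ (t, x))).2.2 = A (t, x) * ψ (t, x) := by
    rw [hform _ hz]; rfl
  rw [hb] at hval hψ's ⊢
  have hval : ψ' (T t, s t * x + η t) = A (t, x) * ψ (t, x) := by rw [hval]; exact hf
  set P : ℝ × ℝ := (T t, s t * x + η t) with hP
  have hG : ∀ᶠ q in 𝓝 (t, x), A q * ψ q = ψ' (T q.1, s q.1 * q.2 + η q.1) := by
    have hcont : ContinuousAt (graphPoint ψ) (t, x) := (contDiffAt_graphPoint hψs).continuousAt
    filter_upwards [heq, hcont.eventually (Φ.open_source.mem_nhds hz)] with q hq h2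
    rw [hform _ h2] at hq
    exact hq
  have hψ'd : HasFDerivAt ψ' (fderiv ℝ ψ' P) P := (hψ's.differentiableAt (by simp)).hasFDerivAt
  have hψt : deriv (fun u => ψ' (u, P.2)) P.1 = fderiv ℝ ψ' P (1, 0) :=
    (hψ'd.comp_hasDerivAt_of_eq P.1 ((hasDerivAt_id P.1).prodMk (hasDerivAt_const P.1 P.2))
      rfl).deriv
  have htime : A₁ (t, x) * ψ (t, x) + A (t, x) * deriv (fun u => ψ (u, x)) t =
      s t ^ 2 • fderiv ℝ ψ' P (1, 0) + (s₁ t * x + η₁ t) • fderiv ℝ ψ' P (0, 1) := by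
    have h1 := hAt.mul (hψs.slice_fst.differentiableAt (by simp)).hasDerivAt
    have h3 : HasDerivAt (fun u => ψ' (T u, s u * x + η u))
        (fderiv ℝ ψ' P (s t ^ 2, s₁ t * x + η₁ t)) t :=
      hψ'd.comp_hasDerivAt_of_eq t (hT.prodMk ((hs.mul_const x).add hη)) rfl
    have ht0 : Tendsto (fun u : ℝ => (u, x)) (𝓝 t) (𝓝 (t, x)) := by
      have : ContinuousAt (fun u : ℝ => (u, x)) t := by fun_prop
      exact this
    have h4 := h1.unique (h3.congr_of_eventuallyEq (ht0.eventually hG))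
    have : ((s t ^ 2, s₁ t * x + η₁ t) : ℝ × ℝ) =
      s t ^ 2 • ((1, 0) : ℝ × ℝ) + (s₁ t * x + η₁ t) • ((0, 1) : ℝ × ℝ) := by simp
    rw [this, map_add, map_smul, map_smul] at h4
    exact h4
  have hx0 : Tendsto (fun y : ℝ => (t, y)) (𝓝 x) (𝓝 (t, x)) := by
    have : ContinuousAt (fun y : ℝ => (t, y)) x := by fun_prop
    exact this
  have hGx : (fun y => A (t, y) * ψ (t, y)) =ᶠ[𝓝 x] fun y => ψ' (P.1, s t * y + η t) :=
    hx0.eventually hG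
  set h : ℝ → ℝ := fun y => (s₁ t * y + η₁ t) / (2 * s t) with hh
  set κ : ℝ := s₁ t / (2 * s t) with hκ
  have hhx : HasDerivAt h κ x := by
    have := (((hasDerivAt_id x).const_mul (s₁ t)).add_const (η₁ t)).div_const (2 * s t)
    simpa using this
  obtain ⟨hψ1, hψ2⟩ := (hψs.slice_snd.of_le two_le_infty).eventually_hasDerivAt le_rfl
  simp only at hψ1 hψ2
  replace hψ2 := hψ2.differentiableAt.hasDerivAt
  set ψx := deriv fun y => ψ (t, y) with hψx
  have hxx1 : iteratedDeriv 2 (fun y => A (t, y) * ψ (t, y)) x =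
      (Complex.I * κ - (h x : ℂ) ^ 2) * A (t, x) * ψ (t, x) +
        2 * (Complex.I * h x * A (t, x)) * ψx x + A (t, x) * deriv ψx x := by
    refine iteratedDeriv_two_eq
      (g' := fun y => Complex.I * h y * A (t, y) * ψ (t, y) + A (t, y) * ψx y) ?_ ?_
    · filter_upwards [hψ1] with y hy
      exact (hAx y).mul hy
    · have h1 := (((hhx.ofReal_comp.const_mul Complex.I).mul (hAx x)).mul hψ1.self_of_nhds).add
        ((hAx x).mul hψ2)
      refine h1.congr_deriv ?_
      simp only [Pi.mul_apply]
      linear_combination (h x : ℂ) ^ 2 * A (t, x) * ψ (t, x) * Complex.I_mul_I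
  have hr : HasDerivAt (fun y => s t * y + η t) (s t) x := by
    simpa using ((hasDerivAt_id x).const_mul (s t)).add_const (η t)
  have hrs : ContDiffAt ℝ 2 (fun y : ℝ => s t * y + η t) x := by fun_prop
  have hxx := iteratedDeriv_two_comp (g := fun y => ψ' (P.1, y)) (r := fun y => s t * y + η t)
    (x := x) (hψ's.slice_snd.of_le two_le_infty) hrs
  have hr2 : iteratedDeriv 2 (fun y => s t * y + η t) x = 0 := by
    refine iteratedDeriv_two_eq (g' := fun _ => s t) (Eventually.of_forall fun y => ?_)
      (hasDerivAt_const x (s t))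
    simpa using ((hasDerivAt_id y).const_mul (s t)).add_const (η t)
  rw [hr.deriv, hr2, zero_smul, add_zero, ← hGx.iteratedDeriv_eq 2, hxx1] at hxx
  have hx1 : Complex.I * h x * A (t, x) * ψ (t, x) + A (t, x) * ψx x =
      s t • fderiv ℝ ψ' P (0, 1) := by
    have h1 : HasDerivAt (fun y => ψ' (P.1, s t * y + η t)) (fderiv ℝ ψ' P (0, s t)) x :=
      hψ'd.comp_hasDerivAt_of_eq x ((hasDerivAt_const x P.1).prodMk hr) rfl
    have h2 := ((hAx x).mul hψ1.self_of_nhds).unique (h1.congr_of_eventuallyEq hGx)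
    have : ((0, s t) : ℝ × ℝ) = s t • ((0, 1) : ℝ × ℝ) := by simp
    rw [this, map_smul] at h2
    exact h2
  have hψxx : iteratedDeriv 2 (fun y => ψ (t, y)) x = deriv ψx x :=
    iteratedDeriv_two_eq hψ1 hψ2
  have h2h : s₁ t * x + η₁ t = 2 * h x * s t := by
    simp only [hh]; field_simp
  have hh₁ : (s₁ t * x + η₁ t) / (2 * s t) = h x := rfl
  rw [hh₁] at hV
  rw [h2h] at htime
  -- The two left-hand sides are proportional with the nonzero factors `A` and `s²`. This holds for
  -- every jet, not only for solutions, so both directions of the equivalence follow.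
  have key : A (t, x) * nlsExpr γ σ V ψ (t, x) =
      ((s t ^ 2 : ℝ) : ℂ) * nlsExpr γ σ' V' ψ' P := by
    rw [nlsExpr, nlsExpr, hψt, hval]
    simp only [hψxx, norm_mul]
    rw [Real.mul_rpow (norm_nonneg _) (norm_nonneg _), hσ]
    change _ = ((s t ^ 2 : ℝ) : ℂ) * (Complex.I * fderiv ℝ ψ' P (1, 0) +
      iteratedDeriv 2 (fun y => ψ' (P.1, y)) (s t * x + η t) + _ + V' P * _)
    simp only [Complex.real_smul] at htime hx1 hxx
    push_cast at htime hx1 hxx hV ⊢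
    linear_combination Complex.I * htime + hxx - 2 * Complex.I * h x * hx1 - ψ (t, x) * hV
      + 2 * (h x : ℂ) ^ 2 * A (t, x) * ψ (t, x) * Complex.I_mul_I
  have hs2 : ((s t ^ 2 : ℝ) : ℂ) ≠ 0 := Complex.ofReal_ne_zero.2 (pow_ne_zero 2 hs0)
  constructor
  · intro h0
    rw [h0, mul_zero] at key
    exact (mul_eq_zero.1 key.symm).resolve_left hs2
  · intro h0
    rw [h0, mul_zero] at key
    exact (mul_eq_zero.1 key).resolve_left hA0

/-- A point transformation with a base part affine in `x` and a field part linear in the field. -/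
theorem exists_of_amplitude {e : OpenPartialHomeomorph ℝ ℝ} (he : ContDiffOn ℝ ∞ e e.source)
    (he' : ContDiffOn ℝ ∞ e.symm e.target) {s η : ℝ → ℝ} {A : ℝ × ℝ → ℂ}
    (hs : ContDiffOn ℝ ∞ s e.source) (hs0 : ∀ t ∈ e.source, s t ≠ 0)
    (hη : ContDiffOn ℝ ∞ η e.source) (hA : ContDiffOn ℝ ∞ A (e.source ×ˢ Set.univ))
    (hA0 : ∀ q, A q ≠ 0) {Ω : Set (ℝ × ℝ)} (hΩ : IsOpen Ω) :
    ∃ Φ : PointTransformation, Φ.source = {z | z.1 ∈ e.source} ∩ equationDomain Ω ∧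
      (∀ z, Φ.toFun z = (e z.1, s z.1 * z.2.1 + η z.1, A (z.1, z.2.1) * z.2.2)) ∧
      Φ.target ⊆ equationDomain (e.target ×ˢ Set.univ) := by
  set f : ℝ × ℝ × ℂ → ℝ × ℝ × ℂ :=
    fun z => (e z.1, s z.1 * z.2.1 + η z.1, A (z.1, z.2.1) * z.2.2) with hf
  set X : ℝ × ℝ × ℂ → ℝ := fun z => (z.2.1 - η (e.symm z.1)) / s (e.symm z.1) with hX
  set g : ℝ × ℝ × ℂ → ℝ × ℝ × ℂ :=
    fun z => (e.symm z.1, X z, z.2.2 / A (e.symm z.1, X z)) with hg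
  set S : Set (ℝ × ℝ × ℂ) := {z | z.1 ∈ e.source} with hS
  set S' : Set (ℝ × ℝ × ℂ) := {z | z.1 ∈ e.target} with hS'
  have hSo : IsOpen S := e.open_source.preimage continuous_fst
  have hS'o : IsOpen S' := e.open_target.preimage continuous_fst
  have hfs : ContDiffOn ℝ ∞ f S := by
    have h1 : ContDiffOn ℝ ∞ (fun z : ℝ × ℝ × ℂ => z.1) S := contDiffOn_fst
    have h2 : ContDiffOn ℝ ∞ (fun z : ℝ × ℝ × ℂ => z.2.1) S := contDiffOn_snd.fst
    have h3 : ContDiffOn ℝ ∞ (fun z : ℝ × ℝ × ℂ => z.2.2) S := contDiffOn_snd.snd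
    have hmaps : Set.MapsTo (fun z : ℝ × ℝ × ℂ => z.1) S e.source := fun z hz => hz
    exact (he.comp h1 hmaps).prodMk ((((hs.comp h1 hmaps).mul h2).add (hη.comp h1 hmaps)).prodMk
      ((hA.comp (h1.prodMk h2) fun z hz => ⟨hz, Set.mem_univ _⟩).mul h3))
  have hgs : ContDiffOn ℝ ∞ g S' := by
    have h1 : ContDiffOn ℝ ∞ (fun z : ℝ × ℝ × ℂ => e.symm z.1) S' :=
      he'.comp contDiffOn_fst fun z hz => hz
    have h2 : ContDiffOn ℝ ∞ (fun z : ℝ × ℝ × ℂ => z.2.1) S' := contDiffOn_snd.fst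
    have h3 : ContDiffOn ℝ ∞ (fun z : ℝ × ℝ × ℂ => z.2.2) S' := contDiffOn_snd.snd
    have hmaps : Set.MapsTo (fun z : ℝ × ℝ × ℂ => e.symm z.1) S' e.source :=
      fun z hz => e.map_target hz
    have hXs : ContDiffOn ℝ ∞ X S' :=
      (h2.sub (hη.comp h1 hmaps)).div (hs.comp h1 hmaps) fun z hz => hs0 _ (hmaps hz)
    have hAs : ContDiffOn ℝ ∞ (fun z => (A (e.symm z.1, X z))⁻¹) S' :=
      (hA.comp (h1.prodMk hXs) fun z hz => ⟨hmaps hz, Set.mem_univ _⟩).inv fun z _ => hA0 _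
    simp only [hg, div_eq_mul_inv (_ : ℂ)]
    exact h1.prodMk (hXs.prodMk (h3.mul hAs))
  let F : OpenPartialHomeomorph (ℝ × ℝ × ℂ) (ℝ × ℝ × ℂ) :=
    { toFun := f
      invFun := g
      source := S
      target := S'
      map_source' := fun z hz => e.map_source hz
      map_target' := fun z hz => e.map_target hz
      left_inv' := by
        rintro ⟨t, x, a⟩ hz
        have h0 := hs0 t hz
        have h1 : (s t * x + η t - η t) / s t = x := by field_simp; ring
        simp only [hf, hg, hX, e.left_inv (show t ∈ e.source from hz), h1]
        rw [mul_div_cancel_left₀ _ (hA0 _)]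
      right_inv' := by
        rintro ⟨t, x, a⟩ hz
        have h0 := hs0 _ (e.map_target (show t ∈ e.target from hz))
        have h1 : s (e.symm t) * ((x - η (e.symm t)) / s (e.symm t)) + η (e.symm t) = x := by
          field_simp; ring
        simp only [hf, hg, hX, e.right_inv (show t ∈ e.target from hz), h1]
        rw [mul_div_cancel₀ _ (hA0 _)]
      open_source := hSo
      open_target := hS'o
      continuousOn_toFun := hfs.continuousOn
      continuousOn_invFun := hgs.continuousOn }
  have ho : IsOpen (equationDomain Ω) := by
    refine (hΩ.preimage basePointCLM.continuous).inter ?_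
    exact isOpen_ne_fun (by fun_prop) continuous_const
  refine ⟨⟨F.restrOpen _ ho, hfs.mono Set.inter_subset_left, hgs.mono Set.inter_subset_left⟩,
    rfl, fun z => rfl, ?_⟩
  rintro z hz
  have hz1 : z ∈ S' := hz.1
  have hz2 : g z ∈ equationDomain Ω := hz.2
  refine ⟨⟨hz1, Set.mem_univ _⟩, fun h0 => hz2.2 ?_⟩
  simp only [hg, h0, zero_div]

end PointTransformation

/-! ### Reduction by a solution of the linear equation -/

theorem exists_primitive {g : ℝ → ℝ} {t₀ ρ : ℝ} (hg : ContDiffOn ℝ ∞ g (Metric.ball t₀ ρ)) :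
    ∃ G : ℝ → ℝ, ContDiffOn ℝ ∞ G (Metric.ball t₀ ρ) ∧
      ∀ t ∈ Metric.ball t₀ ρ, HasDerivAt G (g t) t := by
  have hd : ∀ t ∈ Metric.ball t₀ ρ, HasDerivAt (fun t => ∫ τ in t₀..t, g τ) (g t) t := by
    intro t ht
    have h0 : t₀ ∈ Metric.ball t₀ ρ := Metric.mem_ball_self (Metric.pos_of_mem_ball ht)
    have hsub : Set.uIcc t₀ t ⊆ Metric.ball t₀ ρ :=
      (convex_ball t₀ ρ).ordConnected.uIcc_subset h0 ht
    exact intervalIntegral.integral_hasDerivAt_right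
      (hg.continuousOn.mono hsub).intervalIntegrable
      (hg.continuousOn.stronglyMeasurableAtFilter Metric.isOpen_ball t ht)
      (hg.continuousOn.continuousAt (Metric.isOpen_ball.mem_nhds ht))
  refine ⟨_, (contDiffOn_infty_iff_deriv_of_isOpen Metric.isOpen_ball).2
    ⟨fun t ht => (hd t ht).differentiableAt.differentiableWithinAt, ?_⟩, hd⟩
  exact hg.congr fun t ht => (hd t ht).deriv

/-- A smooth function on an interval with nonvanishing derivative is locally a diffeomorphism. -/
theorem exists_openPartialHomeomorph_of_hasDerivAt {T τ : ℝ → ℝ} {t₀ ρ : ℝ} (hρ : 0 < ρ)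
    (hT : ContDiffOn ℝ ∞ T (Metric.ball t₀ ρ))
    (hd : ∀ t ∈ Metric.ball t₀ ρ, HasDerivAt T (τ t) t ∧ τ t ≠ 0) :
    ∃ e : OpenPartialHomeomorph ℝ ℝ, t₀ ∈ e.source ∧ e.source ⊆ Metric.ball t₀ ρ ∧
      (∀ t, e t = T t) ∧ ContDiffOn ℝ ∞ e.symm e.target := by
  have ht₀ : t₀ ∈ Metric.ball t₀ ρ := Metric.mem_ball_self hρ
  have hC : ∀ t ∈ Metric.ball t₀ ρ, ContDiffAt ℝ ∞ T t := fun t ht =>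
    hT.contDiffAt (Metric.isOpen_ball.mem_nhds ht)
  have hD : HasFDerivAt T ((ContinuousLinearEquiv.unitsEquivAut ℝ
      (Units.mk0 (τ t₀) (hd t₀ ht₀).2) : ℝ ≃L[ℝ] ℝ) : ℝ →L[ℝ] ℝ) t₀ := by
    refine (hd t₀ ht₀).1.hasFDerivAt.congr_fderiv ?_
    ext
    simp
  let e₀ := (hC t₀ ht₀).toOpenPartialHomeomorph T hD (by simp)
  have he₀ : t₀ ∈ e₀.source := (hC t₀ ht₀).mem_toOpenPartialHomeomorph_source hD (by simp)
  refine ⟨e₀.restrOpen _ Metric.isOpen_ball, ⟨he₀, ht₀⟩, Set.inter_subset_right, fun t => rfl, ?_⟩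
  intro a ha
  have ha2 : e₀.symm a ∈ Metric.ball t₀ ρ := ha.2
  exact (e₀.contDiffAt_symm_deriv (hd _ ha2).2 ha.1 (hd _ ha2).1
    (hC _ ha2)).contDiffWithinAt

/-- The reduction of an equation with a quadratic potential to one with an `x`-free potential
that is defined by a positive solution `y` of `y'' = 4 v y`. -/
theorem potentialEquivNear_of_ode {γ : ℝ} (hγ : γ ≠ 0) {σ : ℂ} (hσ : σ ≠ 0) {Ω : Set (ℝ × ℝ)}
    (hΩ : IsOpen Ω) {v u w₁ w y y₁ : ℝ → ℝ} {t₀ ρ : ℝ} (hρ : 0 < ρ)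
    (hu : ContDiffOn ℝ ∞ u (Metric.ball t₀ ρ)) (hw₁ : ContDiffOn ℝ ∞ w₁ (Metric.ball t₀ ρ))
    (hy : ContDiffOn ℝ ∞ y (Metric.ball t₀ ρ)) (hy0 : ∀ t ∈ Metric.ball t₀ ρ, 0 < y t)
    (hyd : ∀ t ∈ Metric.ball t₀ ρ, HasDerivAt y (y₁ t) t)
    (hyd₁ : ∀ t ∈ Metric.ball t₀ ρ, HasDerivAt y₁ (4 * v t * y t) t) :
    ∃ e : OpenPartialHomeomorph ℝ ℝ, t₀ ∈ e.source ∧ e.source ⊆ Metric.ball t₀ ρ ∧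
      ContDiffOn ℝ ∞ e.symm e.target ∧ ∀ W : ℝ → ℂ,
      (∀ t ∈ e.source,
        W (e t) = Complex.I * ((y t ^ 2 * w t - 2 * gammaPrime γ * y t * y₁ t : ℝ) : ℂ)) →
      ∀ z ∈ equationDomain Ω, z.1 = t₀ → PotentialEquivNear γ σ Ω (quadraticPotential v u w₁ w)
        (e.target ×ˢ Set.univ) (fun q => W q.1) z := by
  set J := Metric.ball t₀ ρ with hJ
  have hJo : IsOpen J := Metric.isOpen_ball
  have hyn : ∀ t ∈ J, y t ≠ 0 := fun t ht => (hy0 t ht).ne'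
  have hy₁ : ContDiffOn ℝ ∞ y₁ J :=
    ((contDiffOn_infty_iff_deriv_of_isOpen hJo).1 hy).2.congr fun t ht => (hyd t ht).deriv.symm
  have hys : ContDiffOn ℝ ∞ (fun t => (y t)⁻¹) J := hy.inv hyn
  -- The choice is `s = 1 / y`, so `T' = s² = y⁻²`.
  obtain ⟨T, hTs, hTd⟩ := exists_primitive (hys.pow 2)
  -- Cancelling the term linear in `x` requires `m' = 2 k m - u` with `2 k = -y' / y`. The
  -- integrating factor `y` gives `(m y)' = -u y`, hence `m = -q / y` with `q' = u y`.
  obtain ⟨q, hqs, hqd⟩ := exists_primitive (hu.mul hy)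
  have hms : ContDiffOn ℝ ∞ (fun t => -q t / y t) J := hqs.neg.div hy hyn
  -- From `m = η' / (2 s)` and `s = 1 / y` one gets `η' = 2 m / y`.
  obtain ⟨η, hηs, hηd⟩ := exists_primitive ((contDiffOn_const (c := (2 : ℝ))).mul (hms.div hy hyn))
  -- The phase `θ` absorbs the real `x`-free part of the potential.
  obtain ⟨θ, hθs, hθd⟩ := exists_primitive ((hms.pow 2).sub hw₁)
  have hks : ContDiffOn ℝ ∞ (fun t => -y₁ t / (2 * y t)) J :=
    hy₁.neg.div (contDiffOn_const.mul hy) fun t ht => mul_ne_zero two_ne_zero (hyn t ht)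
  set m : ℝ → ℝ := fun t => -q t / y t with hm
  set k : ℝ → ℝ := fun t => -y₁ t / (2 * y t) with hk
  have hmd : ∀ t ∈ J, HasDerivAt m (-u t - m t * y₁ t / y t) t := by
    intro t ht
    have h0 := hyn t ht
    refine ((hqd t ht).neg.div (hyd t ht) h0).congr_deriv ?_
    simp only [hm, Pi.neg_apply]
    field_simp
  -- The Riccati form of `y'' = 4 v y`, which makes the term quadratic in `x` match `v`.
  have hkd : ∀ t ∈ J, HasDerivAt k (-2 * v t + 2 * k t ^ 2) t := by
    intro t ht
    have h0 := hyn t ht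
    refine ((hyd₁ t ht).neg.div ((hyd t ht).const_mul 2)
      (mul_ne_zero two_ne_zero h0)).congr_deriv ?_
    simp only [hk, Pi.neg_apply]
    field_simp
    ring
  obtain ⟨e, het, hes, heT, hesymm⟩ := exists_openPartialHomeomorph_of_hasDerivAt hρ hTs
    fun t ht => ⟨hTd t ht, pow_ne_zero 2 (inv_ne_zero (hyn t ht))⟩
  refine ⟨e, het, hes, hesymm, fun W hW z hz hzt => ?_⟩
  have hec : ContDiffOn ℝ ∞ e e.source := (hTs.mono hes).congr fun t _ => heT t
  -- `a` is the logarithm of the amplitude. Its real part is chosen so that `|exp a|^γ = y² = s⁻²`,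
  -- which allows the target coefficient to be `σ` itself.
  set a : ℝ × ℝ → ℂ := fun p => ((2 / γ * Real.log (y p.1) : ℝ) : ℂ) +
    Complex.I * ((θ p.1 + k p.1 * p.2 ^ 2 / 2 + m p.1 * p.2 : ℝ) : ℂ) with ha
  have has : ContDiffOn ℝ ∞ a (e.source ×ˢ Set.univ) := by
    have hmaps : Set.MapsTo (fun p : ℝ × ℝ => p.1) (e.source ×ˢ (Set.univ : Set ℝ)) J :=
      fun p hp => hes hp.1
    have h1 : ContDiffOn ℝ ∞ (fun p : ℝ × ℝ => p.1) (e.source ×ˢ Set.univ) := contDiffOn_fst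
    have h2 : ContDiffOn ℝ ∞ (fun p : ℝ × ℝ => p.2) (e.source ×ˢ Set.univ) := contDiffOn_snd
    have h3 : ContDiffOn ℝ ∞ (fun p : ℝ × ℝ => 2 / γ * Real.log (y p.1)) (e.source ×ˢ Set.univ) :=
      contDiffOn_const.mul ((hy.comp h1 hmaps).log fun p hp => hyn _ (hmaps hp))
    have h4 : ContDiffOn ℝ ∞ (fun p : ℝ × ℝ => θ p.1 + k p.1 * p.2 ^ 2 / 2 + m p.1 * p.2)
        (e.source ×ˢ Set.univ) :=
      ((hθs.comp h1 hmaps).add (((hks.comp h1 hmaps).mul (h2.pow 2)).div_const 2)).add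
        ((hms.comp h1 hmaps).mul h2)
    exact (Complex.ofRealCLM.contDiff.comp_contDiffOn h3).add
      (contDiffOn_const.mul (Complex.ofRealCLM.contDiff.comp_contDiffOn h4))
  obtain ⟨Φ, hΦs, hΦ, hΦt⟩ := PointTransformation.exists_of_amplitude (η := η)
    (A := fun p => Complex.exp (a p)) hec hesymm
    (hys.mono hes) (fun t ht => inv_ne_zero (hyn t (hes ht))) (hηs.mono hes)
    has.cexp (fun p => Complex.exp_ne_zero _) hΩ
  have hmem : ∀ z ∈ Φ.source, z.1 ∈ e.source := fun z hz => by
    rw [hΦs] at hz; exact hz.1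
  have hmemJ : ∀ z ∈ Φ.source, z.1 ∈ J := fun z hz => hes (hmem z hz)
  refine ⟨Φ, σ, hσ, ?_, ?_, hΦt, ?_⟩
  · rw [hΦs]; exact ⟨by rw [← hzt] at het; exact het, hz⟩
  · rw [hΦs]; exact Set.inter_subset_right
  refine PointTransformation.mapsEquation_of_amplitude (T := e) (η := η)
    (s := fun t => (y t)⁻¹) (A := fun p => Complex.exp (a p))
    (s₁ := fun t => -y₁ t / y t ^ 2) (η₁ := fun t => 2 * (m t / y t))
    (A₁ := fun p => Complex.exp (a p) * ((2 / γ * (y₁ p.1 / y p.1) : ℝ) + Complex.I *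
      (((m p.1 ^ 2 - w₁ p.1) + (-2 * v p.1 + 2 * k p.1 ^ 2) * p.2 ^ 2 / 2 +
        (-u p.1 - m p.1 * y₁ p.1 / y p.1) * p.2 : ℝ) : ℂ)))
    (fun z _ => hΦ z) (fun z hz => inv_ne_zero (hyn _ (hmemJ z hz))) (fun z hz => ?_)
    (fun z hz => (hyd _ (hmemJ z hz)).inv (hyn _ (hmemJ z hz))) (fun z hz => hηd _ (hmemJ z hz))
    (fun z _ => Complex.exp_ne_zero _) (fun z hz x => ?_) (fun z hz => ?_) (fun z hz => ?_)
    (fun z hz => ?_)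
  · refine (hTd _ (hmemJ z hz)).congr_of_eventuallyEq ?_
    exact Eventually.of_forall heT
  · have h0 := hyn _ (hmemJ z hz)
    have h1 : HasDerivAt (fun x => θ z.1 + k z.1 * x ^ 2 / 2 + m z.1 * x)
        (k z.1 * x + m z.1) x := by
      refine (((((hasDerivAt_id x).pow 2).const_mul (k z.1)).div_const 2).const_add (θ z.1)).add
        ((hasDerivAt_id x).const_mul (m z.1)) |>.congr_deriv ?_
      simp; ring
    have h3 : HasDerivAt (fun x => Complex.exp (a (z.1, x))) _ x :=
      ((h1.ofReal_comp.const_mul Complex.I).const_add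
        ((2 / γ * Real.log (y z.1) : ℝ) : ℂ)).cexp
    refine h3.congr_deriv ?_
    have h2 : (-y₁ z.1 / y z.1 ^ 2 * x + 2 * (m z.1 / y z.1)) / (2 * (y z.1)⁻¹) =
        k z.1 * x + m z.1 := by
      simp only [hk]; field_simp
    rw [h2, mul_comm]
  · have h0 := hyn _ (hmemJ z hz)
    have h1 := ((hyd _ (hmemJ z hz)).log h0).const_mul (2 / γ)
    have h2 := ((hθd _ (hmemJ z hz)).add
      ((((hkd _ (hmemJ z hz)).mul_const (z.2.1 ^ 2)).div_const 2))).add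
      ((hmd _ (hmemJ z hz)).mul_const z.2.1)
    exact (h1.ofReal_comp.add (h2.ofReal_comp.const_mul Complex.I)).cexp
  · have h0 := hy0 _ (hmemJ z hz)
    have h1 : ‖Complex.exp (a (z.1, z.2.1))‖ ^ γ = y z.1 ^ 2 := by
      rw [Complex.norm_exp]
      simp only [ha, Complex.add_re, Complex.ofReal_re, Complex.mul_re, Complex.I_re,
        Complex.I_im, Complex.ofReal_im, zero_mul, mul_zero, sub_zero, add_zero]
      rw [← Real.exp_mul, show 2 / γ * Real.log (y z.1) * γ = Real.log (y z.1 ^ 2) by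
        rw [Real.log_pow]; push_cast; field_simp, Real.exp_log (by positivity)]
    rw [h1]
    have h2 : (y z.1 : ℂ) ≠ 0 := Complex.ofReal_ne_zero.2 h0.ne'
    push_cast
    field_simp
  · have h0 := hyn _ (hmemJ z hz)
    have h2 : (-y₁ z.1 / y z.1 ^ 2 * z.2.1 + 2 * (m z.1 / y z.1)) / (2 * (y z.1)⁻¹) =
        k z.1 * z.2.1 + m z.1 := by
      simp only [hk]; field_simp
    have h3 : -y₁ z.1 / y z.1 ^ 2 / (2 * (y z.1)⁻¹) = k z.1 := by
      simp only [hk]; field_simp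
    simp only [h2, h3]
    have h4 : y₁ z.1 / y z.1 = -2 * k z.1 := by
      simp only [hk]; field_simp
    have h5 : m z.1 * y₁ z.1 / y z.1 = -2 * k z.1 * m z.1 := by
      rw [mul_div_assoc, h4]; ring
    rw [hW _ (hmem z hz), h4, h5]
    -- The prescribed target potential is `i s⁻² (w + 4 γ' k)`: the imaginary part that the
    -- amplitude does not absorb, rescaled by `s²`.
    have h6 : y z.1 ^ 2 * w z.1 - 2 * gammaPrime γ * y z.1 * y₁ z.1 =
        y z.1 ^ 2 * (w z.1 + 4 * gammaPrime γ * k z.1) := by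
      simp only [hk]; field_simp; ring
    have h7 : (((y z.1)⁻¹ ^ 2 : ℝ) : ℂ) *
        (Complex.I * ((y z.1 ^ 2 * (w z.1 + 4 * gammaPrime γ * k z.1) : ℝ) : ℂ)) =
        Complex.I * (w z.1 + 4 * gammaPrime γ * k z.1 : ℝ) := by
      rw [mul_left_comm, ← Complex.ofReal_mul]
      congr 2
      field_simp
    rw [h6, h7, quadraticPotential, gammaPrime]
    push_cast
    linear_combination Complex.exp (a (z.1, z.2.1)) * ((m z.1 ^ 2 - w₁ z.1) +
      (-2 * v z.1 + 2 * k z.1 ^ 2) * z.2.1 ^ 2 / 2 +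
      (-u z.1 + 2 * k z.1 * m z.1) * z.2.1 : ℂ) * Complex.I_mul_I

/-- Positive local solutions of the linear second order equation `y'' = 4 v y`. -/
theorem exists_pos_solution {v : ℝ → ℝ} {t₀ ρ : ℝ} (hρ : 0 < ρ)
    (hv : ContDiffOn ℝ ∞ v (Metric.ball t₀ ρ)) :
    ∃ r > 0, r ≤ ρ ∧ ∃ y y₁ : ℝ → ℝ, ContDiffOn ℝ ∞ y (Metric.ball t₀ r) ∧
      ContDiffOn ℝ ∞ y₁ (Metric.ball t₀ r) ∧ ∀ t ∈ Metric.ball t₀ r,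
        0 < y t ∧ HasDerivAt y (y₁ t) t ∧ HasDerivAt y₁ (4 * v t * y t) t := by
  have ht₀ : t₀ ∈ Metric.ball t₀ ρ := Metric.mem_ball_self hρ
  -- The equation is written as an autonomous system for `(t, y, y')`, started at `(t₀, 1, 0)`. The
  -- initial value `1` keeps `y` positive near `t₀`.
  have hF : ContDiffAt ℝ 1 (fun z : ℝ × ℝ × ℝ => ((1, z.2.2, 4 * v z.1 * z.2.1) : ℝ × ℝ × ℝ))
      (t₀, 1, 0) := by
    have h1 : ContDiffAt ℝ 1 v t₀ :=
      (hv.contDiffAt (Metric.isOpen_ball.mem_nhds ht₀)).of_le (by simp)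
    have h2 : ContDiffAt ℝ 1 (fun z : ℝ × ℝ × ℝ => v z.1) (t₀, 1, 0) :=
      ContDiffAt.comp (g := v) (t₀, 1, 0) h1 contDiffAt_fst
    exact contDiffAt_const.prodMk (contDiffAt_snd.snd.prodMk
      ((contDiffAt_const.mul h2).mul contDiffAt_snd.fst))
  obtain ⟨α, hα₀, ε, hε, hα⟩ :=
    hF.exists_forall_mem_closedBall_exists_eq_forall_mem_Ioo_hasDerivAt₀ t₀
  have hα' : ∀ t ∈ Metric.ball t₀ ε, HasDerivAt α (1, (α t).2.2, 4 * v (α t).1 * (α t).2.1) t :=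
    fun t ht => hα t (by rwa [Real.ball_eq_Ioo] at ht)
  have hfst : ∀ t ∈ Metric.ball t₀ ε, (α t).1 = t := by
    intro t ht
    have hd : ∀ t ∈ Metric.ball t₀ ε, HasDerivAt (fun t => (α t).1 - t) 0 t := fun t ht =>
      ((hα' t ht).prod_fst.sub (hasDerivAt_id t)).congr_deriv (sub_self 1)
    have h1 := Metric.isOpen_ball.is_const_of_deriv_eq_zero (f := fun t => (α t).1 - t)
      (convex_ball t₀ ε).isPreconnected
      (fun t ht => (hd t ht).differentiableAt.differentiableWithinAt)
      (fun t ht => (hd t ht).deriv) ht (Metric.mem_ball_self hε)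
    simp only [hα₀, sub_self] at h1
    exact sub_eq_zero.1 h1
  have hpos : ∀ᶠ t in 𝓝 t₀, 0 < (α t).2.1 := by
    have h1 := (hα' t₀ (Metric.mem_ball_self hε)).continuousAt.snd.fst
    refine h1.eventually (lt_mem_nhds ?_)
    simp only [hα₀, one_pos]
  obtain ⟨δ, hδ, hδpos⟩ := Metric.eventually_nhds_iff_ball.1 hpos
  set r := min ρ (min ε δ) with hr
  have hr0 : 0 < r := lt_min hρ (lt_min hε hδ)
  have hrε : Metric.ball t₀ r ⊆ Metric.ball t₀ ε :=
    Metric.ball_subset_ball ((min_le_right _ _).trans (min_le_left _ _))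
  have hrδ : Metric.ball t₀ r ⊆ Metric.ball t₀ δ :=
    Metric.ball_subset_ball ((min_le_right _ _).trans (min_le_right _ _))
  have hvr : ContDiffOn ℝ ∞ v (Metric.ball t₀ r) :=
    hv.mono (Metric.ball_subset_ball (min_le_left _ _))
  have hd : ∀ t ∈ Metric.ball t₀ r, HasDerivAt (fun t => (α t).2.1) (α t).2.2 t := fun t ht =>
    (hα' t (hrε ht)).prod_snd.prod_fst
  have hd₁ : ∀ t ∈ Metric.ball t₀ r,
      HasDerivAt (fun t => (α t).2.2) (4 * v t * (α t).2.1) t := fun t ht => by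
    have h1 := (hα' t (hrε ht)).prod_snd.prod_snd
    simp only [hfst t (hrε ht)] at h1
    exact h1
  -- Bootstrapping: the derivatives of `y` and `y'` are `y'` and `4 v y`, so each order of
  -- smoothness yields the next.
  have hsmooth : ∀ n : ℕ, ContDiffOn ℝ n (fun t => (α t).2.1) (Metric.ball t₀ r) ∧
      ContDiffOn ℝ n (fun t => (α t).2.2) (Metric.ball t₀ r) := by
    intro n
    induction n with
    | zero =>
      simp only [Nat.cast_zero, contDiffOn_zero]
      exact ⟨fun t ht => (hd t ht).continuousAt.continuousWithinAt,
        fun t ht => (hd₁ t ht).continuousAt.continuousWithinAt⟩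
    | succ n ih =>
      push_cast
      refine ⟨(contDiffOn_succ_iff_deriv_of_isOpen Metric.isOpen_ball).2
          ⟨fun t ht => (hd t ht).differentiableAt.differentiableWithinAt, by simp,
            ih.2.congr fun t ht => (hd t ht).deriv⟩,
        (contDiffOn_succ_iff_deriv_of_isOpen Metric.isOpen_ball).2
          ⟨fun t ht => (hd₁ t ht).differentiableAt.differentiableWithinAt, by simp,
            ((contDiffOn_const.mul (hvr.of_le (by exact_mod_cast le_top))).mul ih.1).congr
              fun t ht => (hd₁ t ht).deriv⟩⟩
  exact ⟨r, hr0, min_le_left _ _, _, _, contDiffOn_infty.2 fun n => (hsmooth n).1,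
    contDiffOn_infty.2 fun n => (hsmooth n).2,
    fun t ht => ⟨hδpos t (hrδ ht), hd t ht, hd₁ t ht⟩⟩

/-! ### From local to global coefficients -/

theorem PotentialEquivNear.congr {γ : ℝ} {σ : ℂ} {Ω Ω₁ Ω₂ : Set (ℝ × ℝ)} {V₁ V₂ V₁' V₂' : ℝ × ℝ → ℂ}
    {z : ℝ × ℝ × ℂ} (h : PotentialEquivNear γ σ Ω V₁ Ω₁ V₁' z) (hV : ∀ p ∈ Ω, V₁ p = V₂ p)
    (hΩ : Ω₁ ⊆ Ω₂) (hV' : ∀ p ∈ Ω₁, V₁' p = V₂' p) : PotentialEquivNear γ σ Ω V₂ Ω₂ V₂' z := by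
  obtain ⟨Φ, σ', hσ', hz, hs, ht, hE⟩ := h
  refine ⟨Φ, σ', hσ', hz, hs, fun z hz => ⟨hΩ (ht hz).1, (ht hz).2⟩, fun ψ ψ' p hc => ?_⟩
  have h1 := hE ψ ψ' p hc
  have h2 : p ∈ Ω := (hs hc.1).1
  rw [nlsExpr, nlsExpr, hV p h2, hV' _ (ht (Φ.map_source' hc.1)).1] at h1
  exact h1

/-- A function on a plane domain with connected vertical sections which locally is a smooth function
of the first variable is a smooth function of the first variable. -/
theorem exists_eq_comp_fst {E : Type*} [NormedAddCommGroup E] [NormedSpace ℝ E] {Ω : Set (ℝ × ℝ)}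
    (hΩ : IsOpen Ω) (hΩx : ∀ t : ℝ, {x : ℝ | (t, x) ∈ Ω}.OrdConnected) {D : ℝ × ℝ → E}
    (h : ∀ p ∈ Ω, ∃ r > 0, ∃ g : ℝ → E, ContDiffOn ℝ ∞ g (Metric.ball p.1 r) ∧
      ∀ t ∈ Metric.ball p.1 r, ∀ x ∈ Metric.ball p.2 r, D (t, x) = g t) :
    ∃ G : ℝ → E, ContDiffOn ℝ ∞ G (Prod.fst '' Ω) ∧ ∀ p ∈ Ω, D p = G p.1 := by
  have hconst : ∀ {t x y}, (t, x) ∈ Ω → (t, y) ∈ Ω → D (t, x) = D (t, y) := by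
    intro t x y hx hy
    have hd : ∀ x ∈ {x : ℝ | (t, x) ∈ Ω}, HasDerivAt (fun x => D (t, x)) 0 x := by
      intro x hx
      obtain ⟨r, hr, g, -, hg⟩ := h _ hx
      refine (hasDerivAt_const x (g t)).congr_of_eventuallyEq ?_
      filter_upwards [Metric.ball_mem_nhds x hr] with y hy
      exact hg t (Metric.mem_ball_self hr) y hy
    exact (hΩ.preimage (by fun_prop : Continuous fun x : ℝ => (t, x))).is_const_of_deriv_eq_zero
      (f := fun x => D (t, x)) (hΩx t).isPreconnected
      (fun x hx => (hd x hx).differentiableAt.differentiableWithinAt)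
      (fun x hx => (hd x hx).deriv) hx hy
  have hsec : ∀ t ∈ Prod.fst '' Ω, ∃ x : ℝ, (t, x) ∈ Ω := by
    rintro _ ⟨⟨t, x⟩, hp, rfl⟩
    exact ⟨x, hp⟩
  -- The selection `X` need not be continuous. Because `D` is constant on each section, near `t₀`
  -- the value at `X t` may be replaced by the value at a fixed `x₀`, where `D` is smooth in `t`.
  choose! X hX using hsec
  have hG : ∀ p ∈ Ω, D p = D (p.1, X p.1) := fun p hp =>
    hconst hp (hX p.1 (Set.mem_image_of_mem _ hp))
  refine ⟨fun t => D (t, X t), ?_, hG⟩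
  rintro t₀ ⟨⟨t₀, x₀⟩, hp, rfl⟩
  obtain ⟨r, hr, g, hgs, hg⟩ := h _ hp
  refine ContDiffAt.contDiffWithinAt ((hgs.contDiffAt
    (Metric.ball_mem_nhds t₀ hr)).congr_of_eventuallyEq ?_)
  have h1 : ∀ᶠ t in 𝓝 t₀, (t, x₀) ∈ Ω :=
    (by fun_prop : ContinuousAt (fun t : ℝ => (t, x₀)) t₀).eventually (hΩ.mem_nhds hp)
  filter_upwards [h1, Metric.ball_mem_nhds t₀ hr] with t ht htr
  rw [← hg t htr x₀ (Metric.mem_ball_self hr), ← hG _ ht]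

/-- The local coefficients are recovered from `V` by differentiation in `x`, so they do not depend
on the chosen transformation or neighbourhood. They therefore glue to functions `D₂, D₁, D₀` on `Ω`
that depend locally on `t` only, and the interval sections make this global. -/
theorem exists_quadraticPotential {γ : ℝ} (hγ : γ ≠ 0) {σ : ℂ} (hσ : σ ≠ 0) {Ω : Set (ℝ × ℝ)}
    (hΩ : IsOpen Ω) (hΩx : ∀ t : ℝ, {x : ℝ | (t, x) ∈ Ω}.OrdConnected) {V : ℝ × ℝ → ℂ}
    (hV : ContDiffOn ℝ ∞ V Ω) (h : TransformableToXFree γ σ Ω V) :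
    ∃ v u w₁ w : ℝ → ℝ,
      ContDiffOn ℝ ∞ v (Prod.fst '' Ω) ∧ ContDiffOn ℝ ∞ u (Prod.fst '' Ω) ∧
      ContDiffOn ℝ ∞ w₁ (Prod.fst '' Ω) ∧ ContDiffOn ℝ ∞ w (Prod.fst '' Ω) ∧
      ∀ p ∈ Ω, V p = quadraticPotential v u w₁ w p := by
  set D₂ : ℝ × ℝ → ℝ := fun p => (iteratedDeriv 2 (fun x => V (p.1, x)) p.2).re / 2 with hD₂
  set D₁ : ℝ × ℝ → ℝ := fun p => (deriv (fun x => V (p.1, x)) p.2).re - 2 * D₂ p * p.2 with hD₁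
  set D₀ : ℝ × ℝ → ℂ := fun p => V p - ((D₂ p * p.2 ^ 2 + D₁ p * p.2 : ℝ) : ℂ) with hD₀
  have hloc : ∀ p ∈ Ω, ∃ r > 0, ∃ (v u : ℝ → ℝ) (f : ℝ → ℂ), ContDiffOn ℝ ∞ v (Metric.ball p.1 r) ∧
      ContDiffOn ℝ ∞ u (Metric.ball p.1 r) ∧ ContDiffOn ℝ ∞ f (Metric.ball p.1 r) ∧
      ∀ t ∈ Metric.ball p.1 r, ∀ x ∈ Metric.ball p.2 r,
        D₂ (t, x) = v t ∧ D₁ (t, x) = u t ∧ D₀ (t, x) = f t := by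
    rintro ⟨t₀, x₀⟩ hp
    obtain ⟨K, W, -, -, hW⟩ := h (t₀, x₀, 1) ⟨hp, one_ne_zero⟩
    obtain ⟨r₁, hr₁, v, u, f, hv, hu, hVr⟩ :=
      PointTransformation.exists_quadratic_of_potentialEquivNear hγ hσ hW
    obtain ⟨r₂, hr₂, hrΩ⟩ := Metric.isOpen_iff.1 hΩ _ hp
    have hr : 0 < min r₁ r₂ := lt_min hr₁ hr₂
    have hb₁ : ∀ c : ℝ, Metric.ball c (min r₁ r₂) ⊆ Metric.ball c r₁ := fun c =>
      Metric.ball_subset_ball (min_le_left _ _)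
    have hb₂ : ∀ c : ℝ, Metric.ball c (min r₁ r₂) ⊆ Metric.ball c r₂ := fun c =>
      Metric.ball_subset_ball (min_le_right _ _)
    have hx₀ : x₀ ∈ Metric.ball x₀ (min r₁ r₂) := Metric.mem_ball_self hr
    -- The local reduction gives no smoothness of `f`. It is inherited from `V` along the line `x =
    -- x₀`.
    have hfs : ContDiffOn ℝ ∞ f (Metric.ball t₀ (min r₁ r₂)) := by
      have h1 : ContDiffOn ℝ ∞ (fun t => V (t, x₀)) (Metric.ball t₀ (min r₁ r₂)) := by
        refine hV.comp (contDiffOn_id.prodMk contDiffOn_const) fun t ht => hrΩ ?_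
        rw [← ball_prod_same]
        exact ⟨hb₂ _ ht, hb₂ _ hx₀⟩
      have h2 : ContDiffOn ℝ ∞ (fun t => v t * x₀ ^ 2 + u t * x₀) (Metric.ball t₀ (min r₁ r₂)) :=
        ((hv.mono (hb₁ _)).mul contDiffOn_const).add ((hu.mono (hb₁ _)).mul contDiffOn_const)
      refine (h1.sub (Complex.ofRealCLM.contDiff.comp_contDiffOn h2)).congr fun t ht => ?_
      rw [hVr t (hb₁ _ ht) x₀ (hb₁ _ hx₀)]
      simp
    refine ⟨min r₁ r₂, hr, v, u, f, hv.mono (hb₁ _), hu.mono (hb₁ _), hfs, fun t ht x hx => ?_⟩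
    have hderiv : ∀ y ∈ Metric.ball x₀ r₁,
        HasDerivAt (fun x => V (t, x)) ((2 * v t * y + u t : ℝ) : ℂ) y := by
      intro y hy
      have h1 : HasDerivAt (fun x => v t * x ^ 2 + u t * x) (2 * v t * y + u t) y := by
        refine ((((hasDerivAt_id y).pow 2).const_mul (v t)).add
          ((hasDerivAt_id y).const_mul (u t))).congr_deriv ?_
        simp; ring
      refine (h1.ofReal_comp.add_const (f t)).congr_of_eventuallyEq ?_
      filter_upwards [Metric.isOpen_ball.mem_nhds hy] with y hy
      exact hVr t (hb₁ _ ht) y hy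
    have h2 : iteratedDeriv 2 (fun x => V (t, x)) x = ((2 * v t : ℝ) : ℂ) := by
      refine iteratedDeriv_two_eq (g' := fun y => ((2 * v t * y + u t : ℝ) : ℂ)) ?_ ?_
      · filter_upwards [Metric.isOpen_ball.mem_nhds (hb₁ _ hx)] with y hy
        exact hderiv y hy
      · have h1 : HasDerivAt (fun y => 2 * v t * y + u t) (2 * v t) x := by
          simpa using ((hasDerivAt_id x).const_mul (2 * v t)).add_const (u t)
        exact h1.ofReal_comp
    have e₂ : D₂ (t, x) = v t := by
      simp only [hD₂, h2, Complex.ofReal_re]; ring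
    have e₁ : D₁ (t, x) = u t := by
      simp only [hD₁, (hderiv x (hb₁ _ hx)).deriv, Complex.ofReal_re, e₂]; ring
    refine ⟨e₂, e₁, ?_⟩
    simp only [hD₀, e₂, e₁]
    rw [hVr t (hb₁ _ ht) x (hb₁ _ hx), add_sub_cancel_left]
  obtain ⟨v, hv, hv'⟩ := exists_eq_comp_fst (D := D₂) hΩ hΩx fun p hp => by
    obtain ⟨r, hr, v, u, f, hv, hu, hf, hD⟩ := hloc p hp
    exact ⟨r, hr, v, hv, fun t ht x hx => (hD t ht x hx).1⟩
  obtain ⟨u, hu, hu'⟩ := exists_eq_comp_fst (D := D₁) hΩ hΩx fun p hp => by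
    obtain ⟨r, hr, v, u, f, hv, hu, hf, hD⟩ := hloc p hp
    exact ⟨r, hr, u, hu, fun t ht x hx => (hD t ht x hx).2.1⟩
  obtain ⟨f, hf, hf'⟩ := exists_eq_comp_fst (D := D₀) hΩ hΩx fun p hp => by
    obtain ⟨r, hr, v, u, f, hv, hu, hf, hD⟩ := hloc p hp
    exact ⟨r, hr, f, hf, fun t ht x hx => (hD t ht x hx).2.2⟩
  refine ⟨v, u, fun t => (f t).re, fun t => (f t).im, hv, hu,
    Complex.reCLM.contDiff.comp_contDiffOn hf, Complex.imCLM.contDiff.comp_contDiffOn hf,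
    fun p hp => ?_⟩
  have h1 : V p = ((v p.1 * p.2 ^ 2 + u p.1 * p.2 : ℝ) : ℂ) + f p.1 := by
    rw [← hv' p hp, ← hu' p hp, ← hf' p hp]
    simp only [hD₀]; ring
  rw [h1, quadraticPotential]
  push_cast
  linear_combination -Complex.re_add_im (f p.1)

/-! ### Sufficiency in the three claims -/

/-- A quadratic potential near a point over which a suitable solution of `y'' = 4 v y` exists can be
made to vanish. -/
theorem potentialEquivNear_zero_of_ode {γ : ℝ} (hγ : γ ≠ 0) {σ : ℂ} (hσ : σ ≠ 0) {Ω : Set (ℝ × ℝ)}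
    (hΩ : IsOpen Ω) {v u w₁ w y y₁ : ℝ → ℝ} {z : ℝ × ℝ × ℂ} (hz : z ∈ equationDomain Ω) {ρ : ℝ}
    (hρ : 0 < ρ) (hu : ContDiffOn ℝ ∞ u (Metric.ball z.1 ρ))
    (hw₁ : ContDiffOn ℝ ∞ w₁ (Metric.ball z.1 ρ))
    (hy : ContDiffOn ℝ ∞ y (Metric.ball z.1 ρ)) (hy0 : ∀ t ∈ Metric.ball z.1 ρ, 0 < y t)
    (hyd : ∀ t ∈ Metric.ball z.1 ρ, HasDerivAt y (y₁ t) t)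
    (hyd₁ : ∀ t ∈ Metric.ball z.1 ρ, HasDerivAt y₁ (4 * v t * y t) t)
    (hw : ∀ t ∈ Metric.ball z.1 ρ, y t ^ 2 * w t - 2 * gammaPrime γ * y t * y₁ t = 0) :
    PotentialEquivNear γ σ Ω (quadraticPotential v u w₁ w) Set.univ (fun _ => 0) z := by
  obtain ⟨e, -, hes, -, he⟩ := potentialEquivNear_of_ode (w := w) hγ hσ hΩ hρ hu hw₁ hy hy0 hyd hyd₁
  refine (he (fun _ => 0) (fun t ht => ?_) z hz rfl).congr (fun _ _ => rfl) (Set.subset_univ _)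
    fun _ _ => rfl
  rw [hw t (hes ht), Complex.ofReal_zero, mul_zero]

theorem gammaPrime_ne_zero {γ : ℝ} (hγ : γ ≠ 0) (hγ₄ : γ ≠ 4) : gammaPrime γ ≠ 0 := by
  intro h
  rw [gammaPrime] at h
  field_simp at h
  exact hγ₄ (by linarith)

theorem exists_ball_subset_fst_image {Ω : Set (ℝ × ℝ)} (hΩ : IsOpen Ω) {z : ℝ × ℝ × ℂ}
    (hz : z ∈ equationDomain Ω) :
    ∃ ρ > 0, Metric.ball z.1 ρ ⊆ Prod.fst '' Ω :=
  Metric.isOpen_iff.1 (isOpenMap_fst _ hΩ) z.1 (Set.mem_image_of_mem Prod.fst hz.1)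

/-- Any positive local solution of `y'' = 4 v y` serves. The imaginary remainder is a function of
`t` alone and becomes the new potential after inverting the time change. -/
theorem transformableToXFree_quadraticPotential {γ : ℝ} (hγ : γ ≠ 0) {σ : ℂ} (hσ : σ ≠ 0)
    {Ω : Set (ℝ × ℝ)} (hΩ : IsOpen Ω) {v u w₁ w : ℝ → ℝ} (hv : ContDiffOn ℝ ∞ v (Prod.fst '' Ω))
    (hu : ContDiffOn ℝ ∞ u (Prod.fst '' Ω)) (hw₁ : ContDiffOn ℝ ∞ w₁ (Prod.fst '' Ω))
    (hw : ContDiffOn ℝ ∞ w (Prod.fst '' Ω)) :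
    TransformableToXFree γ σ Ω (quadraticPotential v u w₁ w) := by
  intro z hz
  obtain ⟨ρ, hρ, hball⟩ := exists_ball_subset_fst_image hΩ hz
  obtain ⟨r, hr, hrρ, y, y₁, hy, hy₁, hode⟩ := exists_pos_solution hρ (hv.mono hball)
  have hr' : Metric.ball z.1 r ⊆ Prod.fst '' Ω := (Metric.ball_subset_ball hrρ).trans hball
  obtain ⟨e, -, hes, hesymm, he⟩ := potentialEquivNear_of_ode (w := w) hγ hσ hΩ hr (hu.mono hr')
    (hw₁.mono hr') hy (fun t ht => (hode t ht).1) (fun t ht => (hode t ht).2.1)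
    (fun t ht => (hode t ht).2.2)
  have hgs : ContDiffOn ℝ ∞ (fun t => y t ^ 2 * w t - 2 * gammaPrime γ * y t * y₁ t)
      (Metric.ball z.1 r) :=
    ((hy.pow 2).mul (hw.mono hr')).sub ((contDiffOn_const.mul hy).mul hy₁)
  set W : ℝ → ℂ := fun τ => Complex.I * ((y (e.symm τ) ^ 2 * w (e.symm τ) -
    2 * gammaPrime γ * y (e.symm τ) * y₁ (e.symm τ) : ℝ) : ℂ) with hW
  refine ⟨e.target, W, e.open_target, ?_, he W (fun t ht => ?_) z hz rfl⟩
  · exact contDiffOn_const.mul (Complex.ofRealCLM.contDiff.comp_contDiffOn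
      (hgs.comp hesymm fun τ hτ => hes (e.map_target hτ)))
  · simp only [hW, e.left_inv ht]

/-- For `γ = 4` one has `γ' = 0`, so with `w = 0` the remainder `y² w - 2 γ' y y'` vanishes for
every positive solution `y`. -/
theorem equivalentToZero_of_real {γ : ℝ} (hγ : γ ≠ 0) {σ : ℂ} (hσ : σ ≠ 0)
    {Ω : Set (ℝ × ℝ)} (hΩ : IsOpen Ω) {v u w₁ : ℝ → ℝ} (hv : ContDiffOn ℝ ∞ v (Prod.fst '' Ω))
    (hu : ContDiffOn ℝ ∞ u (Prod.fst '' Ω)) (hw₁ : ContDiffOn ℝ ∞ w₁ (Prod.fst '' Ω))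
    (hγ₄ : γ = 4) :
    EquivalentToZero γ σ Ω (quadraticPotential v u w₁ fun _ => 0) := by
  intro z hz
  obtain ⟨ρ, hρ, hball⟩ := exists_ball_subset_fst_image hΩ hz
  obtain ⟨r, hr, hrρ, y, y₁, hy, -, hode⟩ := exists_pos_solution hρ (hv.mono hball)
  have hr' : Metric.ball z.1 r ⊆ Prod.fst '' Ω := (Metric.ball_subset_ball hrρ).trans hball
  refine potentialEquivNear_zero_of_ode hγ hσ hΩ hz hr (hu.mono hr') (hw₁.mono hr') hy
    (fun t ht => (hode t ht).1) (fun t ht => (hode t ht).2.1) (fun t ht => (hode t ht).2.2)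
    fun t _ => ?_
  rw [gammaPrime, hγ₄]
  norm_num

/-- The remainder vanishes exactly when `y' / y = w / (2 γ')`, which suggests `y = exp ∫ w / (2
γ')`. Then `y'' / y = w' / (2 γ') + w² / (4 γ'²)`, and the assumed condition equates this with `4
v`. -/
theorem equivalentToZero_of_condition {γ : ℝ} (hγ : γ ≠ 0) {σ : ℂ} (hσ : σ ≠ 0)
    {Ω : Set (ℝ × ℝ)} (hΩ : IsOpen Ω) {v u w₁ w : ℝ → ℝ}
    (hu : ContDiffOn ℝ ∞ u (Prod.fst '' Ω)) (hw₁ : ContDiffOn ℝ ∞ w₁ (Prod.fst '' Ω))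
    (hw : ContDiffOn ℝ ∞ w (Prod.fst '' Ω)) (hγ₄ : γ ≠ 4)
    (hc : ∀ t ∈ Prod.fst '' Ω,
      16 * gammaPrime γ ^ 2 * v t = 2 * gammaPrime γ * deriv w t + w t ^ 2) :
    EquivalentToZero γ σ Ω (quadraticPotential v u w₁ w) := by
  intro z hz
  obtain ⟨ρ, hρ, hball⟩ := exists_ball_subset_fst_image hΩ hz
  have hγ' := gammaPrime_ne_zero hγ hγ₄
  have hwd : ∀ t ∈ Metric.ball z.1 ρ, HasDerivAt w (deriv w t) t := fun t ht =>
    (((hw.mono hball).contDiffAt (Metric.isOpen_ball.mem_nhds ht)).differentiableAt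
      (by simp)).hasDerivAt
  obtain ⟨G, hG, hGd⟩ := exists_primitive ((hw.mono hball).div_const (2 * gammaPrime γ))
  have hyd : ∀ t ∈ Metric.ball z.1 ρ, HasDerivAt (fun t => Real.exp (G t))
      (Real.exp (G t) * (w t / (2 * gammaPrime γ))) t := fun t ht => (hGd t ht).exp
  refine potentialEquivNear_zero_of_ode hγ hσ hΩ hz hρ (hu.mono hball) (hw₁.mono hball)
    hG.exp (fun t _ => Real.exp_pos _) hyd (fun t ht => ?_) fun t _ => ?_
  · refine ((hyd t ht).mul ((hwd t ht).div_const (2 * gammaPrime γ))).congr_deriv ?_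
    have h1 := hc t (hball ht)
    field_simp
    linear_combination -h1
  · field_simp
    ring

end

theorem mainTheorem10 (γ : ℝ) (hγ : γ ≠ 0) (σ : ℂ) (hσ : σ ≠ 0)
    (Ω : Set (ℝ × ℝ)) (hΩ : IsOpen Ω) (hΩx : ∀ t : ℝ, {x : ℝ | (t, x) ∈ Ω}.OrdConnected) :
    -- potentials that can be transformed to `x`-free ones
    (∀ V : ℝ × ℝ → ℂ, ContDiffOn ℝ ∞ V Ω →
      (TransformableToXFree γ σ Ω V ↔
        ∃ v u w₁ w : ℝ → ℝ,
          ContDiffOn ℝ ∞ v (Prod.fst '' Ω) ∧ ContDiffOn ℝ ∞ u (Prod.fst '' Ω) ∧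
          ContDiffOn ℝ ∞ w₁ (Prod.fst '' Ω) ∧ ContDiffOn ℝ ∞ w (Prod.fst '' Ω) ∧
          ∀ p ∈ Ω, V p = quadraticPotential v u w₁ w p)) ∧
    -- for `γ = 4` every real-valued quadratic potential can be made to vanish
    (γ = 4 → ∀ v u w₁ : ℝ → ℝ,
      ContDiffOn ℝ ∞ v (Prod.fst '' Ω) → ContDiffOn ℝ ∞ u (Prod.fst '' Ω) →
      ContDiffOn ℝ ∞ w₁ (Prod.fst '' Ω) →
      EquivalentToZero γ σ Ω (quadraticPotential v u w₁ (fun _ => 0))) ∧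
    -- for `γ ≠ 4` the potentials equivalent to zero
    (γ ≠ 4 → ∀ v u w₁ w : ℝ → ℝ,
      ContDiffOn ℝ ∞ v (Prod.fst '' Ω) → ContDiffOn ℝ ∞ u (Prod.fst '' Ω) →
      ContDiffOn ℝ ∞ w₁ (Prod.fst '' Ω) → ContDiffOn ℝ ∞ w (Prod.fst '' Ω) →
      (EquivalentToZero γ σ Ω (quadraticPotential v u w₁ w) ↔
        ∀ t ∈ Prod.fst '' Ω,
          16 * gammaPrime γ ^ 2 * v t = 2 * gammaPrime γ * deriv w t + w t ^ 2)) := by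
  refine ⟨fun V hV => ⟨exists_quadraticPotential hγ hσ hΩ hΩx hV, ?_⟩, fun hγ₄ v u w₁ hv hu hw₁ =>
    equivalentToZero_of_real hγ hσ hΩ hv hu hw₁ hγ₄, fun hγ₄ v u w₁ w _ hu hw₁ hw =>
    ⟨fun h => ?_, equivalentToZero_of_condition hγ hσ hΩ hu hw₁ hw hγ₄⟩⟩
  · rintro ⟨v, u, w₁, w, hv, hu, hw₁, hw, hVq⟩ z hz
    obtain ⟨K, W, hK, hW, hE⟩ :=
      transformableToXFree_quadraticPotential hγ hσ hΩ hv hu hw₁ hw z hz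
    exact ⟨K, W, hK, hW, hE.congr (fun p hp => (hVq p hp).symm) subset_rfl fun _ _ => rfl⟩
  · rintro _ ⟨⟨t, x⟩, hp, rfl⟩
    -- One point over each `t` suffices, since the condition involves `t` only. The field value `1`
    -- is an arbitrary nonzero choice.
    exact PointTransformation.condition_of_equiv_zero hγ hσ (h (t, x, 1) ⟨hp, one_ne_zero⟩)
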